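/- **Theorem (Asymptotic p.d.f.s of random time delay, lensing map, and shear).** Fix a mass $m>0$, a continuous matter density $\kappa_c\ge 0$, an external shear $\gamma\ge 0$, and points ${\bf y}\in\mathbb R^2$ and ${\bf x}=(u,v)\in\mathbb R^2$. For $g\in\mathbb N$ let $R=\sqrt{g/\pi}$, and let ${\boldsymbol\xi}_1,\dots,{\boldsymbol\xi}_g$, with ${\boldsymbol\xi}_j=(U_j,V_j)$, be independent and uniformly distributed over the closed disc $B({\bf 0},R)$ (which contains ${\bf x}$ for all large $g$). Put $\kappa_*=\pi m$ and $$d_1=\tfrac12|{\bf x}-{\bf y}|^2-\tfrac{\kappa_c}{2}|{\bf x}|^2+\tfrac{\gamma}{2}(u^2-v^2),\qquad c=-\tfrac{1}{2}\kappa_*|{\bf x}|^2,$$ $$T^*_{g,{\bf y}}({\bf x})=d_1-\sum_{j=1}^g m\log|{\bf x}-{\boldsymbol\xi}_j|+g\,m\log R,$$ $${\boldsymbol\eta}_g({\bf x})=\big((1-\kappa_c+\gamma)u,(1-\kappa_c-\gamma)v\big)-\sum_{j=1}^g m\frac{{\bf x}-{\boldsymbol\xi}_j}{|{\bf x}-{\boldsymbol\xi}_j|^2},\qquad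 {\boldsymbol\eta}^*_g({\bf x})=\frac{{\boldsymbol\eta}_g({\bf x})}{\sqrt{\log g}},$$ $$\Gamma_{1,g}({\bf x})=\sum_{j=1}^g\frac{m[(U_j-u)^2-(V_j-v)^2]}{[(U_j-u)^2+(V_j-v)^2]^2},\qquad \Gamma_{2,g}({\bf x})=\sum_{j=1}^g\frac{2m(U_j-u)(V_j-v)}{[(U_j-u)^2+(V_j-v)^2]^2}.$$ For all large $g$ the random quantities below have probability density functions, and these satisfy the following as $g\to\infty$. The equalities hold for almost every argument, and every $O(\cdot)$ is uniform in the argument of the density, with a constant that may depend on $m,\kappa_c,\gamma,{\bf x},{\bf y}$. 1. (Normalized time delay.) $f_{T^*_{g,{\bf y}}({\bf x})}(t)=p_g(t)+O(g^{-3/2})$, where $p_g$ is the shifted Gamma density $$p_g(t)=\Big(\frac2m\Big)^g\frac{(t-d_1-c)^{g-1}}{(g-1)!}\,e^{-2(t-d_1-c)/m}\ \text{ for } t>d_1+c,\qquad p_g(t)=0\ \text{ otherwise.}$$ 2. (Lensing map.) Let $B=2\sqrt\pi\,e^{1-\gamma_e}/\kappa_*$ with $\gamma_e$ Euler's constant,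 $\sigma_g^*=\frac{\kappa_*}{\sqrt\pi}\sqrt{\frac{\log(Bg^{1/2})}{\log g}}$ and $\sigma_g=\sigma_g^*\sqrt{\log g}$. (a) With $a_1=(1-\kappa_c+\gamma)u$, $a_2=(1-\kappa_c-\gamma)v$ and $\rho^2=(h-a_1)^2+(k-a_2)^2$, $$f_{{\boldsymbol\eta}_g({\bf x})}(h,k)=\frac{e^{-\rho^2/(2\sigma_g^2)}}{(\sqrt{2\pi}\,\sigma_g)^2}\Big[1-\kappa_*\frac{(h-a_1)u+(k-a_2)v}{\sigma_g^2}+\frac{\kappa_*^2}{4\pi}\,\frac{\rho^2-2\sigma_g^2}{\sigma_g^4}\,\log(\log g)\Big]+O\Big(\frac1{\log^2g}\Big).$$ (b) Equivalently, for the normalized lensing map, with $a_1^*=a_1/\sqrt{\log g}$, $a_2^*=a_2/\sqrt{\log g}$ and $\rho_*^2=(h-a_1^*)^2+(k-a_2^*)^2$, $$f_{{\boldsymbol\eta}^*_g({\bf x})}(h,k)=\frac{e^{-\rho_*^2/(2(\sigma_g^*)^2)}}{(\sqrt{2\pi}\,\sigma^*_g)^2}\Big[1-\kappa_*\frac{(h-a^*_1)u+(k-a^*_2)v}{(\sigma^*_g)^2\sqrt{\log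 g}}+\frac{\kappa_*^2}{4\pi}\,\frac{\rho_*^2-2(\sigma^*_g)^2}{(\sigma^*_g)^4}\,\frac{\log(\log g)}{\log g}\Big]+O\Big(\frac1{\log g}\Big).$$ 3. (Shear.) With $G=\sqrt{z^2+w^2}$, $$f_{\Gamma_{1,g}({\bf x}),\Gamma_{2,g}({\bf x})}(z,w)=\frac{\kappa_*}{2\pi(\kappa_*^2+G^2)^{3/2}}\Big[1+\frac{H_1(G)}{g}+\frac{H_2(G;|{\bf x}|)}{g^2}\Big]+O(g^{-3}),$$ where $$H_1(G)=\kappa_*^2\frac{9G^2-6\kappa_*^2}{4(\kappa_*^2+G^2)^2},$$ $$H_2(G;|{\bf x}|)=\frac{\kappa_*|{\bf x}|^2}{m}\frac{\kappa_*^2(6\kappa_*^2-9G^2)}{2(\kappa_*^2+G^2)^2}-\frac{\kappa_*^2(8\kappa_*^4-24\kappa_*^2G^2+3G^4)}{4(\kappa_*^2+G^2)^3}+\frac{15\kappa_*^4(8\kappa_*^4-40\kappa_*^2G^2+15G^4)}{32(\kappa_*^2+G^2)^4}.$$ -/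

import Mathlib

open MeasureTheory ProbabilityTheory Filter

noncomputable section

namespace Microlensing

/-- The Euclidean plane: lens plane, light source plane, and the range of the planar random vectors. -/
abbrev Plane : Type := EuclideanSpace ℝ (Fin 2)

/-- The radius `R = √(g/π)` of the disc (of area `g`) that contains `g` stars. -/
def discRadius (g : ℕ) : ℝ := √((g : ℝ) / Real.pi)

/-- The mean star density `κ_* = π m`. -/
def kappaStar (m : ℝ) : ℝ := Real.pi * m

/-- The microlensing potential of `g` stars of mass `m` at the positions `ξ j`, with continuous
matter density `κc` and external shear `γ`. -/
def potential (κc γ m : ℝ) {g : ℕ} (ξ : Fin g → Plane) (x : Plane) : ℝ :=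
  κc / 2 * ‖x‖ ^ 2 - γ / 2 * (x 0 ^ 2 - x 1 ^ 2) + ∑ j, m * Real.log ‖x - ξ j‖

/-- The time delay function `T_{g,y}(x) = |x - y|²/2 - ψ_g(x)`. -/
def timeDelay (κc γ m : ℝ) {g : ℕ} (ξ : Fin g → Plane) (y x : Plane) : ℝ :=
  ‖x - y‖ ^ 2 / 2 - potential κc γ m ξ x

/-- The normalized time delay function `T*_{g,y}(x) = T_{g,y}(x) + g m log R`. -/
def timeDelayStar (κc γ m : ℝ) {g : ℕ} (ξ : Fin g → Plane) (y x : Plane) : ℝ :=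
  timeDelay κc γ m ξ y x + g * m * Real.log (discRadius g)

/-- The part `((1 - κc + γ) u, (1 - κc - γ) v)` of the lensing map that is not due to the stars. -/
def smoothPart (κc γ : ℝ) (x : Plane) : Plane :=
  !₂[(1 - κc + γ) * x 0, (1 - κc - γ) * x 1]

/-- The lensing map `η_g(x) = x - ∇ψ_g(x)`, with the gradient written out. -/
def lensingMap (κc γ m : ℝ) {g : ℕ} (ξ : Fin g → Plane) (x : Plane) : Plane :=
  smoothPart κc γ x - ∑ j, (m / ‖x - ξ j‖ ^ 2) • (x - ξ j)

/-- The normalized lensing map `η_g*(x) = η_g(x) / √(log g)`. -/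
def lensingMapStar (κc γ m : ℝ) {g : ℕ} (ξ : Fin g → Plane) (x : Plane) : Plane :=
  (√(Real.log g))⁻¹ • lensingMap κc γ m ξ x

/-- The components `(Γ_{1,g}(x), Γ_{2,g}(x))` of the shear tensor due to the stars. -/
def shear (m : ℝ) {g : ℕ} (ξ : Fin g → Plane) (x : Plane) : Plane :=
  !₂[∑ j, m * ((ξ j 0 - x 0) ^ 2 - (ξ j 1 - x 1) ^ 2)
        / ((ξ j 0 - x 0) ^ 2 + (ξ j 1 - x 1) ^ 2) ^ 2,
     ∑ j, 2 * m * (ξ j 0 - x 0) * (ξ j 1 - x 1)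
        / ((ξ j 0 - x 0) ^ 2 + (ξ j 1 - x 1) ^ 2) ^ 2]

/-- `d₁(x; y)`, the part of the time delay that is not due to the stars. -/
def dOne (κc γ : ℝ) (y x : Plane) : ℝ :=
  ‖x - y‖ ^ 2 / 2 - κc / 2 * ‖x‖ ^ 2 + γ / 2 * (x 0 ^ 2 - x 1 ^ 2)

/-- The constant shift `c = - κ_* |x|² / 2` of the time delay. -/
def cShift (m : ℝ) (x : Plane) : ℝ := -(kappaStar m * ‖x‖ ^ 2 / 2)

/-- The shifted Gamma density, with shape `g`, rate `2/m` and left end point `d₁ + c`. -/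
def timeDelayApprox (κc γ m : ℝ) (y x : Plane) (g : ℕ) (t : ℝ) : ℝ :=
  if dOne κc γ y x + cShift m x < t then
    (2 / m) ^ g * (t - dOne κc γ y x - cShift m x) ^ (g - 1) / ((g - 1).factorial : ℝ)
      * Real.exp (-(2 * (t - dOne κc γ y x - cShift m x) / m))
  else 0

/-- `B = 2 √π e^{1 - γ_e} / κ_*`, with `γ_e` Euler's constant. -/
def constB (m : ℝ) : ℝ :=
  2 * √Real.pi * Real.exp (1 - Real.eulerMascheroniConstant) / kappaStar m

/-- `σ_g* = (κ_*/√π) √(log(B g^{1/2}) / log g)`. -/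
def sigmaStar (m : ℝ) (g : ℕ) : ℝ :=
  kappaStar m / √Real.pi * √(Real.log (constB m * √(g : ℝ)) / Real.log g)

/-- `σ_g = σ_g* √(log g)`. -/
def sigma (m : ℝ) (g : ℕ) : ℝ := sigmaStar m g * √(Real.log g)

/-- The rotationally symmetric bivariate Gaussian density with mean `a` and variance `σ²` in each
coordinate. -/
def gaussianTwo (a : Plane) (σ : ℝ) (q : Plane) : ℝ :=
  Real.exp (-((q 0 - a 0) ^ 2 + (q 1 - a 1) ^ 2) / (2 * σ ^ 2)) / (√(2 * Real.pi) * σ) ^ 2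

/-- The three-term approximation of the density of the lensing map `η_g(x)`. -/
def lensingMapApprox (κc γ m : ℝ) (x : Plane) (g : ℕ) (q : Plane) : ℝ :=
  let a := smoothPart κc γ x
  let σ := sigma m g
  gaussianTwo a σ q *
    (1 - kappaStar m * ((q 0 - a 0) * x 0 + (q 1 - a 1) * x 1) / σ ^ 2
      + kappaStar m ^ 2 / (4 * Real.pi)
        * (((q 0 - a 0) ^ 2 + (q 1 - a 1) ^ 2 - 2 * σ ^ 2) / σ ^ 4)
        * Real.log (Real.log g))

/-- The three-term approximation of the density of the normalized lensing map `η_g*(x)`. -/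
def lensingMapStarApprox (κc γ m : ℝ) (x : Plane) (g : ℕ) (q : Plane) : ℝ :=
  let a := (√(Real.log g))⁻¹ • smoothPart κc γ x
  let σ := sigmaStar m g
  gaussianTwo a σ q *
    (1 - kappaStar m * ((q 0 - a 0) * x 0 + (q 1 - a 1) * x 1) / σ ^ 2 / √(Real.log g)
      + kappaStar m ^ 2 / (4 * Real.pi)
        * (((q 0 - a 0) ^ 2 + (q 1 - a 1) ^ 2 - 2 * σ ^ 2) / σ ^ 4)
        * (Real.log (Real.log g) / Real.log g))

/-- The coefficient `H₁` of `1/g`, as a function of `κ = κ_*` and `G`. -/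
def hOne (κ G : ℝ) : ℝ :=
  κ ^ 2 * ((9 * G ^ 2 - 6 * κ ^ 2) / (4 * (κ ^ 2 + G ^ 2) ^ 2))

/-- The coefficient `H₂` of `1/g²`, as a function of `m`, `G` and `r = |x|`. -/
def hTwo (m G r : ℝ) : ℝ :=
  let κ := kappaStar m
  κ * r ^ 2 / m * (κ ^ 2 * (6 * κ ^ 2 - 9 * G ^ 2) / (2 * (κ ^ 2 + G ^ 2) ^ 2))
    - κ ^ 2 * (8 * κ ^ 4 - 24 * κ ^ 2 * G ^ 2 + 3 * G ^ 4) / (4 * (κ ^ 2 + G ^ 2) ^ 3)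
    + 15 * κ ^ 4 * (8 * κ ^ 4 - 40 * κ ^ 2 * G ^ 2 + 15 * G ^ 4) / (32 * (κ ^ 2 + G ^ 2) ^ 4)

/-- The three-term approximation of the density of the shear; here `G = |q|`. -/
def shearApprox (m : ℝ) (x : Plane) (g : ℕ) (q : Plane) : ℝ :=
  let κ := kappaStar m
  κ / (2 * Real.pi * (κ ^ 2 + ‖q‖ ^ 2) ^ (3 / 2 : ℝ)) *
    (1 + hOne κ ‖q‖ / g + hTwo m ‖q‖ ‖x‖ / (g : ℝ) ^ 2)

/-- For large `g`, the random vector `X g` has a probability density function, which equals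
`f g` up to an error that is `O(e g)` as `g → ∞`, uniformly in the value `q`. -/
def HasAsymptoticPDF {Ω : ℕ → Type*} [∀ g, MeasurableSpace (Ω g)] (P : ∀ g, Measure (Ω g))
    {E : Type*} [MeasureSpace E] (X : ∀ g, Ω g → E) (f : ℕ → E → ℝ) (e : ℕ → ℝ) : Prop :=
  ∃ C : ℝ, ∀ᶠ g : ℕ in atTop, HasPDF (X g) (P g) volume ∧
    ∀ᵐ q : E, |(pdf (X g) (P g) volume q).toReal - f g q| ≤ C * e g

end Microlensing

end

/-! Each of the random quantities is a constant plus (or a rescaling of a constant plus) a sum of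
i.i.d. terms `F (ξ j - x)`. Its characteristic function is therefore a phase times φ^g, with φ the
characteristic function of one term (`charFun_map_sum_uniform`). If Q is the Fourier transform of
the claimed approximation, inversion bounds the difference of the densities, uniformly in the
argument, by the L¹ norm of the difference of the transforms; the density itself exists because the
characteristic function is integrable (`hasPDF_and_abs_sub_le`). What remains is to invert Q
explicitly and to bound the difference of the transforms by an integrable function of the right size
in g.

In polar coordinates about x the disc is r ≤ ρ(θ), with ρ = `chord`. Angular averages are evaluated
by pairing θ with θ + π, since ρ(θ)ρ(θ+π) = R² - |x|² and ρ(θ) - ρ(θ+π) = -2 `dirComp x θ`; a second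
pairing with θ + π/2 uses the symmetry of the field.

Time delay: the radial integral is that of a power, so φ is 2/(2 - imt) times the average of (ρ/R)²
exp(-imt log(ρ/R)). The first factor belongs to an exponential law, whose g-th power gives the Gamma
law. The average is nearly a phase, and because g(|x|/R)² = π|x|² its g-th power produces the shift
c.

Lensing map and shear: F is homogeneous of degree -k with k = 1, 2. The substitution s = (ρ/r)^k
turns the radial law into a Pareto law of index p = 2/k, so φ is an angular average of
`paretoCharFun p`. For the shear (p = 1) the singular term -π|A|/2 leads to exp(-κ|t|), the
transform of a bivariate Cauchy law, and further Taylor terms give H₁ and H₂. For the lensing map (p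
= 2) the term A² log|A| reflects a logarithmically divergent variance, hence the Gaussian limit
under the normalization √(log g).

Integrable majorants uniform in g come from `exists_norm_paretoCharFun_sq_le`, averaged over the
angle in `exists_norm_radialCharFun_le` and raised to the power g through Bernoulli's inequality
(`one_add_pow_le_one_add_pow`, `inv_sqrt_sqrt_pow_le`). -/

noncomputable section

namespace Microlensing

open Complex FourierTransform Topology
open scoped RealInnerProductSpace

/-! ### Fourier inversion for probability measures with integrable characteristic function. -/

section Inversion

variable {E : Type*} [NormedAddCommGroup E] [InnerProductSpace ℝ E] [FiniteDimensional ℝ E]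
  [MeasurableSpace E] [BorelSpace E]

/-- The inverse of the Fourier transform, in the normalization of characteristic functions. -/
def invCharFun (φ : E → ℂ) (q : E) : ℂ :=
  ((2 * Real.pi) ^ Module.finrank ℝ E : ℝ)⁻¹ • ∫ t, cexp (-(⟪q, t⟫ : ℝ) * I) * φ t

/-- The substitution t = -2πv, which passes to the normalization of `𝓕⁻`. -/
lemma invCharFun_eq_fourierInv (φ : E → ℂ) (q : E) :
    invCharFun φ q = ∫ v, cexp (2 * Real.pi * (⟪q, v⟫ : ℝ) * I) * φ ((-(2 * Real.pi)) • v) := by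
  have h := Measure.integral_comp_smul (volume : Measure E)
    (fun t => cexp (-(⟪q, t⟫ : ℝ) * I) * φ t) (-(2 * Real.pi))
  rw [invCharFun]
  convert h.symm using 2
  · rw [abs_inv, abs_pow, abs_neg, abs_of_pos (by positivity)]
  · ext v
    simp only [inner_smul_right]
    push_cast
    ring_nf

lemma norm_invCharFun_le (φ : E → ℂ) (q : E) :
    ‖invCharFun φ q‖ ≤ ((2 * Real.pi) ^ Module.finrank ℝ E)⁻¹ * ∫ t, ‖φ t‖ := by
  rw [invCharFun, norm_smul, Real.norm_of_nonneg (by positivity)]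
  gcongr
  refine (norm_integral_le_integral_norm _).trans (le_of_eq ?_)
  congr 1 with t
  rw [norm_mul, ← ofReal_neg, norm_exp_ofReal_mul_I, one_mul]

lemma continuous_invCharFun {φ : E → ℂ} (hφ : Integrable φ) : Continuous (invCharFun φ) := by
  suffices h : Continuous fun q : E => ∫ t, cexp (-(⟪q, t⟫ : ℝ) * I) * φ t from
    h.const_smul ((2 * Real.pi) ^ Module.finrank ℝ E : ℝ)⁻¹
  refine continuous_of_dominated (bound := fun t => ‖φ t‖) ?_ ?_ hφ.norm ?_
  · intro q
    exact (Continuous.aestronglyMeasurable (by fun_prop)).mul hφ.aestronglyMeasurable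
  · intro q
    filter_upwards with t
    rw [norm_mul, ← ofReal_neg, norm_exp_ofReal_mul_I, one_mul]
  · filter_upwards with t
    fun_prop

lemma invCharFun_sub {φ ψ : E → ℂ} (hφ : Integrable φ) (hψ : Integrable ψ) (q : E) :
    invCharFun φ q - invCharFun ψ q = invCharFun (φ - ψ) q := by
  have key : ∀ χ : E → ℂ, Integrable χ → Integrable fun t => cexp (-(⟪q, t⟫ : ℝ) * I) * χ t := by
    intro χ hχ
    refine hχ.bdd_mul (c := 1) (Continuous.aestronglyMeasurable (by fun_prop)) ?_
    filter_upwards with t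
    rw [← ofReal_neg, norm_exp_ofReal_mul_I]
  simp only [invCharFun, ← smul_sub, Pi.sub_apply, mul_sub]
  rw [integral_sub (key _ hφ) (key _ hψ)]

/-- Testing a probability measure with integrable characteristic function against smooth functions. -/
lemma integral_eq_integral_invCharFun (μ : Measure E) [IsProbabilityMeasure μ]
    (hμ : Integrable (charFun μ)) (s : SchwartzMap E ℂ) :
    ∫ q, s q ∂μ = ∫ q, s q * invCharFun (charFun μ) q := by
  set r : SchwartzMap E ℂ := 𝓕⁻ s with hr
  have hrs : ∀ q, s q = ∫ v, cexp (-(2 * Real.pi * (⟪q, v⟫ : ℝ)) * I) * r v := by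
    intro q
    have h1 : s = 𝓕 r := by rw [hr]; exact (FourierTransform.fourier_fourierInv_eq s).symm
    rw [h1, SchwartzMap.fourier_coe, Real.fourier_eq']
    congr 1 with v
    rw [smul_eq_mul, real_inner_comm]
    push_cast
    ring_nf
  have hsr : ∀ v, r v = ∫ q, cexp (2 * Real.pi * (⟪q, v⟫ : ℝ) * I) * s q := by
    intro v
    rw [hr, SchwartzMap.fourierInv_coe, Real.fourierInv_eq']
    congr 1 with q
    rw [smul_eq_mul]
    push_cast
    ring_nf
  set φ : E → ℂ := fun v => charFun μ ((-(2 * Real.pi)) • v) with hφ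
  have hφi : Integrable φ := hμ.comp_smul (by simp [Real.pi_ne_zero])
  calc ∫ q, s q ∂μ = ∫ q, (∫ v, cexp (-(2 * Real.pi * (⟪q, v⟫ : ℝ)) * I) * r v) ∂μ := by
        congr 1 with q; exact hrs q
    _ = ∫ v, (∫ q, cexp (-(2 * Real.pi * (⟪q, v⟫ : ℝ)) * I) * r v ∂μ) := by
        rw [integral_integral_swap]
        have : Integrable (fun z : E × E => r z.2) (μ.prod volume) :=
          (r.integrable).comp_snd μ
        refine this.bdd_mul (c := 1) (Continuous.aestronglyMeasurable (by fun_prop)) ?_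
        filter_upwards with t
        norm_cast
        rw [norm_exp_ofReal_mul_I]
    _ = ∫ v, φ v * r v := by
        congr 1 with v
        rw [integral_mul_const]
        simp only [hφ, charFun_apply]
        congr 2 with q
        simp only [inner_smul_right]
        push_cast
        ring_nf
    _ = ∫ v, ∫ q, φ v * (cexp (2 * Real.pi * (⟪q, v⟫ : ℝ) * I) * s q) := by
        congr 1 with v
        rw [integral_const_mul, ← hsr]
    _ = ∫ q, ∫ v, φ v * (cexp (2 * Real.pi * (⟪q, v⟫ : ℝ) * I) * s q) := by
        rw [integral_integral_swap]
        have : Integrable (fun z : E × E => φ z.1 * s z.2) (volume.prod volume) :=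
          hφi.mul_prod s.integrable
        have h2 := this.bdd_mul (c := 1)
          (f := fun z : E × E => cexp (2 * Real.pi * (⟪z.2, z.1⟫ : ℝ) * I))
          (Continuous.aestronglyMeasurable (by fun_prop)) (by
            filter_upwards with t
            norm_cast
            rw [norm_exp_ofReal_mul_I])
        convert h2 using 2 with z
        simp only [Function.uncurry]
        ring
    _ = ∫ q, s q * invCharFun (charFun μ) q := by
        congr 1 with q
        rw [invCharFun_eq_fourierInv, ← integral_const_mul]
        congr 1 with v
        ring

lemma integral_contDiff_smul_eq (μ : Measure E) [IsProbabilityMeasure μ]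
    (hμ : Integrable (charFun μ)) (g : E → ℝ) (hg : ContDiff ℝ (⊤ : ℕ∞) g)
    (hs : HasCompactSupport g) :
    ∫ q, g q • (1 : ℂ) ∂μ = ∫ q, g q • invCharFun (charFun μ) q := by
  have hs' : HasCompactSupport (fun q => (g q : ℂ)) := hs.comp_left (g := Complex.ofReal) (by simp)
  have hg' : ContDiff ℝ (⊤ : ℕ∞) (fun q => (g q : ℂ)) := Complex.ofRealCLM.contDiff.comp hg
  have := integral_eq_integral_invCharFun μ hμ (hs'.toSchwartzMap hg')
  simpa [Complex.real_smul] using! this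

/-- No density is available yet, so μ and Lebesgue measure are both written with respect to their
sum ν. Testing against smooth functions of compact support shows that dμ/dν equals `invCharFun
(charFun μ)` times dvol/dν, and hence vanishes wherever dvol/dν does. -/
lemma absolutelyContinuous_of_integrable_charFun (μ : Measure E) [IsProbabilityMeasure μ]
    (hμ : Integrable (charFun μ)) : μ ≪ volume := by
  set ν : Measure E := μ + volume with hν
  have h1 : μ ≪ ν := Measure.AbsolutelyContinuous.rfl.add_right _
  have h2 : (volume : Measure E) ≪ ν := by
    rw [hν, add_comm]; exact Measure.AbsolutelyContinuous.rfl.add_right _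
  have e1 : ∀ f : E → ℂ, ∫ x, (μ.rnDeriv ν x).toReal • f x ∂ν = ∫ x, f x ∂μ :=
    fun f => integral_rnDeriv_smul h1
  have e2 : ∀ f : E → ℂ, ∫ x, (volume.rnDeriv ν x).toReal • f x ∂ν = ∫ x, f x :=
    fun f => integral_rnDeriv_smul h2
  have hc := continuous_invCharFun hμ
  have l1 : LocallyIntegrable (fun x => (μ.rnDeriv ν x).toReal • (1 : ℂ)) ν := by
    have : LocallyIntegrable (fun _ : E => (1 : ℂ)) μ := locallyIntegrable_const _
    intro x
    obtain ⟨s, hs, hi⟩ := this x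
    refine ⟨interior s, interior_mem_nhds.2 hs, ?_⟩
    have hi' := hi.mono_set interior_subset
    rw [IntegrableOn, ← Measure.withDensity_rnDeriv_eq _ _ h1, 
      restrict_withDensity isOpen_interior.measurableSet] at hi'
    exact (integrable_withDensity_iff_integrable_smul₀' (Measure.measurable_rnDeriv _ _).aemeasurable
      (ae_restrict_of_ae (Measure.rnDeriv_lt_top _ _))).1 hi'
  have l2 : LocallyIntegrable (fun x => (volume.rnDeriv ν x).toReal • invCharFun (charFun μ) x) ν := by
    have : LocallyIntegrable (invCharFun (charFun μ)) (volume : Measure E) := hc.locallyIntegrable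
    intro x
    obtain ⟨s, hs, hi⟩ := this x
    refine ⟨interior s, interior_mem_nhds.2 hs, ?_⟩
    have hi' := hi.mono_set interior_subset
    rw [IntegrableOn, ← Measure.withDensity_rnDeriv_eq _ _ h2,
      restrict_withDensity isOpen_interior.measurableSet] at hi'
    exact (integrable_withDensity_iff_integrable_smul₀' (Measure.measurable_rnDeriv _ _).aemeasurable
      (ae_restrict_of_ae (Measure.rnDeriv_lt_top _ _))).1 hi'
  have key := ae_eq_of_integral_contDiff_smul_eq l1 l2 (by
    intro g hg hs
    have a1 := e1 (fun x => g x • (1 : ℂ))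
    have a2 := e2 (fun x => g x • invCharFun (charFun μ) x)
    rw [integral_contDiff_smul_eq μ hμ g hg hs, ← a2] at a1
    convert a1 using 3 <;> rw [smul_comm])
  refine Measure.AbsolutelyContinuous.mk fun s hs h0 => ?_
  have k1 : ∀ᵐ x ∂ν.restrict s, volume.rnDeriv ν x = 0 := by
    rw [← Measure.withDensity_rnDeriv_eq _ _ h2, withDensity_apply _ hs,
      lintegral_eq_zero_iff (Measure.measurable_rnDeriv _ _)] at h0
    exact h0
  rw [← Measure.withDensity_rnDeriv_eq _ _ h1, withDensity_apply _ hs,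
      lintegral_eq_zero_iff (Measure.measurable_rnDeriv _ _)]
  filter_upwards [k1, ae_restrict_of_ae key, ae_restrict_of_ae (Measure.rnDeriv_lt_top μ ν)]
    with x hx1 hx2 hx3
  rw [hx1] at hx2
  simp only [ENNReal.toReal_zero, zero_smul, real_smul, mul_one, ofReal_eq_zero,
    ENNReal.toReal_eq_zero_iff] at hx2
  rcases hx2 with h | h
  · exact h
  · exact absurd h hx3.ne

lemma rnDeriv_toReal_eq_invCharFun (μ : Measure E) [IsProbabilityMeasure μ]
    (hμ : Integrable (charFun μ)) :
    ∀ᵐ q : E, ((μ.rnDeriv volume q).toReal : ℂ) = invCharFun (charFun μ) q := by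
  have hac := absolutelyContinuous_of_integrable_charFun μ hμ
  have l1 : Integrable (fun q : E => ((μ.rnDeriv volume q).toReal : ℂ)) volume :=
    Measure.integrable_toReal_rnDeriv.ofReal
  refine ae_eq_of_integral_contDiff_smul_eq l1.locallyIntegrable
    (continuous_invCharFun hμ).locallyIntegrable fun g hg hs => ?_
  rw [← integral_contDiff_smul_eq μ hμ g hg hs, ← integral_rnDeriv_smul hac]
  congr 1 with x
  simp only [real_smul]
  ring

/-- Comparison of a random vector's density with a function `p` whose Fourier transform is known. -/
lemma hasPDF_and_abs_sub_le {Ω : Type*} [MeasurableSpace Ω] (P : Measure Ω) [IsProbabilityMeasure P]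
    {X : Ω → E} (hX : Measurable X) {p : E → ℝ} {Q : E → ℂ}
    (hQ : Integrable Q) (hp : ∀ q, (p q : ℂ) = invCharFun Q q)
    (hφ : Integrable (fun t => charFun (P.map X) t - Q t)) :
    HasPDF X P volume ∧ ∀ᵐ q : E, |(pdf X P volume q).toReal - p q|
      ≤ ((2 * Real.pi) ^ Module.finrank ℝ E)⁻¹ * ∫ t, ‖charFun (P.map X) t - Q t‖ := by
  have : IsProbabilityMeasure (P.map X) := Measure.isProbabilityMeasure_map hX.aemeasurable
  -- Integrability of the characteristic function needs no separate proof: it is the sum of Q and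
  -- the integrable difference.
  have hi : Integrable (charFun (P.map X)) :=
    (hφ.add hQ).congr (ae_of_all _ fun t => by simp)
  refine ⟨hasPDF_iff.2 ⟨hX.aemeasurable, inferInstance,
    absolutelyContinuous_of_integrable_charFun _ hi⟩, ?_⟩
  filter_upwards [rnDeriv_toReal_eq_invCharFun _ hi] with q hq
  have h := norm_invCharFun_le (charFun (P.map X) - Q) q
  rw [← invCharFun_sub hi hQ, ← hq, ← hp, ← ofReal_sub, norm_real, Real.norm_eq_abs] at h
  exact h

end Inversion

/-! ### Polar coordinates about an interior point of a disc. -/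

section Polar

/-- The point of the plane with polar coordinates `(r, θ)`. -/
def polarPt (r θ : ℝ) : Plane := !₂[r * Real.cos θ, r * Real.sin θ]

@[simp] lemma polarPt_zero (r θ : ℝ) : polarPt r θ 0 = r * Real.cos θ := rfl
@[simp] lemma polarPt_one (r θ : ℝ) : polarPt r θ 1 = r * Real.sin θ := rfl

lemma plane_norm_sq (z : Plane) : ‖z‖ ^ 2 = z 0 ^ 2 + z 1 ^ 2 := by
  rw [EuclideanSpace.norm_sq_eq, Fin.sum_univ_two]; simp

lemma plane_inner (z w : Plane) : (⟪z, w⟫ : ℝ) = z 0 * w 0 + z 1 * w 1 := by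
  rw [PiLp.inner_apply, Fin.sum_univ_two]
  simp [mul_comm]

lemma norm_polarPt {r : ℝ} (hr : 0 ≤ r) (θ : ℝ) : ‖polarPt r θ‖ = r := by
  have : ‖polarPt r θ‖ ^ 2 = r ^ 2 := by
    rw [plane_norm_sq]; simp only [polarPt_zero, polarPt_one]
    linear_combination r ^ 2 * Real.sin_sq_add_cos_sq θ
  exact (pow_left_inj₀ (norm_nonneg _) hr two_ne_zero).1 this

lemma measurable_polarPt : Measurable fun p : ℝ × ℝ => polarPt p.1 p.2 := by
  unfold polarPt
  apply Continuous.measurable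
  fun_prop

/-- The identification of `ℝ × ℝ` with the plane. -/
def prodEquivPlane : ℝ × ℝ ≃ᵐ Plane :=
  MeasurableEquiv.finTwoArrow.symm.trans (MeasurableEquiv.toLp 2 (Fin 2 → ℝ))

lemma prodEquivPlane_apply (p : ℝ × ℝ) : prodEquivPlane p = !₂[p.1, p.2] := rfl

lemma measurePreserving_prodEquivPlane : MeasurePreserving prodEquivPlane :=
  (volume_preserving_finTwoArrow ℝ).symm.trans (PiLp.volume_preserving_toLp (Fin 2))

variable {F : Type*} [NormedAddCommGroup F] [NormedSpace ℝ F]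

lemma integral_plane_eq_prod (f : Plane → F) :
    ∫ z, f z = ∫ p : ℝ × ℝ, f !₂[p.1, p.2] :=
  (measurePreserving_prodEquivPlane.integral_comp' f).symm

lemma integral_plane_eq_polar (f : Plane → F) :
    ∫ z, f z = ∫ p in polarCoord.target, p.1 • f (polarPt p.1 p.2) := by
  rw [integral_plane_eq_prod, ← integral_comp_polarCoord_symm]
  rfl

/-- The component of `x` in the direction `θ`. -/
def dirComp (x : Plane) (θ : ℝ) : ℝ := x 0 * Real.cos θ + x 1 * Real.sin θ

/-- The distance from `x` to the boundary of the disc of radius `R` in the direction `θ`. -/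
def chord (R : ℝ) (x : Plane) (θ : ℝ) : ℝ :=
  √(R ^ 2 - ‖x‖ ^ 2 + dirComp x θ ^ 2) - dirComp x θ

lemma continuous_dirComp (x : Plane) : Continuous (dirComp x) := by
  unfold dirComp; fun_prop

lemma continuous_chord (R : ℝ) (x : Plane) : Continuous (chord R x) := by
  have := continuous_dirComp x
  unfold chord; fun_prop

lemma dirComp_add_pi (x : Plane) (θ : ℝ) : dirComp x (θ + Real.pi) = -dirComp x θ := by
  simp [dirComp]; ring

lemma dirComp_sq_le (x : Plane) (θ : ℝ) : dirComp x θ ^ 2 ≤ ‖x‖ ^ 2 := by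
  rw [plane_norm_sq, dirComp]
  nlinarith [Real.sin_sq_add_cos_sq θ, sq_nonneg (x 0 * Real.sin θ - x 1 * Real.cos θ)]

lemma abs_dirComp_le (x : Plane) (θ : ℝ) : |dirComp x θ| ≤ ‖x‖ :=
  abs_le_of_sq_le_sq (dirComp_sq_le x θ) (norm_nonneg x)

variable {R : ℝ} {x : Plane}

/-- The power of the point x with respect to the circle. With `chord_sub_chord` it makes symmetric
functions of an antipodal pair of chords polynomial in `dirComp x θ`, free of square roots. -/
lemma chord_mul_chord (hx : ‖x‖ < R) (θ : ℝ) :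
    chord R x θ * chord R x (θ + Real.pi) = R ^ 2 - ‖x‖ ^ 2 := by
  have h : 0 ≤ R ^ 2 - ‖x‖ ^ 2 + dirComp x θ ^ 2 := by nlinarith [norm_nonneg x, sq_nonneg (dirComp x θ)]
  rw [chord, chord, dirComp_add_pi, neg_sq]
  linear_combination Real.sq_sqrt h

lemma chord_sub_chord (R : ℝ) (x : Plane) (θ : ℝ) :
    chord R x θ - chord R x (θ + Real.pi) = -2 * dirComp x θ := by
  rw [chord, chord, dirComp_add_pi, neg_sq]; ring

lemma chord_sq_add_chord_sq (hx : ‖x‖ < R) (θ : ℝ) :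
    chord R x θ ^ 2 + chord R x (θ + Real.pi) ^ 2
      = 2 * R ^ 2 - 2 * ‖x‖ ^ 2 + 4 * dirComp x θ ^ 2 := by
  have h1 := chord_mul_chord hx θ
  have h2 := chord_sub_chord R x θ
  linear_combination 2 * h1 + (chord R x θ - chord R x (θ + Real.pi) - 2 * dirComp x θ) * h2

lemma le_chord (hx : ‖x‖ < R) (θ : ℝ) : R - ‖x‖ ≤ chord R x θ := by
  have h0 := abs_le.1 (abs_dirComp_le x θ)
  have : R - ‖x‖ + dirComp x θ ≤ √(R ^ 2 - ‖x‖ ^ 2 + dirComp x θ ^ 2) := by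
    apply Real.le_sqrt_of_sq_le
    nlinarith [norm_nonneg x]
  rw [chord]; linarith

lemma chord_le (hx : ‖x‖ < R) (θ : ℝ) : chord R x θ ≤ R + ‖x‖ := by
  have h0 := abs_le.1 (abs_dirComp_le x θ)
  have : √(R ^ 2 - ‖x‖ ^ 2 + dirComp x θ ^ 2) ≤ R + ‖x‖ + dirComp x θ := by
    apply Real.sqrt_le_iff.2
    constructor <;> nlinarith [norm_nonneg x]
  rw [chord]; linarith

lemma chord_pos (hx : ‖x‖ < R) (θ : ℝ) : 0 < chord R x θ := by linarith [le_chord hx θ]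

/-- Completing the square gives |rω + x|² = (r + d)² + |x|² - d² with d = `dirComp x θ`. The
negative root is irrelevant because r > 0 and |d| is at most the square root in `chord`. -/
lemma norm_polarPt_add_le_iff (hx : ‖x‖ < R) {r : ℝ} (hr : 0 < r) (θ : ℝ) :
    ‖polarPt r θ + x‖ ≤ R ↔ r ≤ chord R x θ := by
  have hR : 0 ≤ R := (norm_nonneg x).trans hx.le
  have h : 0 ≤ R ^ 2 - ‖x‖ ^ 2 + dirComp x θ ^ 2 := by nlinarith [norm_nonneg x, sq_nonneg (dirComp x θ)]
  have e : ‖polarPt r θ + x‖ ^ 2 = (r + dirComp x θ) ^ 2 + ‖x‖ ^ 2 - dirComp x θ ^ 2 := by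
    rw [plane_norm_sq, plane_norm_sq, dirComp]
    simp only [PiLp.add_apply, polarPt_zero, polarPt_one]
    linear_combination r ^ 2 * Real.sin_sq_add_cos_sq θ
  rw [← sq_le_sq₀ (norm_nonneg _) hR, e, chord, le_sub_iff_add_le]
  have hd : -√(R ^ 2 - ‖x‖ ^ 2 + dirComp x θ ^ 2) ≤ r + dirComp x θ := by
    have : |dirComp x θ| ≤ √(R ^ 2 - ‖x‖ ^ 2 + dirComp x θ ^ 2) := by
      apply Real.le_sqrt_of_sq_le
      rw [sq_abs]
      nlinarith [norm_nonneg x]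
    have := (abs_le.1 this).1
    linarith
  constructor
  · intro hh
    apply Real.le_sqrt_of_sq_le; linarith
  · intro hh
    nlinarith [Real.sq_sqrt h, abs_le.2 ⟨hd, hh⟩, sq_le_sq' hd hh]

/-- Integration over a disc in polar coordinates about one of its interior points. -/
lemma setIntegral_closedBall_sub (hx : ‖x‖ < R) {h : Plane → ℂ} (hm : Measurable h)
    (hb : ∀ z, ‖h z‖ ≤ 1) :
    ∫ z in Metric.closedBall (0 : Plane) R, h (z - x)
      = ∫ θ in (-Real.pi)..Real.pi, ∫ r in (0 : ℝ)..chord R x θ, (r : ℂ) * h (polarPt r θ) := by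
  have hR : 0 < R := (norm_nonneg x).trans_lt hx
  have hcm : Measurable (chord R x) := (continuous_chord R x).measurable
  rw [← integral_indicator measurableSet_closedBall,
    ← integral_add_right_eq_self _ x, integral_plane_eq_polar]
  set S : Set (ℝ × ℝ) := {p | 0 < p.1 ∧ p.1 ≤ chord R x p.2} with hS
  have hSm : MeasurableSet S :=
    (measurableSet_lt measurable_const measurable_fst).inter
      (measurableSet_le measurable_fst (hcm.comp measurable_snd))
  set G : ℝ × ℝ → ℂ := S.indicator fun p => (p.1 : ℂ) * h (polarPt p.1 p.2) with hG
  have hGm : Measurable G :=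
    Measurable.indicator ((measurable_ofReal.comp measurable_fst).mul (hm.comp measurable_polarPt)) hSm
  have htgt : (polarCoord.target : Set (ℝ × ℝ)) = Set.Ioi 0 ×ˢ Set.Ioo (-Real.pi) Real.pi := rfl
  have e1 : ∫ p in polarCoord.target, p.1 • (Metric.closedBall (0 : Plane) R).indicator
        (fun z => h (z - x)) (polarPt p.1 p.2 + x) = ∫ p in polarCoord.target, G p := by
    refine setIntegral_congr_fun polarCoord.open_target.measurableSet ?_
    rintro ⟨r, θ⟩ hp
    rw [htgt] at hp
    have hr : 0 < r := hp.1
    simp only [hG, hS, Set.indicator, Set.mem_ofPred_eq, mem_closedBall_zero_iff,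
      norm_polarPt_add_le_iff hx hr, hr, true_and, add_sub_cancel_right]
    split_ifs <;> simp
  rw [e1, htgt, Measure.volume_eq_prod, ← Measure.prod_restrict, ← integral_prod_swap]
  -- The integrand is bounded by R + |x| and lives on the bounded strip r ≤ R + |x|, so Fubini
  -- applies.
  have hint : Integrable (fun z : ℝ × ℝ => G z.swap)
      ((volume.restrict (Set.Ioo (-Real.pi) Real.pi)).prod (volume.restrict (Set.Ioi 0))) := by
    have i1 : Integrable (fun _ : ℝ => (1 : ℝ)) (volume.restrict (Set.Ioo (-Real.pi) Real.pi)) :=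
      integrable_const _
    have i2 : Integrable ((Set.Ioc 0 (R + ‖x‖)).indicator fun _ => R + ‖x‖)
        (volume.restrict (Set.Ioi (0 : ℝ))) :=
      Integrable.integrableOn ((integrable_indicator_iff measurableSet_Ioc).2
        (integrableOn_const measure_Ioc_lt_top.ne))
    have hI := i1.mul_prod i2
    refine hI.mono' (hGm.comp measurable_swap).aestronglyMeasurable (ae_of_all _ fun z => ?_)
    simp only [hG, hS, Set.indicator, Set.mem_ofPred_eq, Prod.fst_swap, Prod.snd_swap, one_mul,
      Set.mem_Ioc]
    have h1 := chord_le hx z.1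
    split_ifs with h2 h3 h3
    · rw [norm_mul, norm_real, Real.norm_of_nonneg h2.1.le]
      nlinarith [hb (polarPt z.2 z.1), norm_nonneg (h (polarPt z.2 z.1)), h2.2]
    · exact absurd ⟨h2.1, h2.2.trans h1⟩ h3
    · simp only [norm_zero]; positivity
    · simp
  rw [integral_prod _ hint, intervalIntegral.integral_of_le (by linarith [Real.pi_pos]),
    integral_Ioc_eq_integral_Ioo]
  congr 1 with θ
  rw [intervalIntegral.integral_of_le (chord_pos hx θ).le, ← integral_indicator measurableSet_Ioi,
    ← integral_indicator measurableSet_Ioc]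
  congr 1 with r
  simp only [hG, hS, Set.indicator, Set.mem_ofPred_eq, Prod.swap_prod_mk, Set.mem_Ioi, Set.mem_Ioc]
  split_ifs with h1 h2 h3 <;> simp_all

end Polar

/-! ### Angular averages and their symmetries. -/

section Average

variable {F : Type*} [NormedAddCommGroup F] [NormedSpace ℝ F]

/-- The average of a function of the angle over the interval `[-π, π]`. -/
def angAvg (f : ℝ → F) : F := (2 * Real.pi)⁻¹ • ∫ θ in (-Real.pi)..Real.pi, f θ

lemma angAvg_add {f g : ℝ → F} (hf : Continuous f) (hg : Continuous g) :
    angAvg (fun θ => f θ + g θ) = angAvg f + angAvg g := by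
  rw [angAvg, intervalIntegral.integral_add (hf.intervalIntegrable _ _) (hg.intervalIntegrable _ _),
    smul_add]; rfl

lemma angAvg_sub {f g : ℝ → F} (hf : Continuous f) (hg : Continuous g) :
    angAvg (fun θ => f θ - g θ) = angAvg f - angAvg g := by
  rw [angAvg, intervalIntegral.integral_sub (hf.intervalIntegrable _ _) (hg.intervalIntegrable _ _),
    smul_sub]; rfl

lemma angAvg_smul (c : ℝ) (f : ℝ → F) : angAvg (fun θ => c • f θ) = c • angAvg f := by
  rw [angAvg, intervalIntegral.integral_smul, smul_comm]; rfl

lemma angAvg_const_mul (c : ℝ) (f : ℝ → ℝ) : angAvg (fun θ => c * f θ) = c * angAvg f :=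
  angAvg_smul c f

lemma angAvg_neg (f : ℝ → F) : angAvg (fun θ => -f θ) = -angAvg f := by
  rw [angAvg, intervalIntegral.integral_neg, smul_neg]; rfl

lemma angAvg_const_mul_complex (c : ℂ) (f : ℝ → ℂ) : angAvg (fun θ => c * f θ) = c * angAvg f := by
  rw [angAvg, intervalIntegral.integral_const_mul, angAvg, mul_smul_comm]

lemma angAvg_const [CompleteSpace F] (c : F) : angAvg (fun _ => c) = c := by
  rw [angAvg, intervalIntegral.integral_const, smul_smul, sub_neg_eq_add, ← two_mul,
    inv_mul_cancel₀ (by positivity), one_smul]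

lemma angAvg_ofReal (f : ℝ → ℝ) : angAvg (fun θ => (f θ : ℂ)) = (angAvg f : ℝ) := by
  rw [angAvg, intervalIntegral.integral_ofReal, angAvg, real_smul, smul_eq_mul, ofReal_mul]

lemma angAvg_mono {f g : ℝ → ℝ} (hf : Continuous f) (hg : Continuous g) (h : ∀ θ, f θ ≤ g θ) :
    angAvg f ≤ angAvg g := by
  rw [angAvg, angAvg, smul_eq_mul, smul_eq_mul]
  gcongr
  exact intervalIntegral.integral_mono (by linarith [Real.pi_pos]) (hf.intervalIntegrable _ _)
    (hg.intervalIntegrable _ _) h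

lemma angAvg_le {f : ℝ → ℝ} (hf : Continuous f) {c : ℝ} (h : ∀ θ, f θ ≤ c) : angAvg f ≤ c :=
  (angAvg_mono hf continuous_const h).trans (angAvg_const c).le

lemma norm_angAvg_le_angAvg_norm (f : ℝ → F) : ‖angAvg f‖ ≤ angAvg fun θ => ‖f θ‖ := by
  rw [angAvg, angAvg, norm_smul, Real.norm_of_nonneg (by positivity), smul_eq_mul]
  gcongr
  exact intervalIntegral.norm_integral_le_integral_norm (by linarith [Real.pi_pos])

lemma norm_angAvg_le {f : ℝ → F} {g : ℝ → ℝ} (hf : Continuous f) (hg : Continuous g)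
    (h : ∀ θ, ‖f θ‖ ≤ g θ) : ‖angAvg f‖ ≤ angAvg g :=
  (norm_angAvg_le_angAvg_norm f).trans (angAvg_mono hf.norm hg h)

lemma norm_angAvg_le_const {f : ℝ → F} (hf : Continuous f) {c : ℝ}
    (h : ∀ θ, ‖f θ‖ ≤ c) : ‖angAvg f‖ ≤ c :=
  (norm_angAvg_le_angAvg_norm f).trans (angAvg_le hf.norm h)

lemma angAvg_comp_add {f : ℝ → F} (hp : Function.Periodic f (2 * Real.pi)) (a : ℝ) :
    angAvg (fun θ => f (θ + a)) = angAvg f := by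
  rw [angAvg, angAvg, intervalIntegral.integral_comp_add_right]
  congr 1
  have := hp.intervalIntegral_add_eq (-Real.pi + a) (-Real.pi)
  convert this using 2 <;> ring

/-- As θ runs over one period, 2θ runs over two. -/
lemma angAvg_comp_two_mul {f : ℝ → F} (hf : Continuous f) (hp : Function.Periodic f (2 * Real.pi)) :
    angAvg (fun θ => f (2 * θ)) = angAvg f := by
  rw [angAvg, angAvg, intervalIntegral.integral_comp_mul_left _ two_ne_zero]
  congr 1
  rw [← intervalIntegral.integral_add_adjacent_intervals (hf.intervalIntegrable _ 0)
    (hf.intervalIntegrable _ _)]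
  have h1 := hp.intervalIntegral_add_eq (2 * -Real.pi) (-Real.pi)
  have h2 := hp.intervalIntegral_add_eq 0 (-Real.pi)
  rw [show 2 * -Real.pi + 2 * Real.pi = 0 by ring] at h1
  rw [show 0 + 2 * Real.pi = 2 * Real.pi by ring] at h2
  rw [h1, h2, show -Real.pi + 2 * Real.pi = Real.pi by ring, ← two_smul ℝ, smul_smul]
  simp

/-- An average can be computed from pairs of angles with a fixed difference. -/
lemma angAvg_eq_pair {f : ℝ → F} (hf : Continuous f) (hp : Function.Periodic f (2 * Real.pi)) (a : ℝ) :
    angAvg f = angAvg fun θ => (2 : ℝ)⁻¹ • (f θ + f (θ + a)) := by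
  rw [angAvg_smul, angAvg_add hf (by fun_prop), angAvg_comp_add hp, ← two_smul ℝ, smul_smul]
  simp

lemma angAvg_eq_zero_of_antiperiodic {f : ℝ → F} (hf : Continuous f)
    (hp : Function.Periodic f (2 * Real.pi)) {a : ℝ} (h : ∀ θ, f (θ + a) = -f θ) : angAvg f = 0 := by
  rw [angAvg_eq_pair hf hp a]
  simp [h, angAvg]

lemma dirComp_periodic (x : Plane) : Function.Periodic (dirComp x) (2 * Real.pi) := by
  intro θ; simp [dirComp]

lemma chord_periodic (R : ℝ) (x : Plane) : Function.Periodic (chord R x) (2 * Real.pi) := by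
  intro θ; simp [chord, dirComp_periodic x θ]

lemma dirComp_add_pi_div_two (x : Plane) (θ : ℝ) :
    dirComp x (θ + Real.pi / 2) = x 1 * Real.cos θ - x 0 * Real.sin θ := by
  simp [dirComp, Real.cos_add, Real.sin_add]; ring

lemma dirComp_sq_add_sq (x : Plane) (θ : ℝ) :
    dirComp x θ ^ 2 + dirComp x (θ + Real.pi / 2) ^ 2 = ‖x‖ ^ 2 := by
  rw [dirComp_add_pi_div_two, plane_norm_sq, dirComp]
  linear_combination (x 0 ^ 2 + x 1 ^ 2) * Real.sin_sq_add_cos_sq θ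

/-- Paired with a quarter turn, the integrand becomes constant: it is half the inner product of t
and x computed in a rotated orthonormal basis. -/
lemma angAvg_dirComp_mul (t x : Plane) :
    angAvg (fun θ => dirComp t θ * dirComp x θ) = (⟪t, x⟫ : ℝ) / 2 := by
  have ht := continuous_dirComp t
  have hx := continuous_dirComp x
  rw [angAvg_eq_pair (by fun_prop) (fun θ => by
    simp only [dirComp_periodic t θ, dirComp_periodic x θ]) (Real.pi / 2)]
  have : ∀ θ, (2 : ℝ)⁻¹ • (dirComp t θ * dirComp x θ +
      dirComp t (θ + Real.pi / 2) * dirComp x (θ + Real.pi / 2)) = (⟪t, x⟫ : ℝ) / 2 := by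
    intro θ
    rw [dirComp_add_pi_div_two, dirComp_add_pi_div_two, plane_inner, dirComp, dirComp, smul_eq_mul]
    linear_combination (t 0 * x 0 + t 1 * x 1) / 2 * Real.sin_sq_add_cos_sq θ
  simp only [this, angAvg_const]

lemma angAvg_dirComp_sq (t : Plane) : angAvg (fun θ => dirComp t θ ^ 2) = ‖t‖ ^ 2 / 2 := by
  simp only [pow_two (dirComp t _), angAvg_dirComp_mul, real_inner_self_eq_norm_sq]

lemma exists_dirComp_eq (t : Plane) : ∃ α, ∀ θ, dirComp t θ = ‖t‖ * Real.cos (θ + α) := by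
  -- The conjugate of t as a complex number; its argument is the phase shift required.
  set z : ℂ := ⟨t 0, -t 1⟩ with hz
  have hn : ‖z‖ = ‖t‖ := by
    have : ‖z‖ ^ 2 = ‖t‖ ^ 2 := by
      rw [plane_norm_sq, ← Complex.normSq_eq_norm_sq, Complex.normSq_mk]; ring
    exact (pow_left_inj₀ (norm_nonneg _) (norm_nonneg _) two_ne_zero).1 this
  refine ⟨z.arg, fun θ => ?_⟩
  have h1 := Complex.norm_mul_cos_arg z
  have h2 := Complex.norm_mul_sin_arg z
  rw [hn] at h1 h2
  rw [Real.cos_add, dirComp]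
  linear_combination (-Real.cos θ) * h1 + Real.sin θ * h2

lemma angAvg_comp_dirComp (f : ℝ → F) (t : Plane) :
    angAvg (fun θ => f (dirComp t θ)) = angAvg fun θ => f (‖t‖ * Real.cos θ) := by
  obtain ⟨α, hα⟩ := exists_dirComp_eq t
  simp only [hα]
  exact angAvg_comp_add (f := fun θ => f (‖t‖ * Real.cos θ)) (fun θ => by simp) α

lemma angAvg_abs_cos : angAvg (fun θ => |Real.cos θ|) = 2 / Real.pi := by
  have hc : Continuous fun θ : ℝ => |Real.cos θ| := by fun_prop
  have e : ∫ θ in (-Real.pi)..Real.pi, |Real.cos θ| = 4 := by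
    have hp : Function.Periodic (fun θ : ℝ => |Real.cos θ|) (2 * Real.pi) := fun θ => by simp
    have h1 := hp.intervalIntegral_add_eq (-Real.pi) (-(Real.pi / 2))
    rw [show -Real.pi + 2 * Real.pi = Real.pi by ring] at h1
    rw [h1, ← intervalIntegral.integral_add_adjacent_intervals (b := Real.pi / 2)
      (hc.intervalIntegrable _ _) (hc.intervalIntegrable _ _)]
    have a1 : ∫ θ in (-(Real.pi / 2))..(Real.pi / 2), |Real.cos θ| = 2 := by
      rw [intervalIntegral.integral_congr (g := Real.cos)]
      · simp; norm_num
      · intro θ hθ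
        rw [Set.uIcc_of_le (by linarith [Real.pi_pos])] at hθ
        exact abs_of_nonneg (Real.cos_nonneg_of_mem_Icc hθ)
    have a2 : ∫ θ in (Real.pi / 2)..(-(Real.pi / 2) + 2 * Real.pi), |Real.cos θ| = 2 := by
      have := intervalIntegral.integral_comp_add_right (a := -(Real.pi / 2)) (b := Real.pi / 2)
        (fun θ => |Real.cos θ|) Real.pi
      rw [show -(Real.pi / 2) + Real.pi = Real.pi / 2 by ring,
        show Real.pi / 2 + Real.pi = -(Real.pi / 2) + 2 * Real.pi by ring] at this
      rw [← this]
      simpa only [Real.cos_add_pi, abs_neg] using a1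
    rw [a1, a2]; norm_num
  rw [angAvg, e, smul_eq_mul]
  field_simp
  norm_num

/-- The antiderivative used here is a branch-free form of `arctan (tan θ / c) / c`. -/
lemma angAvg_inv_one_add_mul_cos_sq {X : ℝ} (hX : 0 ≤ X) :
    angAvg (fun θ => (1 + X * Real.cos θ ^ 2)⁻¹) = (√(1 + X))⁻¹ := by
  set c := √(1 + X) with hc
  have hc2 : c ^ 2 = 1 + X := Real.sq_sqrt (by positivity)
  have hc0 : 0 < c := Real.sqrt_pos.2 (by positivity)
  have hX' : X = c ^ 2 - 1 := by linarith
  have hden : ∀ θ, 0 < c * Real.cos θ ^ 2 + Real.sin θ ^ 2 := by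
    intro θ
    rcases eq_or_ne (Real.cos θ) 0 with h | h
    · have := Real.sin_sq_add_cos_sq θ
      rw [h] at this ⊢
      nlinarith
    · positivity
  have hderiv : ∀ θ, HasDerivAt (fun θ => c⁻¹ * (θ - Real.arctan
      ((c - 1) * (Real.sin θ * Real.cos θ) / (c * Real.cos θ ^ 2 + Real.sin θ ^ 2))))
      (1 + X * Real.cos θ ^ 2)⁻¹ θ := by
    intro θ
    have hs := Real.hasDerivAt_sin θ
    have hco := Real.hasDerivAt_cos θ
    have h1 := ((hs.mul hco).const_mul (c - 1)).div (((hco.pow 2).const_mul c).add (hs.pow 2))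
      (hden θ).ne'
    have h2 := ((hasDerivAt_id θ).sub h1.arctan).const_mul c⁻¹
    refine h2.congr_deriv ?_
    simp only [Pi.div_apply, Pi.add_apply, Pi.mul_apply, Pi.pow_apply]
    have hp := Real.sin_sq_add_cos_sq θ
    have hd := hden θ
    have hd2 : 0 < 1 + X * Real.cos θ ^ 2 := by positivity
    set s := Real.sin θ
    set k := Real.cos θ
    have hs2 : s ^ 2 = 1 - k ^ 2 := by linarith
    have hD : (c * k ^ 2 + s ^ 2) ^ 2 + ((c - 1) * (s * k)) ^ 2 = 1 + X * k ^ 2 := by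
      rw [mul_pow, mul_pow, hs2, hX']; ring
    have hD' : 1 + ((c - 1) * (s * k) / (c * k ^ 2 + s ^ 2)) ^ 2
        = (1 + X * k ^ 2) / (c * k ^ 2 + s ^ 2) ^ 2 := by
      rw [← hD]; field_simp
    rw [hD']
    field_simp
    have : s ^ 4 = (1 - k ^ 2) ^ 2 := by rw [← hs2]; ring
    push_cast
    ring_nf
    rw [hX']
    simp only [hs2, this]
    ring
  have hcont : Continuous fun θ : ℝ => (1 + X * Real.cos θ ^ 2)⁻¹ :=
    Continuous.inv₀ (by fun_prop) (fun θ => by positivity)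
  rw [angAvg, intervalIntegral.integral_eq_sub_of_hasDerivAt (fun θ _ => hderiv θ)
    (hcont.intervalIntegrable _ _)]
  -- The sine vanishes at ±π, so the arctangent contributes nothing and only 2π/c survives.
  simp
  field_simp
  norm_num

end Average

/-! ### The characteristic function of a sum over independent uniform stars. -/

section CharFun

variable {E : Type*} [NormedAddCommGroup E] [InnerProductSpace ℝ E] [FiniteDimensional ℝ E]
  [MeasurableSpace E] [BorelSpace E]

/-- The characteristic function of `F (ξ - x)`, for `ξ` uniformly distributed over the disc of
radius `R` about the origin. -/
def starCharFun (R : ℝ) (x : Plane) (F : Plane → E) (t : E) : ℂ :=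
  angAvg fun θ => ((2 / R ^ 2 : ℝ) : ℂ) *
    ∫ r in (0 : ℝ)..chord R x θ, (r : ℂ) * cexp ((⟪F (polarPt r θ), t⟫ : ℝ) * I)

lemma discRadius_sq (g : ℕ) : discRadius g ^ 2 = g / Real.pi :=
  Real.sq_sqrt (by positivity)

/-- The factor 2/R² is the quotient of 2π, hidden in `angAvg`, by the area πR². -/
lemma integral_uniform_eq {g : ℕ} {x : Plane} (hx : ‖x‖ < discRadius g)
    {h : Plane → ℂ} (hm : Measurable h) (hb : ∀ z, ‖h z‖ ≤ 1) :
    ∫ z, h (z - x) ∂(ProbabilityTheory.cond volume (Metric.closedBall (0 : Plane) (discRadius g)))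
      = angAvg fun θ => ((2 / discRadius g ^ 2 : ℝ) : ℂ) *
        ∫ r in (0 : ℝ)..chord (discRadius g) x θ, (r : ℂ) * h (polarPt r θ) := by
  have hR : 0 < discRadius g := (norm_nonneg x).trans_lt hx
  have hv : (volume (Metric.closedBall (0 : Plane) (discRadius g))).toReal
      = discRadius g ^ 2 * Real.pi := by
    rw [EuclideanSpace.volume_closedBall_fin_two, ENNReal.toReal_mul, ENNReal.toReal_pow,
      ENNReal.toReal_ofReal hR.le]
    simp [Real.pi_pos.le]
  rw [ProbabilityTheory.cond, integral_smul_measure, setIntegral_closedBall_sub hx hm hb,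
    ENNReal.toReal_inv, hv, angAvg, intervalIntegral.integral_const_mul]
  simp only [real_smul]
  push_cast
  field_simp

lemma charFun_map_uniform {Ω : Type*} [MeasurableSpace Ω] {P : Measure Ω}
    {g : ℕ} {x : Plane} (hx : ‖x‖ < discRadius g) {F : Plane → E} (hF : Measurable F)
    {ξ : Ω → Plane} (hmeas : Measurable ξ)
    (hunif : pdf.IsUniform ξ (Metric.closedBall 0 (discRadius g)) P volume) (t : E) :
    charFun (P.map fun ω => F (ξ ω - x)) t = starCharFun (discRadius g) x F t := by
  have hFm : Measurable fun ω => F (ξ ω - x) := hF.comp (hmeas.sub_const x)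
  rw [charFun_apply, integral_map hFm.aemeasurable
    (Continuous.aestronglyMeasurable (by fun_prop))]
  have hm : Measurable fun z : Plane => cexp ((⟪F z, t⟫ : ℝ) * I) := by fun_prop
  rw [starCharFun, ← integral_uniform_eq (h := fun z => cexp ((⟪F z, t⟫ : ℝ) * I)) hx hm
    (fun z => by rw [norm_exp_ofReal_mul_I]), ← hunif, integral_map hmeas.aemeasurable]
  exact (hm.comp (measurable_id.sub_const x)).aestronglyMeasurable

/-- The common entry point for time delay, lensing map and shear: independence turns the
characteristic function of the sum into a g-th power. -/
lemma charFun_map_sum_uniform {Ω : Type*} [MeasurableSpace Ω] {P : Measure Ω} [IsProbabilityMeasure P]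
    {g : ℕ} {x : Plane} (hx : ‖x‖ < discRadius g) {F : Plane → E} (hF : Measurable F)
    {ξ : Fin g → Ω → Plane} (hmeas : ∀ j, Measurable (ξ j)) (hindep : iIndepFun ξ P)
    (hunif : ∀ j, pdf.IsUniform (ξ j) (Metric.closedBall 0 (discRadius g)) P volume) (c t : E) :
    charFun (P.map fun ω => c + ∑ j, F (ξ j ω - x)) t
      = cexp ((⟪c, t⟫ : ℝ) * I) * starCharFun (discRadius g) x F t ^ g := by
  have hFm : Measurable fun z => F (z - x) := hF.comp (measurable_id.sub_const x)
  have hm : ∀ j, Measurable fun ω => F (ξ j ω - x) := fun j => hFm.comp (hmeas j)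
  have h1 : P.map (fun ω => c + ∑ j, F (ξ j ω - x))
      = (P.map fun ω => ∑ j, F (ξ j ω - x)).map (fun z => c + z) := by
    rw [Measure.map_map (by fun_prop) (by fun_prop)]; rfl
  rw [h1, charFun_map_const_add, 
    iIndepFun.charFun_map_fun_sum_eq_prod (fun j => (hm j).aemeasurable)
      (hindep.comp (fun _ z => F (z - x)) (fun _ => hFm))]
  simp only [Finset.prod_apply, charFun_map_uniform hx hF (hmeas _) (hunif _), Finset.prod_const,
    Finset.card_univ, Fintype.card_fin]
  rw [mul_comm]

end CharFun

/-! ### Elementary inequalities and complex Laplace integrals. -/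

section Toolbox

/-- In the left half plane the Taylor remainder carries no exponential factor. Along the ray u ↦ uz,
the derivative of the remainder of order n + 1 is z times the remainder of order n, so the bound
integrates up by induction. -/
lemma norm_exp_sub_sum_le_of_re_nonpos (n : ℕ) {z : ℂ} (hz : z.re ≤ 0) :
    ‖cexp z - ∑ k ∈ Finset.range n, z ^ k / (k.factorial : ℂ)‖ ≤ ‖z‖ ^ n / n.factorial := by
  induction n generalizing z with
  | zero => simpa [Complex.norm_exp] using hz
  | succ n ih =>
    have hd : ∀ u : ℝ, HasDerivAt (fun u : ℝ => cexp (u * z) -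
        ∑ k ∈ Finset.range (n + 1), (u * z) ^ k / (k.factorial : ℂ))
        (z * (cexp (u * z) - ∑ k ∈ Finset.range n, (u * z) ^ k / (k.factorial : ℂ))) u := by
      intro u
      have h0 : HasDerivAt (fun u : ℝ => (u : ℂ) * z) z u := by
        simpa using (ofRealCLM.hasDerivAt (x := u)).mul_const z
      have hsum : HasDerivAt (fun u : ℝ =>
          ∑ k ∈ Finset.range (n + 1), (u * z) ^ k / (k.factorial : ℂ))
          (∑ k ∈ Finset.range n, z * ((u * z) ^ k / (k.factorial : ℂ))) u := by
        simp only [Finset.sum_range_succ']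
        simp only [pow_zero, Nat.factorial_zero, Nat.cast_one, div_one]
        refine HasDerivAt.add_const _ (HasDerivAt.fun_sum fun k _ => ?_)
        refine ((h0.pow (k + 1)).div_const _).congr_deriv ?_
        have : (k.factorial : ℂ) ≠ 0 := by exact_mod_cast k.factorial_ne_zero
        have : (k + 1 : ℂ) ≠ 0 := by exact_mod_cast k.succ_ne_zero
        rw [Nat.factorial_succ]
        push_cast
        field_simp
      refine (h0.cexp.sub hsum).congr_deriv ?_
      rw [mul_sub, Finset.mul_sum, mul_comm]
    have hc : Continuous fun u : ℝ =>
        z * (cexp (u * z) - ∑ k ∈ Finset.range n, (u * z) ^ k / (k.factorial : ℂ)) := by fun_prop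
    have hi := intervalIntegral.integral_eq_sub_of_hasDerivAt (a := 0) (b := 1)
      (fun u _ => hd u) (hc.intervalIntegrable _ _)
    have h00 : ∑ k ∈ Finset.range (n + 1), ((0 : ℝ) * z) ^ k / (k.factorial : ℂ) = 1 := by
      rw [Finset.sum_range_succ']; simp
    rw [h00] at hi
    simp only [ofReal_one, one_mul, ofReal_zero, zero_mul, Complex.exp_zero, sub_self,
      sub_zero] at hi
    rw [← hi]
    have hb : Continuous fun u : ℝ => ‖z‖ ^ (n + 1) / n.factorial * u ^ n := by fun_prop
    refine (intervalIntegral.norm_integral_le_of_norm_le zero_le_one (ae_of_all _ fun u hu => ?_)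
      (hb.intervalIntegrable _ _)).trans (le_of_eq ?_)
    · have hu0 : 0 ≤ u := hu.1.le
      rw [norm_mul]
      have := ih (z := u * z) (by
        rw [Complex.re_ofReal_mul]; exact mul_nonpos_of_nonneg_of_nonpos hu0 hz)
      rw [norm_mul, norm_real, Real.norm_of_nonneg hu0] at this
      calc _ ≤ ‖z‖ * ((u * ‖z‖) ^ n / n.factorial) := by gcongr
        _ = _ := by ring
    · rw [intervalIntegral.integral_const_mul, integral_pow, Nat.factorial_succ]
      push_cast
      field_simp
      simp

lemma norm_cexp_I_sub_one_sub_le (y : ℝ) : ‖cexp (y * I) - 1 - y * I‖ ≤ y ^ 2 / 2 := by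
  have := norm_exp_sub_sum_le_of_re_nonpos 2 (z := y * I) (by simp)
  simpa [Finset.sum_range_succ, sub_sub] using this

/-- Telescoping that retains M^(n-1): the decay of the bases survives in the error, which is what
makes the error integrable. -/
lemma norm_pow_sub_pow_le_mul {a b : ℂ} {M : ℝ} (ha : ‖a‖ ≤ M) (hb : ‖b‖ ≤ M) (n : ℕ) :
    ‖a ^ n - b ^ n‖ ≤ n * ‖a - b‖ * M ^ (n - 1) := by
  have hM : 0 ≤ M := (norm_nonneg a).trans ha
  rcases n with _ | n
  · simp
  rw [← (Commute.all a b).mul_geom_sum₂, norm_mul, mul_comm (((n + 1 : ℕ) : ℝ)), mul_assoc]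
  gcongr
  refine (norm_sum_le _ _).trans ?_
  have : ∀ i ∈ Finset.range (n + 1), ‖a ^ i * b ^ (n + 1 - 1 - i)‖ ≤ M ^ n := by
    intro i hi
    have hi' : i ≤ n := by simpa [Nat.lt_succ_iff] using hi
    rw [norm_mul, norm_pow, norm_pow]
    calc _ ≤ M ^ i * M ^ (n + 1 - 1 - i) := by gcongr
      _ = M ^ n := by rw [← pow_add]; congr 1; omega
  refine (Finset.sum_le_sum this).trans ?_
  simp

/-- Bernoulli's inequality with exponent n/k. It trades a power growing with n for polynomial growth
of fixed order k in the rescaled variable n u. -/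
lemma one_add_pow_le_one_add_pow {u : ℝ} (hu : 0 ≤ u) {n k : ℕ} (hk : 0 < k) (hkn : k ≤ n) :
    (1 + n * u / k) ^ k ≤ (1 + u) ^ n := by
  have h1 : (1 : ℝ) ≤ n / k := by
    rw [le_div_iff₀ (by positivity)]; simpa using (by exact_mod_cast hkn : (k : ℝ) ≤ n)
  have h2 := one_add_mul_self_le_rpow_one_add (s := u) (by linarith) h1
  calc (1 + n * u / k) ^ k = (1 + n / k * u) ^ k := by ring
    _ ≤ ((1 + u) ^ ((n : ℝ) / k)) ^ k := by gcongr
    _ = (1 + u) ^ n := by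
      rw [← Real.rpow_natCast, ← Real.rpow_mul (by positivity), div_mul_cancel₀ _ (by positivity),
        Real.rpow_natCast]

lemma tendsto_discRadius : Tendsto discRadius atTop atTop := by
  unfold discRadius
  exact Real.tendsto_sqrt_atTop.comp
    (tendsto_natCast_atTop_atTop.atTop_div_const Real.pi_pos)

lemma integrable_inv_one_add_norm_pow {E : Type*} [NormedAddCommGroup E] [NormedSpace ℝ E]
    [FiniteDimensional ℝ E] [MeasurableSpace E] [BorelSpace E] (μ : Measure E) [μ.IsAddHaarMeasure]
    {n : ℕ} (hn : Module.finrank ℝ E < n) : Integrable (fun t : E => ((1 + ‖t‖) ^ n)⁻¹) μ := by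
  have := integrable_one_add_norm (E := E) (μ := μ) (r := n) (by exact_mod_cast hn)
  refine this.congr (ae_of_all _ fun t => ?_)
  simp only
  rw [Real.rpow_neg (by positivity), Real.rpow_natCast]

lemma integrableOn_pow_mul_cexp_neg_mul (n : ℕ) {z : ℂ} (hz : 0 < z.re) :
    IntegrableOn (fun u : ℝ => (u : ℂ) ^ n * cexp (-(z * u))) (Set.Ioi 0) := by
  have h := integrableOn_rpow_mul_exp_neg_mul_rpow (s := n) (p := 1) (b := z.re)
    (by linarith [(Nat.cast_nonneg n : (0 : ℝ) ≤ n)]) one_pos hz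
  refine h.mono' (Continuous.aestronglyMeasurable (by fun_prop)) ?_
  filter_upwards [ae_restrict_mem measurableSet_Ioi] with u hu
  have hu' : 0 < u := hu
  rw [norm_mul, norm_pow, norm_real, Real.norm_of_nonneg hu'.le, Complex.norm_exp, Real.rpow_natCast,
    Real.rpow_one]
  simp

lemma tendsto_pow_mul_cexp_neg_mul (n : ℕ) {z : ℂ} (hz : 0 < z.re) :
    Tendsto (fun u : ℝ => (u : ℂ) ^ n * cexp (-(z * u))) atTop (𝓝 0) := by
  rw [tendsto_zero_iff_norm_tendsto_zero]
  have h := tendsto_rpow_mul_exp_neg_mul_atTop_nhds_zero n z.re hz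
  refine h.congr' ?_
  filter_upwards [eventually_ge_atTop 0] with u hu
  rw [norm_mul, norm_pow, norm_real, Real.norm_of_nonneg hu, Complex.norm_exp, Real.rpow_natCast]
  simp

/-- The Laplace transform of a power, for a complex argument. -/
lemma integral_pow_mul_cexp_neg_mul (n : ℕ) {z : ℂ} (hz : 0 < z.re) :
    ∫ u in Set.Ioi (0 : ℝ), (u : ℂ) ^ n * cexp (-(z * u)) = n.factorial / z ^ (n + 1) := by
  have hz0 : z ≠ 0 := by rintro rfl; simp at hz
  have hexp : ∀ u : ℝ, HasDerivAt (fun u : ℝ => cexp (-(z * u))) (-z * cexp (-(z * u))) u := by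
    intro u
    have h0 : HasDerivAt (fun u : ℝ => -(z * (u : ℂ))) (-(z * 1)) u :=
      ((ofRealCLM.hasDerivAt (x := u)).const_mul z).neg
    refine h0.cexp.congr_deriv (by ring)
  induction n with
  | zero =>
    have := integral_Ioi_of_hasDerivAt_of_tendsto' (a := 0)
      (f := fun u : ℝ => -z⁻¹ * cexp (-(z * u))) (f' := fun u : ℝ => (u : ℂ) ^ 0 * cexp (-(z * u)))
      (m := 0) (fun u _ => ((hexp u).const_mul _).congr_deriv (by field_simp))
      (integrableOn_pow_mul_cexp_neg_mul 0 hz)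
      (by simpa using (tendsto_pow_mul_cexp_neg_mul 0 hz).const_mul (-z⁻¹))
    rw [this]
    simp
  | succ n ih =>
    have i1 := integrableOn_pow_mul_cexp_neg_mul n hz
    have i2 := integrableOn_pow_mul_cexp_neg_mul (n + 1) hz
    have := integral_Ioi_of_hasDerivAt_of_tendsto' (a := 0)
      (f := fun u : ℝ => (u : ℂ) ^ (n + 1) * cexp (-(z * u)))
      (f' := fun u : ℝ => (n + 1 : ℂ) * ((u : ℂ) ^ n * cexp (-(z * u))) -
        z * ((u : ℂ) ^ (n + 1) * cexp (-(z * u))))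
      (m := 0) (fun u _ => (((ofRealCLM.hasDerivAt (x := u)).pow (n + 1)).mul (hexp u)).congr_deriv
        (by simp; ring))
      ((i1.const_mul _).sub (i2.const_mul _))
      (tendsto_pow_mul_cexp_neg_mul (n + 1) hz)
    rw [integral_sub (i1.const_mul _) (i2.const_mul _), integral_const_mul, integral_const_mul,
      ih] at this
    simp only [ofReal_zero, ne_eq, Nat.add_eq_zero_iff, one_ne_zero, and_false, not_false_eq_true,
      zero_pow, zero_mul, sub_self] at this
    rw [Nat.factorial_succ]
    push_cast
    have h3 : z * ∫ u in Set.Ioi (0 : ℝ), (u : ℂ) ^ (n + 1) * cexp (-(z * u))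
        = (n + 1) * (n.factorial / z ^ (n + 1)) := by linear_combination -this
    rw [eq_div_iff (pow_ne_zero _ hz0)]
    have h4 : (n + 1) * (n.factorial / z ^ (n + 1)) * z ^ (n + 1) = ((n + 1) * n.factorial : ℂ) := by
      field_simp
    rw [← h4, ← h3]
    ring

end Toolbox

/-! ### Inversion for an explicitly known continuous density. -/

section FourierPair

variable {E : Type*} [NormedAddCommGroup E] [InnerProductSpace ℝ E] [FiniteDimensional ℝ E]
  [MeasurableSpace E] [BorelSpace E]

lemma eq_invCharFun_of_continuous {p : E → ℝ} (hp : Continuous p) (hpi : Integrable p) {Q : E → ℂ}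
    (hQ : Integrable Q) (h : ∀ t, ∫ q, cexp ((⟪q, t⟫ : ℝ) * I) * p q = Q t) (q : E) :
    (p q : ℂ) = invCharFun Q q := by
  set f : E → ℂ := fun q => p q with hf
  have hF : 𝓕 f = fun v => Q ((-(2 * Real.pi)) • v) := by
    ext v
    rw [Real.fourier_eq', ← h]
    congr 1 with q
    simp only [inner_smul_right, smul_eq_mul, hf, neg_mul]
  have hFi : Integrable (𝓕 f) := by
    rw [hF]; exact hQ.comp_smul (by simp [Real.pi_ne_zero])
  have key := congrFun ((continuous_ofReal.comp hp).fourierInv_fourier_eq (hpi.ofReal) hFi) q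
  have key' : 𝓕⁻ (𝓕 f) q = p q := key
  rw [← key', invCharFun_eq_fourierInv, hF, Real.fourierInv_eq']
  congr 1 with v
  rw [smul_eq_mul, real_inner_comm]
  push_cast
  rfl

end FourierPair

/-! ### Angular averages of the chord length and of its logarithm. -/

section ChordAverages

variable {R : ℝ} {x : Plane}

/-- In polar coordinates about x this says that the disc has area πR². -/
lemma angAvg_chord_sq (hx : ‖x‖ < R) : angAvg (fun θ => chord R x θ ^ 2) = R ^ 2 := by
  have hc := continuous_chord R x
  have hd := continuous_dirComp x
  rw [angAvg_eq_pair (by fun_prop) (fun θ => by simp only [chord_periodic R x θ]) Real.pi]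
  have e : ∀ θ, (2 : ℝ)⁻¹ • (chord R x θ ^ 2 + chord R x (θ + Real.pi) ^ 2)
      = (R ^ 2 - ‖x‖ ^ 2) + 2 * dirComp x θ ^ 2 := by
    intro θ; rw [chord_sq_add_chord_sq hx, smul_eq_mul]; ring
  simp only [e]
  rw [angAvg_add (by fun_prop) (by fun_prop), angAvg_const_mul, angAvg_dirComp_sq, angAvg_const]
  ring

lemma abs_chord_div_sub_one_le (hx : ‖x‖ < R) (θ : ℝ) : |chord R x θ / R - 1| ≤ ‖x‖ / R := by
  have hR : 0 < R := (norm_nonneg x).trans_lt hx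
  have h1 := le_chord hx θ
  have h2 := chord_le hx θ
  rw [div_sub_one hR.ne', abs_div, abs_of_pos hR]
  gcongr
  rw [abs_le]; constructor <;> linarith

/-- With y = √(1 + w) the remainder is exactly -(y - 1)²/2, and |y - 1| ≤ |w| since y + 1 ≥ 1. -/
lemma abs_sqrt_one_add_sub_le {w : ℝ} (hw : -1 ≤ w) : |√(1 + w) - 1 - w / 2| ≤ w ^ 2 / 2 := by
  have h1 := Real.sq_sqrt (show 0 ≤ 1 + w by linarith)
  have h0 := Real.sqrt_nonneg (1 + w)
  set y := √(1 + w)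
  have hy : y - 1 - w / 2 = -(y - 1) ^ 2 / 2 := by linear_combination h1 / 2
  have hw2 : w = (y - 1) * (y + 1) := by linear_combination -h1
  rw [hy, abs_div, abs_neg, abs_of_nonneg (sq_nonneg _), abs_two, hw2]
  gcongr ?_ / 2
  nlinarith [sq_nonneg (y - 1)]

/-- In ρ/R = √(1 + w) - d/R the odd term d averages to zero, and w/2 averages to -(|x|/R)²/4 because
d² has mean |x|²/2. -/
lemma abs_angAvg_chord_sub_le (hx : ‖x‖ < R) :
    |angAvg (fun θ => chord R x θ / R - 1) + (‖x‖ / R) ^ 2 / 4| ≤ (‖x‖ / R) ^ 4 / 2 := by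
  have hR : 0 < R := (norm_nonneg x).trans_lt hx
  have hd := continuous_dirComp x
  set w : ℝ → ℝ := fun θ => (dirComp x θ ^ 2 - ‖x‖ ^ 2) / R ^ 2 with hw
  have hwc : Continuous w := by fun_prop
  have hwb : ∀ θ, |w θ| ≤ (‖x‖ / R) ^ 2 := by
    intro θ
    rw [hw, div_pow, abs_div, abs_of_pos (by positivity : 0 < R ^ 2)]
    gcongr
    rw [abs_le]
    constructor <;> nlinarith [dirComp_sq_le x θ, sq_nonneg (dirComp x θ), sq_nonneg ‖x‖]
  have ha : (‖x‖ / R) ^ 2 ≤ 1 := by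
    rw [div_pow, div_le_one (by positivity)]; gcongr
  have e : ∀ θ, chord R x θ / R - 1 = ((√(1 + w θ) - 1 - w θ / 2) + w θ / 2) - R⁻¹ * dirComp x θ := by
    intro θ
    have : √(1 + w θ) = √(R ^ 2 - ‖x‖ ^ 2 + dirComp x θ ^ 2) / R := by
      rw [hw, eq_div_iff hR.ne', ← Real.sqrt_sq hR.le, ← Real.sqrt_mul' _ (sq_nonneg _),
        Real.sqrt_sq hR.le]
      congr 1; field_simp; ring
    rw [chord, this]; field_simp; ring
  have hzero : angAvg (fun θ => R⁻¹ * dirComp x θ) = 0 := by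
    rw [angAvg_const_mul, angAvg_eq_zero_of_antiperiodic hd (dirComp_periodic x) (dirComp_add_pi x),
      mul_zero]
  have hw2 : angAvg (fun θ => w θ / 2) = -(‖x‖ / R) ^ 2 / 4 := by
    have : ∀ θ, w θ / 2 = (2 * R ^ 2)⁻¹ * (dirComp x θ ^ 2 - ‖x‖ ^ 2) := by
      intro θ; rw [hw]; field_simp
    simp only [this]
    rw [angAvg_const_mul, angAvg_sub (by fun_prop) (by fun_prop), angAvg_dirComp_sq, angAvg_const]
    field_simp; ring
  simp only [e]
  rw [angAvg_sub (by fun_prop) (by fun_prop), angAvg_add (by fun_prop) (by fun_prop), hzero, hw2]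
  have : angAvg (fun θ => √(1 + w θ) - 1 - w θ / 2) + -(‖x‖ / R) ^ 2 / 4 - 0 + (‖x‖ / R) ^ 2 / 4
      = angAvg (fun θ => √(1 + w θ) - 1 - w θ / 2) := by ring
  rw [this, ← Real.norm_eq_abs]
  refine norm_angAvg_le_const (by fun_prop) fun θ => ?_
  have h1 := hwb θ
  rw [Real.norm_eq_abs]
  refine (abs_sqrt_one_add_sub_le (by linarith [(abs_le.1 h1).1])).trans ?_
  gcongr ?_ / 2
  calc w θ ^ 2 = |w θ| ^ 2 := (sq_abs _).symm
    _ ≤ ((‖x‖ / R) ^ 2) ^ 2 := by gcongr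
    _ = _ := by ring

lemma abs_log_one_add_sub_le {u : ℝ} (hu : |u| ≤ 1 / 2) :
    |Real.log (1 + u) - (u - u ^ 2 / 2)| ≤ 2 * |u| ^ 3 := by
  have h := Real.abs_log_sub_add_sum_range_le (x := -u) (by rw [abs_neg]; linarith) 2
  simp only [Finset.sum_range_succ, Finset.sum_range_zero, abs_neg, sub_neg_eq_add] at h
  calc _ = |_| := by congr 1; push_cast; ring
    _ ≤ _ := h
    _ ≤ _ := by
      rw [div_le_iff₀ (by linarith)]
      change |u| ^ 3 ≤ _
      nlinarith [mul_nonneg (pow_nonneg (abs_nonneg u) 3) (by linarith : 0 ≤ 1 - 2 * |u|)]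

lemma abs_log_one_add_le {u : ℝ} (hu : |u| ≤ 1 / 2) : |Real.log (1 + u)| ≤ 2 * |u| := by
  have h := abs_log_one_add_sub_le hu
  have h1 : |u - u ^ 2 / 2| ≤ |u| + |u| ^ 2 / 2 := by
    refine (abs_sub _ _).trans (le_of_eq ?_)
    rw [abs_div, abs_pow, abs_two]
  have h2 := abs_add_le (Real.log (1 + u) - (u - u ^ 2 / 2)) (u - u ^ 2 / 2)
  rw [sub_add_cancel] at h2
  have h0 := abs_nonneg u
  have h3 : |u| ^ 2 ≤ |u| / 2 := by nlinarith
  have h4 : |u| ^ 3 ≤ |u| / 4 := by nlinarith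
  linarith

lemma abs_sq_mul_log_sub_le {u : ℝ} (hu : |u| ≤ 1 / 2) :
    |(1 + u) ^ 2 * Real.log (1 + u) - (u + 3 / 2 * u ^ 2)| ≤ 5 * |u| ^ 3 := by
  have h := abs_log_one_add_sub_le hu
  have h0 := abs_nonneg u
  set L := Real.log (1 + u) - (u - u ^ 2 / 2) with hL
  have e : (1 + u) ^ 2 * Real.log (1 + u) - (u + 3 / 2 * u ^ 2) = (1 + u) ^ 2 * L - u ^ 4 / 2 := by
    rw [hL]; ring
  rw [e]
  have h1 : |(1 + u) ^ 2 * L| ≤ 9 / 4 * (2 * |u| ^ 3) := by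
    rw [abs_mul, abs_of_nonneg (sq_nonneg (1 + u))]
    have := abs_le.1 hu
    gcongr
    nlinarith
  have h2 : |u ^ 4 / 2| ≤ |u| ^ 3 / 4 := by
    rw [abs_div, abs_pow, abs_two]
    nlinarith [pow_nonneg h0 3]
  have := abs_sub ((1 + u) ^ 2 * L) (u ^ 4 / 2)
  linarith [pow_nonneg h0 3]

/-- With u = ρ/R - 1, the function (1 + u)² log(1 + u) is u + 3u²/2 up to cubic order. Since (ρ/R)²
has mean 1, the mean of u² is -2 times that of u, so the total is -2 times the mean of u. This
average becomes the shift c of the time delay. -/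
lemma abs_angAvg_sq_mul_log_sub_le (hx : ‖x‖ ≤ R / 2) (hR : 0 < R) :
    |angAvg (fun θ => (chord R x θ / R) ^ 2 * Real.log (chord R x θ / R)) - (‖x‖ / R) ^ 2 / 2|
      ≤ 6 * (‖x‖ / R) ^ 3 := by
  have hx' : ‖x‖ < R := by linarith
  have hc := continuous_chord R x
  set a := ‖x‖ / R with ha
  have ha0 : 0 ≤ a := by positivity
  have ha1 : a ≤ 1 / 2 := by rw [ha, div_le_iff₀ hR]; linarith
  set u : ℝ → ℝ := fun θ => chord R x θ / R - 1 with hu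
  have hub : ∀ θ, |u θ| ≤ a := abs_chord_div_sub_one_le hx'
  have huc : Continuous u := by fun_prop
  have h1u : ∀ θ, chord R x θ / R = 1 + u θ := fun θ => by rw [hu]; ring
  have hlc : Continuous fun θ => Real.log (1 + u θ) :=
    Continuous.log (by fun_prop) fun θ => by have := abs_le.1 (hub θ); linarith
  have hu1 := abs_angAvg_chord_sub_le hx'
  rw [← ha, ← hu] at hu1
  have hu2 : angAvg (fun θ => u θ ^ 2) = -2 * angAvg u := by
    have e : ∀ θ, u θ ^ 2 = (R ^ 2)⁻¹ * chord R x θ ^ 2 - (1 + 2 * u θ) := by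
      intro θ; rw [hu]; field_simp; ring
    simp only [e]
    rw [angAvg_sub (by fun_prop) (by fun_prop), angAvg_const_mul, angAvg_chord_sq hx',
      angAvg_add (by fun_prop) (by fun_prop), angAvg_const, angAvg_const_mul]
    field_simp; ring
  have key : |angAvg (fun θ => (1 + u θ) ^ 2 * Real.log (1 + u θ) - (u θ + 3 / 2 * u θ ^ 2))|
      ≤ 5 * a ^ 3 := by
    rw [← Real.norm_eq_abs]
    refine norm_angAvg_le_const (by fun_prop) fun θ => ?_
    refine (abs_sq_mul_log_sub_le ((hub θ).trans ha1)).trans ?_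
    gcongr
    exact hub θ
  rw [angAvg_sub (by fun_prop) (by fun_prop), angAvg_add (by fun_prop) (by fun_prop),
    angAvg_const_mul, hu2] at key
  simp only [h1u]
  have h4 : a ^ 4 ≤ a ^ 3 := by nlinarith [pow_nonneg ha0 3]
  rw [abs_le] at *
  constructor <;> linarith

end ChordAverages

/-! ### The single-star characteristic function of the time delay. -/

section TimeDelay

variable {R : ℝ} {x : Plane}

lemma real_inner_eq_mul (a b : ℝ) : (⟪a, b⟫ : ℝ) = a * b := by
  simp [mul_comm]

/-- The radial integrand is a constant phase times r^(1 - iT) with T = mt, and the integral of this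
power is ρ^(2 - iT)/(2 - iT). -/
lemma starCharFun_timeDelay (hx : ‖x‖ < R) (m t : ℝ) :
    starCharFun R x (fun z => m * Real.log R - m * Real.log ‖z‖) t =
      2 / (2 - (m * t : ℝ) * I) *
        angAvg fun θ => (((chord R x θ / R) ^ 2 : ℝ) : ℂ) *
          cexp ((-(m * t) * Real.log (chord R x θ / R) : ℝ) * I) := by
  have hR : 0 < R := (norm_nonneg x).trans_lt hx
  rw [starCharFun, ← angAvg_const_mul_complex]
  congr 1 with θ
  have hρ := chord_pos hx θ
  set ρ := chord R x θ
  set T := m * t with hT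
  have h2 : (2 - (T : ℂ) * I) ≠ 0 := by
    intro h; have := congrArg Complex.re h; simp at this
  have e1 : ∫ r in (0 : ℝ)..ρ, (r : ℂ) * cexp ((⟪m * Real.log R - m * Real.log ‖polarPt r θ‖, t⟫ : ℝ) * I)
      = ∫ r in (0 : ℝ)..ρ, cexp ((T * Real.log R : ℝ) * I) * (r : ℂ) ^ (1 - (T : ℂ) * I) := by
    refine intervalIntegral.integral_congr_ae (ae_of_all _ fun r hr => ?_)
    rw [Set.uIoc_of_le hρ.le] at hr
    have hr0 : 0 < r := hr.1
    rw [norm_polarPt hr0.le, cpow_sub _ _ (by exact_mod_cast hr0.ne'), cpow_one,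
      cpow_def_of_ne_zero (by exact_mod_cast hr0.ne'), ← ofReal_log hr0.le, div_eq_mul_inv,
      ← Complex.exp_neg, mul_left_comm, ← Complex.exp_add]
    congr 2
    rw [real_inner_eq_mul, hT]
    push_cast
    ring
  rw [e1, intervalIntegral.integral_const_mul, integral_cpow (by left; simp)]
  have e2 : (1 - (T : ℂ) * I + 1) = 2 - (T : ℂ) * I := by ring
  rw [e2, ofReal_zero, zero_cpow h2, sub_zero, cpow_sub _ _ (by exact_mod_cast hρ.ne'),
    cpow_def_of_ne_zero (by exact_mod_cast hρ.ne') (↑T * I), ← ofReal_log hρ.le,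
    Real.log_div hρ.ne' hR.ne']
  have e3 : ((ρ : ℂ) ^ (2 : ℂ)) = (ρ : ℂ) ^ 2 := by
    exact_mod_cast cpow_natCast (ρ : ℂ) 2
  have e4 : ((-T * (Real.log ρ - Real.log R) : ℝ) : ℂ) * I
      = (T * Real.log R : ℝ) * I - Real.log ρ * (T * I) := by push_cast; ring
  rw [e3, e4, Complex.exp_sub]
  have : (R : ℂ) ≠ 0 := by exact_mod_cast hR.ne'
  have h5 : cexp (Real.log ρ * (T * I)) ≠ 0 := Complex.exp_ne_zero _
  push_cast
  field_simp

lemma norm_two_sub_mul_I (T : ℝ) : ‖(2 : ℂ) - T * I‖ = 2 * √(1 + T ^ 2 / 4) := by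
  have : ‖(2 : ℂ) - T * I‖ ^ 2 = (2 * √(1 + T ^ 2 / 4)) ^ 2 := by
    rw [mul_pow, Real.sq_sqrt (by positivity), ← Complex.normSq_eq_norm_sq, Complex.normSq_apply]
    simp; ring
  exact (pow_left_inj₀ (norm_nonneg _) (by positivity) two_ne_zero).1 this

lemma norm_two_div (T : ℝ) : ‖(2 : ℂ) / (2 - T * I)‖ = (√(1 + T ^ 2 / 4))⁻¹ := by
  rw [norm_div, norm_two_sub_mul_I, Complex.norm_ofNat]
  field_simp

/-- The weights (ρ/R)² average to 1 and the phases have modulus 1, so only the factor 2/(2 - iT)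
remains. -/
lemma norm_starCharFun_timeDelay_le (hx : ‖x‖ < R) (m t : ℝ) :
    ‖starCharFun R x (fun z => m * Real.log R - m * Real.log ‖z‖) t‖
      ≤ (√(1 + (m * t) ^ 2 / 4))⁻¹ := by
  have hR : 0 < R := (norm_nonneg x).trans_lt hx
  have hc := continuous_chord R x
  rw [starCharFun_timeDelay hx, norm_mul, norm_two_div]
  refine mul_le_of_le_one_right (by positivity) ?_
  refine (norm_angAvg_le_angAvg_norm _).trans (le_of_eq ?_)
  have : ∀ θ, ‖(((chord R x θ / R) ^ 2 : ℝ) : ℂ) *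
      cexp ((-(m * t) * Real.log (chord R x θ / R) : ℝ) * I)‖ = (R ^ 2)⁻¹ * chord R x θ ^ 2 := by
    intro θ
    rw [norm_mul, norm_exp_ofReal_mul_I, norm_real, Real.norm_of_nonneg (by positivity)]
    field_simp
  simp only [this]
  rw [angAvg_const_mul, angAvg_chord_sq hx]
  field_simp

/-- Both the average and the target phase are compared with their linearization 1 - iTb, where b is
the mean of (ρ/R)² log(ρ/R). The factor 2/(2 - iT) stays in the bound, to supply decay after the
g-th power. -/
lemma norm_starCharFun_timeDelay_sub_le (hx : ‖x‖ ≤ R / 2) (hR : 0 < R) (m t : ℝ) :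
    ‖starCharFun R x (fun z => m * Real.log R - m * Real.log ‖z‖) t -
        2 / (2 - (m * t : ℝ) * I) * cexp ((-(m * t) * ((‖x‖ / R) ^ 2 / 2) : ℝ) * I)‖
      ≤ (6 * |m * t| * (‖x‖ / R) ^ 3 + 5 * (m * t) ^ 2 * (‖x‖ / R) ^ 2)
        * (√(1 + (m * t) ^ 2 / 4))⁻¹ := by
  have hx' : ‖x‖ < R := by linarith
  have hc := continuous_chord R x
  have hb := abs_angAvg_sq_mul_log_sub_le hx hR
  set a := ‖x‖ / R with ha
  have ha0 : 0 ≤ a := by positivity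
  have ha1 : a ≤ 1 / 2 := by rw [ha, div_le_iff₀ hR]; linarith
  set T := m * t with hT
  rw [starCharFun_timeDelay hx', ← mul_sub, norm_mul, norm_two_div, mul_comm]
  gcongr
  set k : ℝ → ℝ := fun θ => chord R x θ / R with hk
  have hkp : ∀ θ, 0 < k θ := fun θ => div_pos (chord_pos hx' θ) hR
  have hkc : Continuous k := by fun_prop
  set ℓ : ℝ → ℝ := fun θ => Real.log (k θ) with hℓ
  have hℓc : Continuous ℓ := hkc.log fun θ => (hkp θ).ne'
  have hk1 : ∀ θ, |k θ - 1| ≤ a := abs_chord_div_sub_one_le hx'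
  have hℓb : ∀ θ, |ℓ θ| ≤ 2 * a := by
    intro θ
    have := abs_log_one_add_le ((hk1 θ).trans ha1)
    rw [add_sub_cancel] at this
    linarith [hk1 θ]
  have hk2 : angAvg (fun θ => k θ ^ 2) = 1 := by
    have : ∀ θ, k θ ^ 2 = (R ^ 2)⁻¹ * chord R x θ ^ 2 := fun θ => by rw [hk]; field_simp
    simp only [this]
    rw [angAvg_const_mul, angAvg_chord_sq hx']
    field_simp
  set b := angAvg fun θ => k θ ^ 2 * ℓ θ with hbdef
  have main : ‖angAvg (fun θ => ((k θ ^ 2 : ℝ) : ℂ) * cexp ((-T * ℓ θ : ℝ) * I))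
      - (1 + (-T * b : ℝ) * I)‖ ≤ 9 / 2 * T ^ 2 * a ^ 2 := by
    have e : (1 + (-T * b : ℝ) * I) =
        angAvg (fun θ => ((k θ ^ 2 : ℝ) : ℂ) + (-T * I) * ((k θ ^ 2 * ℓ θ : ℝ) : ℂ)) := by
      rw [angAvg_add (by fun_prop) (by fun_prop), angAvg_const_mul_complex, angAvg_ofReal,
        angAvg_ofReal, hk2]
      push_cast; ring
    rw [e, ← angAvg_sub (by fun_prop) (by fun_prop)]
    refine norm_angAvg_le_const (by fun_prop) fun θ => ?_
    have e2 : ((k θ ^ 2 : ℝ) : ℂ) * cexp ((-T * ℓ θ : ℝ) * I) -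
        (((k θ ^ 2 : ℝ) : ℂ) + (-T * I) * ((k θ ^ 2 * ℓ θ : ℝ) : ℂ))
        = ((k θ ^ 2 : ℝ) : ℂ) * (cexp ((-T * ℓ θ : ℝ) * I) - 1 - (-T * ℓ θ : ℝ) * I) := by
      push_cast; ring
    rw [e2, norm_mul, norm_real, Real.norm_of_nonneg (sq_nonneg _)]
    have h1 := abs_le.1 (hk1 θ)
    have h2 : k θ ^ 2 ≤ 9 / 4 := by nlinarith [hkp θ]
    have h3 : (-T * ℓ θ) ^ 2 ≤ T ^ 2 * (2 * a) ^ 2 := by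
      rw [mul_pow, neg_sq, ← sq_abs (ℓ θ)]
      gcongr
      exact hℓb θ
    calc _ ≤ 9 / 4 * ((-T * ℓ θ) ^ 2 / 2) := by
          gcongr; exact norm_cexp_I_sub_one_sub_le _
      _ ≤ 9 / 4 * (T ^ 2 * (2 * a) ^ 2 / 2) := by gcongr
      _ = _ := by ring
  have h2 := norm_cexp_I_sub_one_sub_le (-T * (a ^ 2 / 2))
  have h3 : ‖((-T * b : ℝ) : ℂ) * I - (-T * (a ^ 2 / 2) : ℝ) * I‖ ≤ |T| * (6 * a ^ 3) := by
    rw [← sub_mul, norm_mul, norm_I, mul_one, ← ofReal_sub, norm_real, Real.norm_eq_abs, ← mul_sub,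
      abs_mul, abs_neg]
    gcongr
  have h4 : (-T * (a ^ 2 / 2)) ^ 2 / 2 ≤ T ^ 2 * a ^ 2 / 8 := by
    have : a ^ 4 ≤ a ^ 2 := pow_le_pow_of_le_one ha0 (by linarith) (by norm_num)
    nlinarith [sq_nonneg T]
  have e5 : ∀ A B : ℂ, A - B = (A - (1 + (-T * b : ℝ) * I)) - (B - 1 - (-T * (a ^ 2 / 2) : ℝ) * I)
      + (((-T * b : ℝ) : ℂ) * I - (-T * (a ^ 2 / 2) : ℝ) * I) := by intro A B; ring
  rw [e5]
  refine (norm_add_le _ _).trans ((add_le_add_left (norm_sub_le _ _) _).trans ?_)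
  nlinarith [sq_nonneg (T * a)]

end TimeDelay

/-! ### The shifted Gamma density and its Fourier transform. -/

section GammaDensity

variable {κc γ m : ℝ} {y x : Plane} {g : ℕ}

/-- Measured from the left end point d₁ + c, the integrand is that of a Laplace transform at 2/m -
it on the half line. -/
lemma cexp_mul_timeDelayApprox_shift (t u : ℝ) :
    cexp ((((u + (dOne κc γ y x + cShift m x)) * t : ℝ) : ℂ) * I) *
        timeDelayApprox κc γ m y x g (u + (dOne κc γ y x + cShift m x)) =
      (Set.Ioi (0 : ℝ)).indicator (fun u : ℝ =>
        (cexp (((dOne κc γ y x + cShift m x) * t : ℝ) * I) * (2 / m) ^ g / ((g - 1).factorial : ℂ)) *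
          ((u : ℂ) ^ (g - 1) * cexp (-((2 / m - t * I) * u)))) u := by
  set D := dOne κc γ y x + cShift m x with hD
  have e : u + D - dOne κc γ y x - cShift m x = u := by rw [hD]; ring
  rw [timeDelayApprox, ← hD, e]
  simp only [Set.indicator, Set.mem_Ioi, lt_add_iff_pos_left]
  split_ifs with h
  · have e1 : cexp (((u + D) * t : ℝ) * I) * cexp ((-(2 * u / m) : ℝ))
        = cexp ((D * t : ℝ) * I) * cexp (-((2 / m - t * I) * u)) := by
      rw [← Complex.exp_add, ← Complex.exp_add]
      congr 1; push_cast; ring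
    push_cast at e1 ⊢
    linear_combination ((2 / m : ℂ) ^ g * u ^ (g - 1) / ((g - 1).factorial : ℂ)) * e1
  · simp

/-- From g = 2 on the power g - 1 is positive and vanishes at the end point, so the two branches
match. -/
lemma continuous_timeDelayApprox (hg : 2 ≤ g) : Continuous (timeDelayApprox κc γ m y x g) := by
  have : timeDelayApprox κc γ m y x g = fun t => (2 / m) ^ g *
      (max (t - dOne κc γ y x - cShift m x) 0) ^ (g - 1) / ((g - 1).factorial : ℝ)
      * Real.exp (-(2 * (t - dOne κc γ y x - cShift m x) / m)) := by
    ext t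
    rw [timeDelayApprox]
    split_ifs with h
    · rw [max_eq_left (by linarith)]
    · rw [max_eq_right (by linarith), zero_pow (by omega)]; simp
  rw [this]
  fun_prop

lemma re_two_div_sub_pos (hm : 0 < m) (t : ℝ) : 0 < ((2 / m - t * I : ℂ)).re := by
  have : ((2 / m - t * I : ℂ)).re = 2 / m := by
    have : (2 / m : ℂ) = ((2 / m : ℝ) : ℂ) := by push_cast; rfl
    rw [this]; simp
  rw [this]; positivity

lemma integrable_timeDelayApprox (hm : 0 < m) :
    Integrable (timeDelayApprox κc γ m y x g) := by
  suffices h : Integrable fun u => timeDelayApprox κc γ m y x g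
      (u + (dOne κc γ y x + cShift m x)) by
    simpa using h.comp_sub_right (dOne κc γ y x + cShift m x)
  have h := (integrable_indicator_iff measurableSet_Ioi).2
    ((integrableOn_pow_mul_cexp_neg_mul (g - 1) (re_two_div_sub_pos hm 0)).const_mul
    (cexp (((dOne κc γ y x + cShift m x) * (0 : ℝ) : ℝ) * I) * (2 / m) ^ g / ((g - 1).factorial : ℂ)))
  rw [← integrable_congr (ae_of_all _ fun u => cexp_mul_timeDelayApprox_shift 0 u)] at h
  refine h.re.congr (ae_of_all _ fun u => ?_)
  simp

lemma integral_cexp_mul_timeDelayApprox (hm : 0 < m) (hg : 2 ≤ g) (t : ℝ) :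
    ∫ q : ℝ, cexp ((⟪q, t⟫ : ℝ) * I) * timeDelayApprox κc γ m y x g q =
      cexp (((dOne κc γ y x + cShift m x) * t : ℝ) * I) * (2 / (2 - (m * t : ℝ) * I)) ^ g := by
  simp only [real_inner_eq_mul]
  rw [← integral_add_right_eq_self _ (dOne κc γ y x + cShift m x)]
  simp only [cexp_mul_timeDelayApprox_shift]
  rw [integral_indicator measurableSet_Ioi, integral_const_mul,
    integral_pow_mul_cexp_neg_mul _ (re_two_div_sub_pos hm t), Nat.sub_add_cancel (by omega)]
  have hm' : (m : ℂ) ≠ 0 := by exact_mod_cast hm.ne'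
  have hz : (2 / m - t * I : ℂ) ≠ 0 := by
    intro h; have := re_two_div_sub_pos hm t; rw [h] at this; simp at this
  have hf : ((g - 1).factorial : ℂ) ≠ 0 := by exact_mod_cast (g - 1).factorial_ne_zero
  have e : (2 : ℂ) - (m * t : ℝ) * I = m * (2 / m - t * I) := by push_cast; field_simp
  rw [e]
  generalize (2 / m - t * I : ℂ) = z at hz
  rw [div_pow, div_pow, mul_pow]
  field_simp

end GammaDensity

/-! ### The density of the time delay. -/

section TimeDelayDensity

lemma exists_one_add_sq_le {c : ℝ} (hc : 0 < c) :
    ∃ K : ℝ, 0 < K ∧ ∀ v : ℝ, (1 + |v|) ^ 2 ≤ K * (1 + c * v ^ 2) := by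
  refine ⟨2 * (1 + c⁻¹), by positivity, fun v => ?_⟩
  have h1 : (1 + |v|) ^ 2 ≤ 2 * (1 + v ^ 2) := by
    nlinarith [sq_nonneg (1 - |v|), sq_abs v]
  have h2 : 2 * (1 + c⁻¹) * (1 + c * v ^ 2) = 2 * (1 + v ^ 2) + 2 * (c⁻¹ + c * v ^ 2) := by
    field_simp; ring
  rw [h2]
  have : 0 ≤ c⁻¹ + c * v ^ 2 := by positivity
  linarith

/-- Bernoulli of order 8; the square root halves it to order 4, enough to integrate against a
quadratic weight after u is replaced by a multiple of t². -/
lemma inv_sqrt_one_add_pow_le {u : ℝ} (hu : 0 ≤ u) {g : ℕ} (hg : 8 ≤ g) :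
    (√(1 + u))⁻¹ ^ g ≤ ((1 + g * u / 8) ^ 4)⁻¹ := by
  rw [inv_pow]
  gcongr
  have h := one_add_pow_le_one_add_pow hu (k := 8) (by norm_num) hg
  push_cast at h
  refine (sq_le_sq₀ (by positivity) (by positivity)).1 ?_
  rw [← pow_mul, ← pow_mul, mul_comm g 2, pow_mul (√(1 + u)), Real.sq_sqrt (by positivity)]
  exact h

lemma timeDelayStar_eq {κc γ m : ℝ} {g : ℕ} (ξ : Fin g → Plane) (y x : Plane) :
    timeDelayStar κc γ m ξ y x = dOne κc γ y x +
      ∑ j, (fun z : Plane => m * Real.log (discRadius g) - m * Real.log ‖z‖) (ξ j - x) := by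
  simp only [timeDelayStar, timeDelay, potential, dOne, Finset.sum_sub_distrib, Finset.sum_const,
    Finset.card_univ, Fintype.card_fin, nsmul_eq_mul, norm_sub_rev]
  ring

lemma norm_cexp_mul_two_div_pow (a T : ℝ) (g : ℕ) :
    ‖cexp ((a : ℝ) * I) * (2 / (2 - (T : ℝ) * I)) ^ g‖ = (√(1 + T ^ 2 / 4))⁻¹ ^ g := by
  rw [norm_mul, norm_exp_ofReal_mul_I, one_mul, norm_pow, norm_two_div]

lemma integrable_cexp_mul_two_div_pow {m : ℝ} (hm : 0 < m) (D : ℝ) {g : ℕ} (hg : 8 ≤ g) :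
    Integrable fun t : ℝ => cexp ((D * t : ℝ) * I) * (2 / (2 - (m * t : ℝ) * I)) ^ g := by
  obtain ⟨K, hK, hb⟩ := exists_one_add_sq_le (c := m ^ 2 / 4) (by positivity)
  have hi := (integrable_inv_one_add_norm_pow (volume : Measure ℝ) (n := 2)
    (by simp)).const_mul K
  have hne : ∀ t : ℝ, (2 : ℂ) - (m * t : ℝ) * I ≠ 0 := by
    intro t h; have := congrArg Complex.re h; simp at this
  refine hi.mono' (Continuous.aestronglyMeasurable ?_) (ae_of_all _ fun t => ?_)
  · exact (by fun_prop : Continuous fun t : ℝ => cexp ((D * t : ℝ) * I)).mul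
      ((continuous_const.div (by fun_prop) hne).pow g)
  · rw [norm_cexp_mul_two_div_pow]
    refine (inv_sqrt_one_add_pow_le (by positivity) hg).trans ?_
    rw [← div_eq_mul_inv, inv_eq_one_div, div_le_div_iff₀ (by positivity) (by positivity), one_mul,
      Real.norm_eq_abs]
    refine (hb t).trans ?_
    gcongr
    have h1 : (1 : ℝ) ≤ g / 8 := by
      rw [le_div_iff₀ (by norm_num)]; norm_num; exact_mod_cast hg
    have h2 : 1 + m ^ 2 / 4 * t ^ 2 ≤ 1 + g * ((m * t) ^ 2 / 4) / 8 := by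
      nlinarith [sq_nonneg (m * t)]
    refine h2.trans (le_self_pow₀ ?_ (by norm_num))
    have : 0 ≤ g * ((m * t) ^ 2 / 4) / 8 := by positivity
    linarith

/-- The natural scale is t = v/√g. There g times the one-star error is O(1/g), and dt = dv/√g
supplies the remaining g^(-1/2). -/
theorem hasAsymptoticPDF_timeDelayStar {m κc γ : ℝ} (hm : 0 < m) (y x : Plane)
    {Ω : ℕ → Type*} [∀ g, MeasurableSpace (Ω g)] (P : ∀ g, Measure (Ω g))
    [∀ g, IsProbabilityMeasure (P g)] (ξ : ∀ g, Fin g → Ω g → Plane)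
    (hmeas : ∀ g j, Measurable (ξ g j)) (hindep : ∀ g, iIndepFun (ξ g) (P g))
    (hunif : ∀ g j,
      pdf.IsUniform (ξ g j) (Metric.closedBall 0 (discRadius g)) (P g) volume) :
    HasAsymptoticPDF P (fun g ω => timeDelayStar κc γ m (fun j => ξ g j ω) y x)
      (timeDelayApprox κc γ m y x) (fun g => (g : ℝ) ^ (-(3 / 2) : ℝ)) := by
  set A := ‖x‖ * √Real.pi with hA
  have hA0 : 0 ≤ A := by positivity
  obtain ⟨K, hK, hKb⟩ := exists_one_add_sq_le (c := m ^ 2 / 32) (by positivity)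
  -- The majorant in the rescaled variable v = √g t, independent of g; note that |x|/R = A/√g.
  set H : ℝ → ℝ := fun v => (6 * m * A ^ 3 * |v| + 5 * m ^ 2 * A ^ 2 * v ^ 2)
    * ((1 + m ^ 2 / 32 * v ^ 2) ^ 4)⁻¹ with hH
  have hHc : Continuous H :=
    Continuous.mul (by fun_prop) (Continuous.inv₀ (by fun_prop) fun v => by positivity)
  have hHi : Integrable H := by
    have hi := (integrable_inv_one_add_norm_pow (volume : Measure ℝ) (n := 2)
      (by simp)).const_mul ((6 * m * A ^ 3 + 5 * m ^ 2 * A ^ 2) * K ^ 2)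
    refine hi.mono' hHc.aestronglyMeasurable (ae_of_all _ fun v => ?_)
    rw [Real.norm_of_nonneg (by positivity), Real.norm_eq_abs]
    simp only [hH]
    have hw : 1 ≤ 1 + m ^ 2 / 32 * v ^ 2 := by
      have : 0 ≤ m ^ 2 / 32 * v ^ 2 := by positivity
      linarith
    set w := 1 + m ^ 2 / 32 * v ^ 2
    have hv := hKb v
    have hv0 := abs_nonneg v
    rw [← div_eq_mul_inv, ← div_eq_mul_inv, div_le_div_iff₀ (by positivity) (by positivity)]
    have h1 : 6 * m * A ^ 3 * |v| + 5 * m ^ 2 * A ^ 2 * v ^ 2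
        ≤ (6 * m * A ^ 3 + 5 * m ^ 2 * A ^ 2) * (1 + |v|) ^ 2 := by
      rw [← sq_abs v, add_mul]
      gcongr <;> nlinarith
    calc _ ≤ (6 * m * A ^ 3 + 5 * m ^ 2 * A ^ 2) * (1 + |v|) ^ 2 * (1 + |v|) ^ 2 := by gcongr
      _ ≤ (6 * m * A ^ 3 + 5 * m ^ 2 * A ^ 2) * (K * w) * (K * w) := by gcongr
      _ = (6 * m * A ^ 3 + 5 * m ^ 2 * A ^ 2) * K ^ 2 * w ^ 2 := by ring
      _ ≤ _ := by gcongr; norm_num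
  refine ⟨((2 * Real.pi) ^ Module.finrank ℝ ℝ)⁻¹ * ∫ v, H v, ?_⟩
  filter_upwards [eventually_ge_atTop 8, tendsto_discRadius.eventually_gt_atTop (2 * ‖x‖)]
    with g hg hR
  have hg0 : (0 : ℝ) < g := by have : 0 < g := by omega
                               exact_mod_cast this
  have hR0 : 0 < discRadius g := by linarith [norm_nonneg x]
  have hx2 : ‖x‖ ≤ discRadius g / 2 := by linarith
  have hx1 : ‖x‖ < discRadius g := by linarith
  set F : Plane → ℝ := fun z => m * Real.log (discRadius g) - m * Real.log ‖z‖ with hF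
  have hFm : Measurable F := by
    have := Real.measurable_log.comp (measurable_norm (α := Plane))
    exact (this.const_mul m).const_sub _
  set X : Ω g → ℝ := fun ω => timeDelayStar κc γ m (fun j => ξ g j ω) y x with hX
  have hXe : X = fun ω => dOne κc γ y x + ∑ j, F (ξ g j ω - x) := by
    ext ω; exact timeDelayStar_eq _ _ _
  have hXm : Measurable X := by
    rw [hXe]
    exact (Finset.measurable_sum _ fun j _ => hFm.comp ((hmeas g j).sub_const x)).const_add _
  set Q : ℝ → ℂ := fun t => cexp (((dOne κc γ y x + cShift m x) * t : ℝ) * I)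
    * (2 / (2 - (m * t : ℝ) * I)) ^ g with hQ
  have hQi : Integrable Q := integrable_cexp_mul_two_div_pow hm _ hg
  have hp : ∀ q, (timeDelayApprox κc γ m y x g q : ℂ) = invCharFun Q q :=
    eq_invCharFun_of_continuous (continuous_timeDelayApprox (by omega))
      (integrable_timeDelayApprox hm) hQi (integral_cexp_mul_timeDelayApprox hm (by omega))
  have hsqrt : √(g : ℝ) ^ 2 = g := Real.sq_sqrt hg0.le
  have hsp : 0 < √(g : ℝ) := Real.sqrt_pos.2 hg0
  have ha : ‖x‖ / discRadius g = A / √(g : ℝ) := by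
    rw [discRadius, Real.sqrt_div hg0.le, hA]; field_simp
  have ha2 : (‖x‖ / discRadius g) ^ 2 = ‖x‖ ^ 2 * Real.pi / g := by
    rw [div_pow, discRadius_sq]; field_simp
  have hbound : ∀ t : ℝ, ‖charFun ((P g).map X) t - Q t‖ ≤ (g : ℝ)⁻¹ * H (√(g : ℝ) * t) := by
    intro t
    rw [hXe, charFun_map_sum_uniform hx1 hFm (hmeas g) (hindep g) (hunif g)]
    set φ := starCharFun (discRadius g) x F t
    set ψ := 2 / (2 - (m * t : ℝ) * I) * cexp ((-(m * t) * ((‖x‖ / discRadius g) ^ 2 / 2) : ℝ) * I)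
      with hψ
    -- Here g(|x|/R)² = π|x|², so the g-th power of the phase in ψ is exactly the shift c.
    have hQe : Q t = cexp ((⟪dOne κc γ y x, t⟫ : ℝ) * I) * ψ ^ g := by
      rw [hQ, hψ, mul_pow, ← Complex.exp_nat_mul, mul_left_comm, ← Complex.exp_add, mul_comm,
        real_inner_eq_mul, ha2, cShift, kappaStar]
      have : (g : ℂ) ≠ 0 := by exact_mod_cast hg0.ne'
      push_cast
      field_simp
    rw [hQe, ← mul_sub, norm_mul, norm_exp_ofReal_mul_I, one_mul]
    have hφ1 : ‖φ‖ ≤ (√(1 + (m * t) ^ 2 / 4))⁻¹ := norm_starCharFun_timeDelay_le hx1 m t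
    have hψ1 : ‖ψ‖ ≤ (√(1 + (m * t) ^ 2 / 4))⁻¹ := by
      rw [hψ, norm_mul, norm_two_div, norm_exp_ofReal_mul_I, mul_one]
    have hd : ‖φ - ψ‖ ≤ (6 * |m * t| * (‖x‖ / discRadius g) ^ 3
        + 5 * (m * t) ^ 2 * (‖x‖ / discRadius g) ^ 2) * (√(1 + (m * t) ^ 2 / 4))⁻¹ :=
      norm_starCharFun_timeDelay_sub_le hx2 hR0 m t
    set M := (√(1 + (m * t) ^ 2 / 4))⁻¹ with hM
    have hM0 : 0 ≤ M := by positivity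
    have hMg : M ^ g ≤ ((1 + m ^ 2 / 32 * (√(g : ℝ) * t) ^ 2) ^ 4)⁻¹ := by
      refine (inv_sqrt_one_add_pow_le (by positivity) hg).trans (le_of_eq ?_)
      rw [mul_pow (√(g : ℝ)), hsqrt]; ring
    calc ‖φ ^ g - ψ ^ g‖ ≤ g * ‖φ - ψ‖ * M ^ (g - 1) := norm_pow_sub_pow_le_mul hφ1 hψ1 g
      _ ≤ g * ((6 * |m * t| * (‖x‖ / discRadius g) ^ 3
          + 5 * (m * t) ^ 2 * (‖x‖ / discRadius g) ^ 2) * M) * M ^ (g - 1) := by gcongr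
      _ = g * (6 * |m * t| * (‖x‖ / discRadius g) ^ 3
          + 5 * (m * t) ^ 2 * (‖x‖ / discRadius g) ^ 2) * M ^ g := by
        have : M ^ g = M ^ (g - 1) * M := by rw [← pow_succ, Nat.sub_add_cancel (by omega)]
        rw [this]
        ring
      _ ≤ g * (6 * |m * t| * (‖x‖ / discRadius g) ^ 3
          + 5 * (m * t) ^ 2 * (‖x‖ / discRadius g) ^ 2) *
          ((1 + m ^ 2 / 32 * (√(g : ℝ) * t) ^ 2) ^ 4)⁻¹ := by gcongr
      _ = _ := by
        simp only [hH]
        rw [ha, abs_mul, abs_mul, abs_of_pos hm, abs_of_pos hsp, ← mul_assoc (g : ℝ)⁻¹]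
        congr 1
        have : (g : ℝ) = √(g : ℝ) ^ 2 := hsqrt.symm
        generalize √(g : ℝ) = r at *
        rw [this]
        field_simp
  have hHs : Integrable fun t : ℝ => (g : ℝ)⁻¹ * H (√(g : ℝ) * t) :=
    (hHi.comp_mul_left' hsp.ne').const_mul _
  have : IsProbabilityMeasure ((P g).map X) := Measure.isProbabilityMeasure_map hXm.aemeasurable
  have hDi : Integrable fun t => charFun ((P g).map X) t - Q t :=
    hHs.mono' (measurable_charFun.aestronglyMeasurable.sub hQi.aestronglyMeasurable)
      (ae_of_all _ hbound)
  obtain ⟨h1, h2⟩ := hasPDF_and_abs_sub_le (P g) hXm hQi hp hDi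
  refine ⟨h1, ?_⟩
  filter_upwards [h2] with q hq
  refine hq.trans ?_
  rw [mul_assoc]
  gcongr
  calc ∫ t, ‖charFun ((P g).map X) t - Q t‖ ≤ ∫ t, (g : ℝ)⁻¹ * H (√(g : ℝ) * t) :=
        integral_mono hDi.norm hHs hbound
    _ = (∫ v, H v) * (g : ℝ) ^ (-(3 / 2) : ℝ) := by
      rw [integral_const_mul, Measure.integral_comp_mul_left, smul_eq_mul, abs_inv, abs_of_pos hsp,
        show (-(3 / 2) : ℝ) = -1 + -(1 / 2) by norm_num, Real.rpow_add hg0, Real.rpow_neg_one,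
        Real.rpow_neg hg0.le (1 / 2), ← Real.sqrt_eq_rpow]
      ring

end TimeDelayDensity

/-! ### Pareto characteristic functions and their decay. -/

section Pareto

/-- The density of the Pareto distribution with index `p` on `(1, ∞)`. -/
def paretoDensity (p : ℕ) (s : ℝ) : ℝ := p * (s ^ (p + 1))⁻¹

/-- The characteristic function of the Pareto distribution with index `p`. -/
def paretoCharFun (p : ℕ) (A : ℝ) : ℂ :=
  ∫ s in Set.Ioi (1 : ℝ), (paretoDensity p s : ℂ) * cexp ((A * s : ℝ) * I)

variable {p : ℕ}

lemma paretoDensity_nonneg (p : ℕ) {s : ℝ} (hs : 1 < s) : 0 ≤ paretoDensity p s := by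
  rw [paretoDensity]; positivity

lemma paretoDensity_eq_rpow {s : ℝ} (hs : 1 < s) :
    paretoDensity p s = p * s ^ (-(p + 1) : ℝ) := by
  rw [paretoDensity, Real.rpow_neg (by linarith)]
  norm_cast

lemma integrableOn_paretoDensity (hp : 1 ≤ p) : IntegrableOn (paretoDensity p) (Set.Ioi 1) := by
  have hp' : (1 : ℝ) ≤ p := by exact_mod_cast hp
  have h : IntegrableOn (fun s : ℝ => p * s ^ (-(p + 1 : ℝ))) (Set.Ioi 1) :=
    (integrableOn_Ioi_rpow_of_lt (by linarith) one_pos).const_mul (p : ℝ)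
  exact h.congr_fun (fun s hs => (paretoDensity_eq_rpow hs).symm) measurableSet_Ioi

lemma integral_paretoDensity (hp : 1 ≤ p) : ∫ s in Set.Ioi (1 : ℝ), paretoDensity p s = 1 := by
  have hp' : (1 : ℝ) ≤ p := by exact_mod_cast hp
  rw [setIntegral_congr_fun measurableSet_Ioi (fun s hs => paretoDensity_eq_rpow hs),
    integral_const_mul, integral_Ioi_rpow_of_lt (by linarith) one_pos, Real.one_rpow]
  have : -(p + 1 : ℝ) + 1 = -p := by ring
  rw [this]; field_simp

lemma measurable_paretoDensity (p : ℕ) : Measurable (paretoDensity p) := by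
  unfold paretoDensity; fun_prop

lemma norm_paretoDensity_mul (A : ℝ) {s : ℝ} (hs : 1 < s) :
    ‖(paretoDensity p s : ℂ) * cexp ((A * s : ℝ) * I)‖ = paretoDensity p s := by
  rw [norm_mul, norm_exp_ofReal_mul_I, mul_one, norm_real,
    Real.norm_of_nonneg (paretoDensity_nonneg p hs)]

lemma integrableOn_paretoDensity_mul (hp : 1 ≤ p) (A : ℝ) :
    IntegrableOn (fun s => (paretoDensity p s : ℂ) * cexp ((A * s : ℝ) * I)) (Set.Ioi 1) := by
  refine (integrableOn_paretoDensity hp).mono' ?_ ?_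
  · exact ((measurable_ofReal.comp (measurable_paretoDensity p)).mul (by fun_prop)).aestronglyMeasurable
  · filter_upwards [ae_restrict_mem measurableSet_Ioi] with s hs
    exact (norm_paretoDensity_mul A hs).le

lemma norm_paretoCharFun_le_one (hp : 1 ≤ p) (A : ℝ) : ‖paretoCharFun p A‖ ≤ 1 := by
  refine (norm_integral_le_integral_norm _).trans (le_of_eq ?_)
  rw [setIntegral_congr_fun measurableSet_Ioi fun s (hs : 1 < s) => norm_paretoDensity_mul A hs,
    integral_paretoDensity hp]

lemma continuous_paretoCharFun (hp : 1 ≤ p) : Continuous (paretoCharFun p) := by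
  refine continuous_of_dominated (bound := paretoDensity p) ?_ ?_ (integrableOn_paretoDensity hp) ?_
  · exact fun A => (integrableOn_paretoDensity_mul hp A).aestronglyMeasurable
  · intro A
    filter_upwards [ae_restrict_mem measurableSet_Ioi] with s hs
    exact (norm_paretoDensity_mul A hs).le
  · filter_upwards with s
    fun_prop

/-- Integration by parts. -/
lemma mul_paretoCharFun (hp : 1 ≤ p) (A : ℝ) :
    A * I * paretoCharFun p A = p * (paretoCharFun (p + 1) A - cexp (A * I)) := by
  have i1 := (integrableOn_paretoDensity_mul hp A).const_mul (A * I)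
  have i2 := (integrableOn_paretoDensity_mul (p := p + 1) (by omega) A).const_mul (p : ℂ)
  have hd : ∀ s ∈ Set.Ici (1 : ℝ), HasDerivAt
      (fun s : ℝ => (paretoDensity p s : ℂ) * cexp ((A * s : ℝ) * I))
      (A * I * ((paretoDensity p s : ℂ) * cexp ((A * s : ℝ) * I)) -
        p * ((paretoDensity (p + 1) s : ℂ) * cexp ((A * s : ℝ) * I))) s := by
    intro s hs
    have hs0 : s ≠ 0 := by have : (1 : ℝ) ≤ s := hs; positivity
    have h1 : HasDerivAt (paretoDensity p) (-(p * paretoDensity (p + 1) s)) s := by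
      refine (((hasDerivAt_pow (p + 1) s).inv (pow_ne_zero _ hs0)).const_mul (p : ℝ)).congr_deriv ?_
      rw [paretoDensity]; push_cast; field_simp; ring
    have h2 : HasDerivAt (fun s : ℝ => ((A * s : ℝ) : ℂ) * I) (A * I) s := by
      have := (((hasDerivAt_id s).const_mul A).ofReal_comp).mul_const I
      simpa using this
    refine (h1.ofReal_comp.mul h2.cexp).congr_deriv ?_
    push_cast; ring
  have hlim : Tendsto (fun s : ℝ => (paretoDensity p s : ℂ) * cexp ((A * s : ℝ) * I)) atTop (𝓝 0) := by
    rw [tendsto_zero_iff_norm_tendsto_zero]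
    have h0 : Tendsto (paretoDensity p) atTop (𝓝 0) := by
      have := (tendsto_inv_atTop_zero.comp (tendsto_pow_atTop (α := ℝ) (n := p + 1) (by omega))).const_mul
        (p : ℝ)
      rw [mul_zero] at this
      exact this
    refine h0.congr' ?_
    filter_upwards [eventually_gt_atTop 1] with s hs
    exact (norm_paretoDensity_mul A hs).symm
  have := integral_Ioi_of_hasDerivAt_of_tendsto' hd (i1.sub i2) hlim
  rw [integral_sub i1 i2, integral_const_mul, integral_const_mul] at this
  rw [paretoCharFun, paretoCharFun, mul_sub, ← sub_eq_iff_eq_add'.2 (sub_eq_iff_eq_add.1 this)]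
  simp [paretoDensity]

lemma abs_mul_norm_paretoCharFun_le (hp : 1 ≤ p) (A : ℝ) : |A| * ‖paretoCharFun p A‖ ≤ 2 * p := by
  have h := congrArg norm (mul_paretoCharFun hp A)
  rw [norm_mul, norm_mul, norm_I, mul_one, norm_real, Real.norm_eq_abs, norm_mul, norm_natCast] at h
  rw [h]
  have h2 := norm_sub_le (paretoCharFun (p + 1) A) (cexp (A * I))
  rw [norm_exp_ofReal_mul_I] at h2
  have h3 := norm_paretoCharFun_le_one (p := p + 1) (by omega) A
  nlinarith [(Nat.cast_nonneg p : (0 : ℝ) ≤ p)]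

/-- Over length 1/|A| the phase advances by one radian, and the chord of a unit arc is 2 sin(1/2) <
1: a fixed proportion of the mass cancels. -/
lemma norm_intervalIntegral_cexp_le {A : ℝ} (hA : A ≠ 0) :
    ‖∫ s in (1 : ℝ)..(1 + |A|⁻¹), cexp ((A * s : ℝ) * I)‖ ≤ 2 * Real.sin (1 / 2) * |A|⁻¹ := by
  have hA' : (A * I : ℂ) ≠ 0 := mul_ne_zero (by exact_mod_cast hA) I_ne_zero
  have e : ∀ s : ℝ, ((A * s : ℝ) : ℂ) * I = (A * I) * s := fun s => by push_cast; ring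
  simp only [e]
  rw [integral_exp_mul_complex hA', norm_div, norm_mul, norm_I, mul_one, norm_real,
    Real.norm_eq_abs, div_eq_mul_inv]
  gcongr
  have e2 : cexp (A * I * ((1 + |A|⁻¹ : ℝ) : ℂ)) - cexp (A * I * ((1 : ℝ) : ℂ))
      = cexp (A * I) * (cexp (I * (A * |A|⁻¹ : ℝ)) - 1) := by
    rw [mul_sub, ← Complex.exp_add]; push_cast; ring_nf
  rw [e2, norm_mul, norm_exp_ofReal_mul_I, one_mul, norm_exp_I_mul_ofReal_sub_one, norm_mul,
    Real.norm_eq_abs, Real.norm_eq_abs, abs_two]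
  have hs : 0 ≤ Real.sin (1 / 2) :=
    Real.sin_nonneg_of_nonneg_of_le_pi (by norm_num) (by linarith [Real.pi_gt_three])
  rcases lt_or_gt_of_ne hA with h | h
  · rw [abs_of_neg h, show A * (-A)⁻¹ / 2 = -(1 / 2) by field_simp, Real.sin_neg, abs_neg,
      abs_of_nonneg hs]
  · rw [abs_of_pos h, show A * A⁻¹ / 2 = 1 / 2 by field_simp, abs_of_nonneg hs]

/-- The density decreases, so a uniform piece of height w = f(1 + 1/|A|) on (1, 1 + 1/|A|] can be
split off. Oscillation reduces the contribution of this piece by 2 sin(1/2); the rest is bounded by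
its mass. -/
lemma norm_paretoCharFun_le (hp : 1 ≤ p) (A : ℝ) :
    ‖paretoCharFun p A‖ ≤ 1 - (1 - 2 * Real.sin (1 / 2)) * p * |A| ^ p / (1 + |A|) ^ (p + 1) := by
  rcases eq_or_ne A 0 with rfl | hA
  · rw [abs_zero, zero_pow (by omega)]
    simpa using norm_paretoCharFun_le_one hp 0
  have hA0 : 0 < |A| := abs_pos.2 hA
  set h := |A|⁻¹ with hh
  have hh0 : 0 < h := by positivity
  set w := paretoDensity p (1 + h) with hw
  have hw0 : 0 ≤ w := paretoDensity_nonneg p (by linarith)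
  set S := Set.Ioc (1 : ℝ) (1 + h) with hS
  have hSsub : S ⊆ Set.Ioi 1 := fun s hs => hs.1
  set v : ℝ → ℝ := fun s => paretoDensity p s - S.indicator (fun _ => w) s with hv
  have iI : IntegrableOn (S.indicator fun _ => w) (Set.Ioi (1 : ℝ)) :=
    ((integrable_indicator_iff measurableSet_Ioc).2
      (integrableOn_const measure_Ioc_lt_top.ne)).integrableOn
  have hi := (integrableOn_paretoDensity hp).sub iI
  have hvn : ∀ s, 1 < s → 0 ≤ v s := by
    intro s hs
    simp only [hv, Set.indicator]
    split_ifs with h1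
    · rw [sub_nonneg, hw, paretoDensity, paretoDensity]
      have := h1.2
      gcongr
    · simpa using paretoDensity_nonneg p hs
  have hvi : ∫ s in Set.Ioi (1 : ℝ), v s = 1 - w * h := by
    simp only [hv]
    rw [integral_sub (integrableOn_paretoDensity hp) iI, integral_paretoDensity hp,
      setIntegral_indicator measurableSet_Ioc, Set.inter_eq_right.2 hSsub, setIntegral_const]
    simp [hS, hh0.le, mul_comm]
  have iV : IntegrableOn (fun s => (v s : ℂ) * cexp ((A * s : ℝ) * I)) (Set.Ioi 1) := by
    refine hi.mono' ?_ ?_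
    · exact (hi.aestronglyMeasurable.aemeasurable.complex_ofReal.mul (by fun_prop)).aestronglyMeasurable
    · filter_upwards [ae_restrict_mem measurableSet_Ioi] with s hs
      rw [norm_mul, norm_exp_ofReal_mul_I, mul_one, norm_real, Real.norm_of_nonneg (hvn s hs)]
      rfl
  have iW : IntegrableOn (S.indicator fun s : ℝ => w * cexp ((A * s : ℝ) * I)) (Set.Ioi 1) := by
    refine ((integrable_indicator_iff measurableSet_Ioc).2 ?_).integrableOn
    exact (Continuous.integrableOn_Icc (by fun_prop)).mono_set Set.Ioc_subset_Icc_self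
  have e : paretoCharFun p A = (∫ s in Set.Ioi (1 : ℝ), (v s : ℂ) * cexp ((A * s : ℝ) * I)) +
      w * ∫ s in (1 : ℝ)..(1 + h), cexp ((A * s : ℝ) * I) := by
    have : ∫ s in Set.Ioi (1 : ℝ), S.indicator (fun s : ℝ => w * cexp ((A * s : ℝ) * I)) s
        = w * ∫ s in (1 : ℝ)..(1 + h), cexp ((A * s : ℝ) * I) := by
      rw [setIntegral_indicator measurableSet_Ioc, Set.inter_eq_right.2 hSsub, integral_const_mul,
        intervalIntegral.integral_of_le (by linarith)]
    rw [← this, ← integral_add iV iW, paretoCharFun]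
    congr 1 with s
    simp only [hv, Set.indicator]
    split_ifs <;> push_cast <;> ring
  have b1 : ‖∫ s in Set.Ioi (1 : ℝ), (v s : ℂ) * cexp ((A * s : ℝ) * I)‖ ≤ 1 - w * h := by
    rw [← hvi]
    refine (norm_integral_le_integral_norm _).trans (le_of_eq ?_)
    refine setIntegral_congr_fun measurableSet_Ioi fun s hs => ?_
    rw [norm_mul, norm_exp_ofReal_mul_I, mul_one, norm_real, Real.norm_of_nonneg (hvn s hs)]
  have b2 : ‖(w : ℂ) * ∫ s in (1 : ℝ)..(1 + h), cexp ((A * s : ℝ) * I)‖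
      ≤ w * (2 * Real.sin (1 / 2) * h) := by
    rw [norm_mul, norm_real, Real.norm_of_nonneg hw0]
    gcongr
    exact norm_intervalIntegral_cexp_le hA
  have e3 : w * h = p * |A| ^ p / (1 + |A|) ^ (p + 1) := by
    have h1 : 1 + h = (1 + |A|) / |A| := by rw [hh]; field_simp; ring
    rw [hw, paretoDensity, h1, hh, div_pow, inv_div, pow_succ |A|]
    field_simp
  have e4 : (1 - 2 * Real.sin (1 / 2)) * p * |A| ^ p / (1 + |A|) ^ (p + 1)
      = (1 - 2 * Real.sin (1 / 2)) * (w * h) := by rw [e3]; ring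
  rw [e, e4]
  refine (norm_add_le _ _).trans ?_
  linarith

lemma exists_norm_paretoCharFun_sq_le (hp : 1 ≤ p) (hp2 : p ≤ 2) :
    ∃ c : ℝ, 0 < c ∧ ∀ A, ‖paretoCharFun p A‖ ^ 2 ≤ (1 + c * |A| ^ p)⁻¹ := by
  have hs : 0 < 1 - 2 * Real.sin (1 / 2) := by
    have := Real.sin_lt (x := 1 / 2) (by norm_num); linarith
  have hp' : (1 : ℝ) ≤ p := by exact_mod_cast hp
  set c₁ := (1 - 2 * Real.sin (1 / 2)) * p / (1 + 4 * p) ^ (p + 1) with hc₁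
  have hc₁0 : 0 < c₁ := by positivity
  refine ⟨min c₁ (1 / (8 * p ^ 2)), lt_min hc₁0 (by positivity), fun A => ?_⟩
  set c := min c₁ (1 / (8 * (p : ℝ) ^ 2)) with hc
  have hc0 : 0 < c := lt_min hc₁0 (by positivity)
  have hy : 0 ≤ |A| ^ p := by positivity
  have hn := norm_nonneg (paretoCharFun p A)
  rw [← one_div, le_div_iff₀ (by positivity)]
  -- For |A| ≤ 4p the uniform-piece bound is used, with its denominator frozen at |A| = 4p, followed
  -- by (1 - y)(1 + y) ≤ 1. Beyond, integration by parts gives |A| ‖E‖ ≤ 2p, and p ≤ 2 allows |A|^p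
  -- ≤ |A|².
  rcases le_total |A| (4 * p) with h | h
  · have h1 : ‖paretoCharFun p A‖ ≤ 1 - c * |A| ^ p := by
      refine (norm_paretoCharFun_le hp A).trans ?_
      have : c₁ * |A| ^ p ≤ (1 - 2 * Real.sin (1 / 2)) * p * |A| ^ p / (1 + |A|) ^ (p + 1) := by
        rw [hc₁, div_mul_eq_mul_div]
        gcongr
      have h2 : c * |A| ^ p ≤ c₁ * |A| ^ p := by gcongr; exact min_le_left _ _
      linarith
    have h2 : ‖paretoCharFun p A‖ ^ 2 ≤ 1 - c * |A| ^ p := by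
      have := norm_paretoCharFun_le_one hp A
      nlinarith
    nlinarith [mul_nonneg hc0.le hy]
  · have h1 := abs_mul_norm_paretoCharFun_le hp A
    have hA1 : 1 ≤ |A| := by linarith
    have h2 : |A| ^ p ≤ |A| ^ 2 := pow_le_pow_right₀ hA1 hp2
    have h3 : (|A| * ‖paretoCharFun p A‖) ^ 2 ≤ (2 * p) ^ 2 := by gcongr
    have h4 : c * |A| ^ p ≤ 1 / (8 * (p : ℝ) ^ 2) * |A| ^ 2 := by
      gcongr; exact min_le_right _ _
    have h5 : (2 * (p : ℝ)) ^ 2 * (1 + 1 / (8 * (p : ℝ) ^ 2) * |A| ^ 2) ≤ |A| ^ 2 := by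
      have : (2 * (p : ℝ)) ^ 2 * (1 + 1 / (8 * (p : ℝ) ^ 2) * |A| ^ 2)
          = 4 * p ^ 2 + |A| ^ 2 / 2 := by field_simp; ring
      rw [this]; nlinarith
    have hA2 : 0 < |A| ^ 2 := by positivity
    have : |A| ^ 2 * (‖paretoCharFun p A‖ ^ 2 * (1 + c * |A| ^ p)) ≤ |A| ^ 2 * 1 := by
      calc _ = (|A| * ‖paretoCharFun p A‖) ^ 2 * (1 + c * |A| ^ p) := by ring
        _ ≤ (2 * (p : ℝ)) ^ 2 * (1 + 1 / (8 * (p : ℝ) ^ 2) * |A| ^ 2) := by gcongr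
        _ ≤ _ := by linarith
    exact le_of_mul_le_mul_left this hA2

end Pareto

/-! ### From radial integrals to Pareto laws. -/

section Substitution

/-- If r has density 2r/ρ² on (0, ρ), then (ρ/r)^k has the Pareto law of index 2/k = p. The change
of variables is r = ρ s^(-p/2), as 1/k = p/2. -/
lemma two_mul_integral_eq_paretoCharFun {k p : ℕ} (hkp : k * p = 2) {ρ : ℝ} (hρ : 0 < ρ) (B : ℝ) :
    2 * ∫ r in (0 : ℝ)..ρ, (r : ℂ) * cexp ((B / r ^ k : ℝ) * I)
      = (ρ : ℂ) ^ 2 * paretoCharFun p (B / ρ ^ k) := by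
  have hp : 1 ≤ p := by rcases p with _ | p <;> omega
  have hp0 : (0 : ℝ) < p := by exact_mod_cast hp
  have hkp' : (k : ℝ) * p = 2 := by exact_mod_cast hkp
  set f : ℝ → ℝ := fun s => ρ * s ^ (-(p / 2) : ℝ) with hf
  have hd : ∀ s ∈ Set.Ioi (1 : ℝ), HasDerivWithinAt f (ρ * (-(p / 2) * s ^ (-(p / 2) - 1 : ℝ)))
      (Set.Ioi 1) s := by
    intro s hs
    have hs1 : (1 : ℝ) < s := hs
    exact ((Real.hasDerivAt_rpow_const (Or.inl (by linarith))).const_mul ρ).hasDerivWithinAt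
  have hinj : Set.InjOn f (Set.Ioi 1) := by
    intro a ha b hb hab
    have ha1 : (1 : ℝ) < a := ha
    have hb1 : (1 : ℝ) < b := hb
    exact Real.rpow_left_injOn (x := -(p / 2 : ℝ)) (by linarith : -(p / 2 : ℝ) ≠ 0)
      (by simp; linarith) (by simp; linarith)
      (mul_left_cancel₀ hρ.ne' hab)
  have himg : f '' Set.Ioi 1 = Set.Ioo 0 ρ := by
    ext r
    constructor
    · rintro ⟨s, hs, rfl⟩
      have hs1 : (1 : ℝ) < s := hs
      have h0 : 0 < s ^ (-(p / 2) : ℝ) := by positivity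
      have h1 : s ^ (-(p / 2) : ℝ) < 1 := Real.rpow_lt_one_of_one_lt_of_neg hs1 (by linarith)
      exact ⟨by positivity, by nlinarith⟩
    · rintro ⟨h0, h1⟩
      refine ⟨(r / ρ) ^ (-(2 / p) : ℝ), ?_, ?_⟩
      · refine Real.one_lt_rpow_of_pos_of_lt_one_of_neg (by positivity) ((div_lt_one hρ).2 h1) ?_
        have : 0 < 2 / (p : ℝ) := by positivity
        linarith
      · simp only [hf]
        rw [← Real.rpow_mul (by positivity), show -(2 / (p : ℝ)) * -(p / 2) = 1 by field_simp,
          Real.rpow_one]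
        field_simp
  rw [intervalIntegral.integral_of_le hρ.le, integral_Ioc_eq_integral_Ioo, ← himg,
    integral_image_eq_integral_abs_deriv_smul measurableSet_Ioi hd hinj, paretoCharFun,
    ← integral_const_mul, ← integral_const_mul]
  refine setIntegral_congr_fun measurableSet_Ioi fun s hs => ?_
  have hs1 : (1 : ℝ) < s := hs
  have hs0 : 0 < s := by linarith
  have e1 : B / f s ^ k = B / ρ ^ k * s := by
    simp only [hf]
    rw [mul_pow, ← Real.rpow_mul_natCast hs0.le, show -(p / 2 : ℝ) * k = -1 by linarith,
      Real.rpow_neg_one]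
    field_simp
  have e2 : |ρ * (-(p / 2) * s ^ (-(p / 2) - 1 : ℝ))| * (2 * f s) = ρ ^ 2 * paretoDensity p s := by
    have h0 : 0 < s ^ (-(p / 2) - 1 : ℝ) := by positivity
    rw [abs_mul, abs_mul, abs_neg, abs_of_pos hρ, abs_of_pos h0, abs_of_pos (by positivity),
      paretoDensity_eq_rpow hs1]
    simp only [hf]
    have : s ^ (-(p + 1) : ℝ) = s ^ (-(p / 2) - 1 : ℝ) * s ^ (-(p / 2) : ℝ) := by
      rw [← Real.rpow_add hs0]; congr 1; ring
    rw [this]; ring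
  simp only [e1, real_smul]
  have e3 : ((|ρ * (-(p / 2) * s ^ (-(p / 2) - 1 : ℝ))| : ℝ) : ℂ) * (2 * (f s : ℂ))
      = (ρ : ℂ) ^ 2 * paretoDensity p s := by exact_mod_cast e2
  linear_combination cexp ((B / ρ ^ k * s : ℝ) * I) * e3

end Substitution

/-! ### Expansion of the Pareto characteristic function of index 1. -/

section ParetoOne

lemma one_sub_cos_mul_exp_eq_re (w u : ℝ) :
    (1 - Real.cos u) * Real.exp (-(w * u))
      = (((u : ℂ) ^ 0 * cexp (-((w : ℂ) * u)) - (u : ℂ) ^ 0 * cexp (-((w - I) * u)))).re := by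
  have e1 : cexp (-((w : ℂ) * u)) = (Real.exp (-(w * u)) : ℝ) := by push_cast; rfl
  have e2 : cexp (-((w - I) * u)) = (Real.exp (-(w * u)) : ℝ) * cexp (u * I) := by
    rw [← e1, ← Complex.exp_add]; congr 1; ring
  rw [pow_zero, one_mul, one_mul, sub_re, e1, e2, re_ofReal_mul, ofReal_re, exp_ofReal_mul_I_re]
  ring

lemma integrableOn_one_sub_cos_mul_exp {w : ℝ} (hw : 0 < w) :
    IntegrableOn (fun u : ℝ => (1 - Real.cos u) * Real.exp (-(w * u))) (Set.Ioi 0) := by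
  have h1 := integrableOn_pow_mul_cexp_neg_mul 0 (z := (w : ℂ)) (by simpa using hw)
  have h2 := integrableOn_pow_mul_cexp_neg_mul 0 (z := (w : ℂ) - I) (by simpa using hw)
  simp only [one_sub_cos_mul_exp_eq_re]
  exact (h1.sub h2).re

lemma integral_one_sub_cos_mul_exp {w : ℝ} (hw : 0 < w) :
    ∫ u in Set.Ioi (0 : ℝ), (1 - Real.cos u) * Real.exp (-(w * u)) = (w * (1 + w ^ 2))⁻¹ := by
  have h1 := integrableOn_pow_mul_cexp_neg_mul 0 (z := (w : ℂ)) (by simpa using hw)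
  have h2 := integrableOn_pow_mul_cexp_neg_mul 0 (z := (w : ℂ) - I) (by simpa using hw)
  simp only [one_sub_cos_mul_exp_eq_re]
  have h3 := reCLM.integral_comp_comm (h1.sub h2)
  simp only [reCLM_apply, Pi.sub_apply] at h3
  rw [h3, integral_sub h1 h2, integral_pow_mul_cexp_neg_mul 0 (z := (w : ℂ)) (by simpa using hw),
    integral_pow_mul_cexp_neg_mul 0 (z := (w : ℂ) - I) (by simpa using hw)]
  simp [Complex.inv_re, Complex.normSq_apply]
  field_simp
  ring

lemma integral_mul_exp_neg_mul {u : ℝ} (hu : 0 < u) :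
    ∫ w in Set.Ioi (0 : ℝ), w * Real.exp (-(w * u)) = (u ^ 2)⁻¹ := by
  have h := integral_pow_mul_cexp_neg_mul 1 (z := (u : ℂ)) (by simpa using hu)
  have e : ∀ w : ℝ, (w : ℂ) ^ 1 * cexp (-((u : ℂ) * w)) = ((w * Real.exp (-(w * u)) : ℝ) : ℂ) := by
    intro w; push_cast; rw [pow_one, mul_comm (u : ℂ)]
  simp only [e] at h
  have h' : ((∫ w in Set.Ioi (0 : ℝ), w * Real.exp (-(w * u)) : ℝ) : ℂ) = (((u ^ 2)⁻¹ : ℝ) : ℂ) := by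
    refine (integral_ofReal (𝕜 := ℂ)).symm.trans (h.trans ?_)
    push_cast; simp
  exact_mod_cast h'

lemma integrable_prod_one_sub_cos :
    Integrable (fun z : ℝ × ℝ => (1 - Real.cos z.1) * (z.2 * Real.exp (-(z.2 * z.1))))
      ((volume.restrict (Set.Ioi 0)).prod (volume.restrict (Set.Ioi 0))) := by
  rw [integrable_prod_iff' (Continuous.aestronglyMeasurable (by fun_prop))]
  constructor
  · filter_upwards [ae_restrict_mem measurableSet_Ioi] with w hw
    refine ((integrableOn_one_sub_cos_mul_exp hw).const_mul w).congr (ae_of_all _ fun u => ?_)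
    simp only; ring
  · have : IntegrableOn (fun w : ℝ => (1 + w ^ 2)⁻¹) (Set.Ioi 0) :=
      integrable_inv_one_add_sq.integrableOn
    refine this.congr ?_
    filter_upwards [ae_restrict_mem measurableSet_Ioi] with w hw
    have hw0 : 0 < w := hw
    have e : ∀ u : ℝ, ‖(1 - Real.cos u) * (w * Real.exp (-(w * u)))‖
        = w * ((1 - Real.cos u) * Real.exp (-(w * u))) := by
      intro u
      rw [Real.norm_of_nonneg
        (mul_nonneg (by linarith [Real.cos_le_one u]) (by positivity))]
      ring
    simp only [e]
    rw [integral_const_mul, integral_one_sub_cos_mul_exp hw0]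
    field_simp

lemma integrableOn_one_sub_cos_div :
    IntegrableOn (fun u : ℝ => (1 - Real.cos u) / u ^ 2) (Set.Ioi 0) := by
  refine integrable_prod_one_sub_cos.integral_prod_left.congr ?_
  filter_upwards [ae_restrict_mem measurableSet_Ioi] with u hu
  rw [integral_const_mul, integral_mul_exp_neg_mul hu]
  rfl

/-- Writing 1/u² as the integral of w exp(-wu) over w and exchanging the integrals leaves the
integral of 1/(1 + w²). -/
lemma integral_one_sub_cos_div :
    ∫ u in Set.Ioi (0 : ℝ), (1 - Real.cos u) / u ^ 2 = Real.pi / 2 := by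
  have h := integral_integral_swap
    (f := fun u w => (1 - Real.cos u) * (w * Real.exp (-(w * u)))) integrable_prod_one_sub_cos
  have e1 : ∫ u in Set.Ioi (0 : ℝ), (1 - Real.cos u) / u ^ 2
      = ∫ u in Set.Ioi (0 : ℝ), ∫ w in Set.Ioi (0 : ℝ),
        (1 - Real.cos u) * (w * Real.exp (-(w * u))) := by
    refine setIntegral_congr_fun measurableSet_Ioi fun u hu => ?_
    rw [integral_const_mul, integral_mul_exp_neg_mul hu]
    rfl
  have e2 : ∫ w in Set.Ioi (0 : ℝ), ∫ u in Set.Ioi (0 : ℝ),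
        (1 - Real.cos u) * (w * Real.exp (-(w * u))) = ∫ w in Set.Ioi (0 : ℝ), (1 + w ^ 2)⁻¹ := by
    refine setIntegral_congr_fun measurableSet_Ioi fun w hw => ?_
    have hw0 : 0 < w := hw
    simp only [mul_left_comm _ w]
    rw [integral_const_mul, integral_one_sub_cos_mul_exp hw0]
    field_simp
  rw [e1, h, e2, integral_Ioi_inv_one_add_sq, Real.arctan_zero, sub_zero]

lemma abs_one_sub_cos_sub_le (u : ℝ) : |1 - Real.cos u - u ^ 2 / 2| ≤ u ^ 4 / 24 := by
  have h := norm_exp_sub_sum_le_of_re_nonpos 4 (z := u * I) (by simp)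
  have h2 := (abs_re_le_norm _).trans h
  have e : (cexp (u * I) - ∑ k ∈ Finset.range 4, (u * I : ℂ) ^ k / (k.factorial : ℂ)).re
      = Real.cos u - 1 + u ^ 2 / 2 := by
    have e1 : ∑ k ∈ Finset.range 4, (u * I : ℂ) ^ k / (k.factorial : ℂ)
        = ((1 - u ^ 2 / 2 : ℝ) : ℂ) + ((u - u ^ 3 / 6 : ℝ) : ℂ) * I := by
      simp only [Finset.sum_range_succ, Finset.sum_range_zero, Nat.factorial, mul_pow, I_sq]
      have : I ^ 3 = -I := I_pow_three
      rw [this]; push_cast; ring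
    rw [e1, sub_re, exp_ofReal_mul_I_re, add_re, ofReal_re, re_ofReal_mul, I_re]
    ring
  rw [e, norm_mul, norm_I, mul_one, norm_real, Real.norm_eq_abs,
    Even.pow_abs (by decide)] at h2
  rw [show 1 - Real.cos u - u ^ 2 / 2 = -(Real.cos u - 1 + u ^ 2 / 2) by ring, abs_neg]
  simpa [Nat.factorial] using h2

lemma abs_sin_sub_le (u : ℝ) : |Real.sin u - (u - u ^ 3 / 6)| ≤ u ^ 4 / 24 := by
  have h := norm_exp_sub_sum_le_of_re_nonpos 4 (z := u * I) (by simp)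
  have h2 := (abs_im_le_norm _).trans h
  have e : (cexp (u * I) - ∑ k ∈ Finset.range 4, (u * I : ℂ) ^ k / (k.factorial : ℂ)).im
      = Real.sin u - (u - u ^ 3 / 6) := by
    have e1 : ∑ k ∈ Finset.range 4, (u * I : ℂ) ^ k / (k.factorial : ℂ)
        = ((1 - u ^ 2 / 2 : ℝ) : ℂ) + ((u - u ^ 3 / 6 : ℝ) : ℂ) * I := by
      simp only [Finset.sum_range_succ, Finset.sum_range_zero, Nat.factorial, mul_pow, I_sq]
      have : I ^ 3 = -I := I_pow_three
      rw [this]; push_cast; ring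
    rw [e1, sub_im, exp_ofReal_mul_I_im, add_im, ofReal_im, im_ofReal_mul, I_im]
    ring
  rw [e, norm_mul, norm_I, mul_one, norm_real, Real.norm_eq_abs,
    Even.pow_abs (by decide)] at h2
  simpa [Nat.factorial] using h2

lemma re_paretoCharFun {p : ℕ} (hp : 1 ≤ p) (A : ℝ) :
    (paretoCharFun p A).re = ∫ s in Set.Ioi (1 : ℝ), paretoDensity p s * Real.cos (A * s) := by
  have h := reCLM.integral_comp_comm (integrableOn_paretoDensity_mul hp A)
  rw [paretoCharFun]
  simp only [reCLM_apply] at h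
  rw [← h]
  congr 1 with s
  rw [re_ofReal_mul, exp_ofReal_mul_I_re]

lemma im_paretoCharFun {p : ℕ} (hp : 1 ≤ p) (A : ℝ) :
    (paretoCharFun p A).im = ∫ s in Set.Ioi (1 : ℝ), paretoDensity p s * Real.sin (A * s) := by
  have h := imCLM.integral_comp_comm (integrableOn_paretoDensity_mul hp A)
  rw [paretoCharFun]
  simp only [imCLM_apply] at h
  rw [← h]
  congr 1 with s
  rw [im_ofReal_mul, exp_ofReal_mul_I_im]

/-- Scaling gives 1 - Re E(A) = a ∫_a^∞ (1 - cos u)/u² du with a = |A|. The complete integral π/2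
yields the singular term; the missing piece over (0, a) is a/2 up to a³/72. -/
lemma abs_re_paretoCharFun_one_sub_le (A : ℝ) :
    |(paretoCharFun 1 A).re - (1 - Real.pi / 2 * |A| + A ^ 2 / 2)| ≤ A ^ 4 / 72 := by
  rcases eq_or_ne A 0 with rfl | hA
  · rw [re_paretoCharFun le_rfl]
    simp [integral_paretoDensity le_rfl]
  set a := |A| with ha
  have ha0 : 0 < a := abs_pos.2 hA
  set h : ℝ → ℝ := fun u => (1 - Real.cos u) / u ^ 2 with hh
  have hi := integrableOn_one_sub_cos_div
  have hcos : ∀ s, Real.cos (A * s) = Real.cos (a * s) := by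
    intro s
    rcases abs_choice A with h1 | h1 <;> rw [ha, h1]
    rw [neg_mul, Real.cos_neg]
  have e1 : 1 - (paretoCharFun 1 A).re = a * ∫ u in Set.Ioi a, h u := by
    have hc : IntegrableOn (fun s => paretoDensity 1 s * Real.cos (A * s)) (Set.Ioi 1) := by
      refine (integrableOn_paretoDensity_mul le_rfl A).re.congr (ae_of_all _ fun s => ?_)
      simp only [RCLike.re_to_complex]
      rw [re_ofReal_mul, exp_ofReal_mul_I_re]
    have h1 := integral_comp_mul_left_Ioi h 1 ha0
    rw [mul_one, smul_eq_mul] at h1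
    have h2 : ∫ u in Set.Ioi a, h u = a * ∫ s in Set.Ioi (1 : ℝ), h (a * s) := by
      rw [h1]; field_simp
    have h3 : 1 - (paretoCharFun 1 A).re
        = ∫ s in Set.Ioi (1 : ℝ), (paretoDensity 1 s - paretoDensity 1 s * Real.cos (A * s)) := by
      rw [integral_sub (integrableOn_paretoDensity le_rfl) hc, integral_paretoDensity le_rfl,
        re_paretoCharFun le_rfl]
    rw [h3, h2, ← mul_assoc, ← integral_const_mul]
    refine setIntegral_congr_fun measurableSet_Ioi fun s hs => ?_
    have hs0 : (0 : ℝ) < s := one_pos.trans hs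
    simp only [hh, hcos, paretoDensity]
    push_cast
    field_simp
  have e2 : ∫ u in Set.Ioi a, h u = Real.pi / 2 - ∫ u in (0 : ℝ)..a, h u := by
    have h1 := setIntegral_union (f := h) (μ := volume) (Set.Ioc_disjoint_Ioi (a := 0) le_rfl)
      measurableSet_Ioi (hi.mono_set Set.Ioc_subset_Ioi_self)
      (hi.mono_set (Set.Ioi_subset_Ioi ha0.le))
    rw [Set.Ioc_union_Ioi_eq_Ioi ha0.le] at h1
    rw [← integral_one_sub_cos_div, intervalIntegral.integral_of_le ha0.le, h1]
    ring
  have e3 : |(∫ u in (0 : ℝ)..a, h u) - a / 2| ≤ a ^ 3 / 72 := by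
    have hint : IntervalIntegrable h volume 0 a :=
      (intervalIntegrable_iff_integrableOn_Ioc_of_le ha0.le).2 (hi.mono_set Set.Ioc_subset_Ioi_self)
    have : (∫ u in (0 : ℝ)..a, h u) - a / 2 = ∫ u in (0 : ℝ)..a, (h u - 1 / 2) := by
      rw [intervalIntegral.integral_sub hint (by simp)]
      simp; ring
    rw [this, ← Real.norm_eq_abs]
    refine (intervalIntegral.norm_integral_le_of_norm_le (g := fun u => u ^ 2 / 24) ha0.le
      (ae_of_all _ fun u hu => ?_) (Continuous.intervalIntegrable (by fun_prop) _ _)).trans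
      (le_of_eq ?_)
    · have hu0 : 0 < u := hu.1
      have : h u - 1 / 2 = (1 - Real.cos u - u ^ 2 / 2) / u ^ 2 := by
        simp only [hh]; field_simp
      rw [this, norm_div, Real.norm_eq_abs, Real.norm_of_nonneg (sq_nonneg u), div_le_iff₀ (by positivity)]
      exact (abs_one_sub_cos_sub_le u).trans (by apply le_of_eq; ring)
    · rw [intervalIntegral.integral_div, integral_pow]; norm_num; ring
  have e4 : (paretoCharFun 1 A).re - (1 - Real.pi / 2 * a + A ^ 2 / 2)
      = a * ((∫ u in (0 : ℝ)..a, h u) - a / 2) := by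
    have h1 : (paretoCharFun 1 A).re = 1 - a * ∫ u in Set.Ioi a, h u := by linarith
    rw [h1, e2, ← sq_abs A]; ring
  rw [e4, abs_mul, abs_of_pos ha0]
  calc _ ≤ a * (a ^ 3 / 72) := by gcongr
    _ = a ^ 4 / 72 := by ring
    _ = _ := by rw [ha, Even.pow_abs (by decide)]

/-- The dependence of the imaginary part of `ρ² E(B / ρ²)` on the radius `ρ`. -/
lemma abs_sq_mul_im_paretoCharFun_sub_le {ρ R : ℝ} (hR : 0 < R) (hρ : R / 2 ≤ ρ) (B : ℝ) :
    |ρ ^ 2 * (paretoCharFun 1 (B / ρ ^ 2)).im - R ^ 2 * (paretoCharFun 1 (B / R ^ 2)).im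
        - (2 * B * Real.log (ρ / R) - B ^ 3 / 12 * ((R ^ 4)⁻¹ - (ρ ^ 4)⁻¹))|
      ≤ 2 * (B ^ 4 * (R ^ 6)⁻¹) := by
  set G : ℝ → ℝ := fun s => Real.sin (B * s) / s ^ 2 with hG
  have hρ0 : 0 < ρ := by linarith
  have hGi : ∀ b : ℝ, 0 < b → IntegrableOn G (Set.Ioi b) := by
    intro b hb
    have h1 : IntegrableOn (fun s : ℝ => s ^ (-2 : ℝ)) (Set.Ioi b) :=
      integrableOn_Ioi_rpow_of_lt (by norm_num) hb
    refine h1.mono' (Measurable.aestronglyMeasurable (by fun_prop)) ?_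
    filter_upwards [ae_restrict_mem measurableSet_Ioi] with s hs
    have hs0 : 0 < s := hb.trans hs
    simp only [hG]
    rw [norm_div, Real.norm_of_nonneg (sq_nonneg s), Real.rpow_neg hs0.le, div_eq_mul_inv]
    have : s ^ (2 : ℝ) = s ^ 2 := by norm_cast
    rw [this]
    exact mul_le_of_le_one_left (by positivity) (Real.abs_sin_le_one _)
  -- Only the lower limit of the integral of sin(Bs)/s² depends on the radius. The difference of two
  -- radii is thus an integral over a bounded interval, where the sine may be expanded; the term B/s
  -- produces the logarithm.
  have key : ∀ r : ℝ, 0 < r → r ^ 2 * (paretoCharFun 1 (B / r ^ 2)).im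
      = ∫ s in Set.Ioi (r ^ 2)⁻¹, G s := by
    intro r hr
    have h1 := integral_comp_mul_left_Ioi G 1 (show 0 < (r ^ 2)⁻¹ by positivity)
    rw [mul_one, inv_inv, smul_eq_mul] at h1
    have h2 : ∫ s in Set.Ioi (r ^ 2)⁻¹, G s
        = (r ^ 2)⁻¹ * ∫ s in Set.Ioi (1 : ℝ), G ((r ^ 2)⁻¹ * s) := by
      rw [h1]; field_simp
    rw [h2, im_paretoCharFun le_rfl, ← integral_const_mul, ← integral_const_mul]
    refine setIntegral_congr_fun measurableSet_Ioi fun s hs => ?_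
    have hs0 : (0 : ℝ) < s := one_pos.trans hs
    simp only [hG, paretoDensity]
    rw [show B * ((r ^ 2)⁻¹ * s) = B / r ^ 2 * s by ring]
    push_cast
    field_simp
  have hsub : ∀ s ∈ Set.uIcc (ρ ^ 2)⁻¹ (R ^ 2)⁻¹, 0 < s := by
    intro s hs
    exact (lt_min (by positivity) (by positivity)).trans_le hs.1
  have hGc : ContinuousOn G (Set.uIcc (ρ ^ 2)⁻¹ (R ^ 2)⁻¹) :=
    ContinuousOn.div (by fun_prop) (by fun_prop) fun s hs => pow_ne_zero _ (hsub s hs).ne'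
  have hd : ∀ s ∈ Set.uIcc (ρ ^ 2)⁻¹ (R ^ 2)⁻¹, HasDerivAt
      (fun s => B * Real.log s - B ^ 3 / 12 * s ^ 2) ((B * s - (B * s) ^ 3 / 6) / s ^ 2) s := by
    intro s hs
    have h0 := hsub s hs
    refine (((Real.hasDerivAt_log h0.ne').const_mul B).sub
      ((hasDerivAt_pow 2 s).const_mul (B ^ 3 / 12))).congr_deriv ?_
    push_cast
    field_simp
    ring
  have hPc : ContinuousOn (fun s : ℝ => (B * s - (B * s) ^ 3 / 6) / s ^ 2)
      (Set.uIcc (ρ ^ 2)⁻¹ (R ^ 2)⁻¹) :=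
    ContinuousOn.div (by fun_prop) (by fun_prop) fun s hs => pow_ne_zero _ (hsub s hs).ne'
  have hmain := intervalIntegral.integral_eq_sub_of_hasDerivAt hd hPc.intervalIntegrable
  have hdiff : ρ ^ 2 * (paretoCharFun 1 (B / ρ ^ 2)).im - R ^ 2 * (paretoCharFun 1 (B / R ^ 2)).im
      = ∫ s in (ρ ^ 2)⁻¹..(R ^ 2)⁻¹, G s := by
    rw [key ρ hρ0, key R hR]
    exact intervalIntegral.integral_Ioi_sub_Ioi' (hGi _ (by positivity)) (hGi _ (by positivity))
  have hlog : 2 * B * Real.log (ρ / R) - B ^ 3 / 12 * ((R ^ 4)⁻¹ - (ρ ^ 4)⁻¹)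
      = ∫ s in (ρ ^ 2)⁻¹..(R ^ 2)⁻¹, (B * s - (B * s) ^ 3 / 6) / s ^ 2 := by
    rw [hmain, Real.log_div hρ0.ne' hR.ne', Real.log_inv, Real.log_inv, Real.log_pow, Real.log_pow]
    push_cast
    rw [← inv_pow, ← inv_pow, ← inv_pow, ← inv_pow]
    ring
  rw [hdiff, hlog, ← intervalIntegral.integral_sub hGc.intervalIntegrable hPc.intervalIntegrable,
    ← Real.norm_eq_abs]
  have hle : ∀ s ∈ Set.uIoc (ρ ^ 2)⁻¹ (R ^ 2)⁻¹,
      ‖G s - (B * s - (B * s) ^ 3 / 6) / s ^ 2‖ ≤ B ^ 4 / 24 * (4 * (R ^ 2)⁻¹) ^ 2 := by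
    intro s hs
    have h0 := hsub s (Set.uIoc_subset_uIcc hs)
    have hs4 : s ≤ 4 * (R ^ 2)⁻¹ := by
      refine hs.2.trans (max_le ?_ ?_)
      · rw [← div_eq_mul_inv, inv_le_comm₀ (by positivity) (by positivity), inv_div]
        rw [div_le_iff₀ (by norm_num)]
        nlinarith
      · have : 0 < (R ^ 2)⁻¹ := by positivity
        linarith
    have : G s - (B * s - (B * s) ^ 3 / 6) / s ^ 2
        = (Real.sin (B * s) - (B * s - (B * s) ^ 3 / 6)) / s ^ 2 := by simp only [hG]; ring
    rw [this, norm_div, Real.norm_of_nonneg (sq_nonneg s), Real.norm_eq_abs,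
      div_le_iff₀ (by positivity)]
    refine (abs_sin_sub_le (B * s)).trans ?_
    calc (B * s) ^ 4 / 24 = B ^ 4 / 24 * s ^ 2 * s ^ 2 := by ring
      _ ≤ _ := by gcongr
  refine (intervalIntegral.norm_integral_le_of_norm_le_const hle).trans ?_
  have hab : |(R ^ 2)⁻¹ - (ρ ^ 2)⁻¹| ≤ 3 * (R ^ 2)⁻¹ := by
    have h1 : (ρ ^ 2)⁻¹ ≤ 4 * (R ^ 2)⁻¹ := by
      rw [← div_eq_mul_inv, inv_le_comm₀ (by positivity) (by positivity), inv_div,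
        div_le_iff₀ (by norm_num)]
      nlinarith
    have h2 : 0 < (ρ ^ 2)⁻¹ := by positivity
    rw [abs_le]; constructor <;> linarith
  have hB : 0 ≤ B ^ 4 := by positivity
  calc _ ≤ B ^ 4 / 24 * (4 * (R ^ 2)⁻¹) ^ 2 * (3 * (R ^ 2)⁻¹) := by gcongr
    _ = 2 * (B ^ 4 * (R ^ 6)⁻¹) := by field_simp; ring

end ParetoOne

/-! ### Expansion of the Pareto characteristic function of index 2. -/

section ParetoTwo

lemma im_paretoCharFun_neg {p : ℕ} (hp : 1 ≤ p) (A : ℝ) :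
    (paretoCharFun p (-A)).im = -(paretoCharFun p A).im := by
  rw [im_paretoCharFun hp, im_paretoCharFun hp, ← integral_neg]
  congr 1 with s
  rw [neg_mul, Real.sin_neg]; ring

lemma abs_im_paretoCharFun_one_add_le {A : ℝ} (hA : |A| ≤ 1) :
    |(paretoCharFun 1 A).im + A * (Real.log |A|)| ≤ 4 * |A| := by
  have pos : ∀ a : ℝ, 0 < a → a ≤ 1 → |(paretoCharFun 1 a).im + a * Real.log a| ≤ 4 * a := by
    intro a ha ha1
    have hs : √a ^ 2 = a := Real.sq_sqrt ha.le
    have hs0 : 0 < √a := Real.sqrt_pos.2 ha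
    have hs1 : √a ≤ 1 := Real.sqrt_le_one.2 ha1
    -- With B = R = 1 and ρ = a^(-1/2), the comparison of two radii relates E(a) to E(1), whose
    -- imaginary part is at most 1 in modulus, and isolates log a.
    have h := abs_sq_mul_im_paretoCharFun_sub_le (ρ := (√a)⁻¹) one_pos
      (by rw [div_le_iff₀ two_pos]; linarith [(one_le_inv₀ hs0).2 hs1]) 1
    have e4 : (√a) ^ 4 = a ^ 2 := by rw [show 4 = 2 * 2 from rfl, pow_mul, hs]
    rw [inv_pow, hs, div_one, Real.log_inv, Real.log_sqrt ha.le, inv_pow, inv_inv, e4] at h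
    simp only [one_div, inv_inv, one_pow, inv_one, mul_one, one_mul] at h
    have h1 := (abs_im_le_norm _).trans (norm_paretoCharFun_le_one le_rfl (1 : ℝ))
    have ha2 : a ^ 2 ≤ 1 := pow_le_one₀ ha.le ha1
    have ha2' : 0 ≤ a ^ 2 := sq_nonneg a
    rw [abs_le] at h h1
    have e : (paretoCharFun 1 a).im + a * Real.log a
        = a * (a⁻¹ * (paretoCharFun 1 a).im + Real.log a) := by field_simp
    rw [e, abs_mul, abs_of_pos ha, mul_comm]
    gcongr
    rw [abs_le]
    constructor <;> linarith [h.1, h.2, h1.1, h1.2]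
  rcases lt_trichotomy A 0 with h0 | h0 | h0
  · rw [abs_of_neg h0] at hA ⊢
    have := pos (-A) (by linarith) hA
    rw [im_paretoCharFun_neg le_rfl] at this
    rwa [← abs_neg, neg_add, ← neg_mul]
  · subst h0
    rw [im_paretoCharFun le_rfl]; simp
  · rw [abs_of_pos h0] at hA ⊢
    exact pos A h0 hA

lemma paretoCharFun_two_eq (A : ℝ) :
    paretoCharFun 2 A = cexp (A * I) + A * I * paretoCharFun 1 A := by
  rw [mul_paretoCharFun le_rfl]; push_cast; ring

/-- By `paretoCharFun_two_eq` the term A² log|A| is A times the singular imaginary part for index 1.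
-/
lemma norm_paretoCharFun_two_sub_le (A : ℝ) :
    ‖paretoCharFun 2 A - (1 + (2 * A : ℝ) * I + (A ^ 2 * Real.log |A| : ℝ))‖
      ≤ 8 * (A ^ 2 + |A| ^ 3) := by
  have hA0 := abs_nonneg A
  rw [← sq_abs A]
  rcases le_total |A| 1 with h1 | h1
  · have e : paretoCharFun 2 A - (1 + (2 * A : ℝ) * I + (|A| ^ 2 * Real.log |A| : ℝ))
        = (cexp (A * I) - 1 - A * I) + (A * ((paretoCharFun 1 A).re - 1) : ℝ) * I
          - (A * ((paretoCharFun 1 A).im + A * (Real.log |A|)) : ℝ) := by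
      conv_lhs => rw [paretoCharFun_two_eq, ← re_add_im (paretoCharFun 1 A), sq_abs]
      push_cast
      linear_combination A * (paretoCharFun 1 A).im * I_sq
    have b1 := norm_cexp_I_sub_one_sub_le A
    have b2 : |(paretoCharFun 1 A).re - 1| ≤ 3 * |A| := by
      have h := abs_re_paretoCharFun_one_sub_le A
      have hpi := Real.pi_lt_d2
      have hpi0 := Real.pi_pos
      have q2 : A ^ 2 ≤ |A| := by rw [← sq_abs, sq]; nlinarith
      have q4 : A ^ 4 ≤ |A| := by
        rw [← Even.pow_abs (by decide : Even 4)]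
        exact pow_le_of_le_one hA0 h1 (by norm_num)
      have q20 : 0 ≤ A ^ 2 := sq_nonneg A
      rw [abs_le] at h ⊢
      constructor <;> nlinarith [h.1, h.2]
    have b3 := abs_im_paretoCharFun_one_add_le h1
    rw [e]
    refine (norm_sub_le _ _).trans ((add_le_add (norm_add_le _ _) le_rfl).trans ?_)
    rw [norm_mul, norm_I, mul_one, norm_real, norm_real, Real.norm_eq_abs, Real.norm_eq_abs,
      abs_mul, abs_mul]
    rw [← sq_abs] at b1
    have c2 := mul_le_mul_of_nonneg_left b2 hA0
    have c3 := mul_le_mul_of_nonneg_left b3 hA0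
    have : 0 ≤ |A| ^ 3 := by positivity
    nlinarith
  -- For |A| ≥ 1 nothing cancels: each term is itself O(A² + |A|³).
  · refine (norm_sub_le _ _).trans ?_
    have b1 := norm_paretoCharFun_le_one (p := 2) (by norm_num) A
    have b2 : ‖(1 : ℂ) + (2 * A : ℝ) * I + (|A| ^ 2 * Real.log |A| : ℝ)‖
        ≤ 1 + 2 * |A| + |A| ^ 2 * Real.log |A| := by
      refine (norm_add₃_le).trans (le_of_eq ?_)
      rw [norm_one, norm_mul, norm_I, mul_one, norm_real, norm_real, Real.norm_eq_abs,
        Real.norm_eq_abs, abs_mul, abs_mul, abs_two, abs_of_nonneg (Real.log_nonneg h1),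
        abs_of_nonneg (sq_nonneg |A|)]
    have b3 := Real.log_le_sub_one_of_pos (by linarith : 0 < |A|)
    have b4 := mul_le_mul_of_nonneg_left b3 (sq_nonneg |A|)
    nlinarith

/-- The imaginary term 2A is orthogonal to 1 and so enters the modulus only at order A², whereas A²
log|A| is negative and supplies the damping. -/
lemma norm_paretoCharFun_two_le {A : ℝ} (hA : |A| ≤ 1) :
    ‖paretoCharFun 2 A‖ ≤ 1 + A ^ 2 * Real.log |A| + 20 * A ^ 2 := by
  have h := norm_paretoCharFun_two_sub_le A
  have hA0 := abs_nonneg A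
  have hlog0 : Real.log |A| ≤ 0 := Real.log_nonpos hA0 hA
  have hlog1 : -(1 / 2) ≤ A ^ 2 * Real.log |A| := by
    rcases eq_or_lt_of_le hA0 with h0 | h0
    · rw [← sq_abs, ← h0]; norm_num
    · have h2 := Real.one_sub_inv_le_log_of_pos (show 0 < |A| ^ 2 by positivity)
      rw [Real.log_pow] at h2
      have h3 := mul_le_mul_of_nonneg_left h2 (sq_nonneg |A|)
      rw [mul_sub, mul_inv_cancel₀ (by positivity)] at h3
      rw [← sq_abs]
      push_cast at h3
      nlinarith
  have hy := mul_nonpos_of_nonneg_of_nonpos (sq_nonneg A) hlog0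
  set y := A ^ 2 * Real.log |A|
  have hn : ‖(1 : ℂ) + (2 * A : ℝ) * I + (y : ℝ)‖ ≤ 1 + y + 4 * A ^ 2 := by
    have e : (1 : ℂ) + (2 * A : ℝ) * I + (y : ℝ) = ((1 + y : ℝ) : ℂ) + ((2 * A : ℝ) : ℂ) * I := by
      push_cast; ring
    rw [e, norm_add_mul_I]
    refine Real.sqrt_le_iff.2 ⟨by nlinarith [sq_nonneg A], ?_⟩
    nlinarith [sq_nonneg A, sq_nonneg (A ^ 2)]
  have h3 : |A| ^ 3 ≤ A ^ 2 := by
    rw [← sq_abs A]; exact pow_le_pow_of_le_one hA0 hA (by norm_num)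
  have h4 := norm_add_le (paretoCharFun 2 A - (1 + (2 * A : ℝ) * I + (y : ℝ)))
    (1 + (2 * A : ℝ) * I + (y : ℝ))
  rw [sub_add_cancel] at h4
  linarith

end ParetoTwo

/-! ### Angular averages of Pareto characteristic functions, with decay uniform in g. -/

section RadialCharFun

/-- The characteristic function of `F (ξ - x)`, with `ξ` uniform on the disc of radius `R`, for a
field `F` that is homogeneous of degree `-k` with the angular part `m cos k(θ - θ₀)`. -/
def radialCharFun (k p : ℕ) (m R : ℝ) (x t : Plane) : ℂ :=
  angAvg fun θ => (((chord R x θ / R) ^ 2 : ℝ) : ℂ) *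
    paretoCharFun p (m * dirComp t (k * θ) / chord R x θ ^ k)

variable {k p : ℕ} {m R : ℝ} {x t : Plane}

lemma starCharFun_eq_radialCharFun {F : Plane → Plane} (hkp : k * p = 2) (hx : ‖x‖ < R)
    (hF : ∀ r θ, 0 < r → (⟪F (polarPt r θ), t⟫ : ℝ) = m * dirComp t (k * θ) / r ^ k) :
    starCharFun R x F t = radialCharFun k p m R x t := by
  unfold starCharFun radialCharFun
  congr 1 with θ
  have hρ := chord_pos hx θ
  have e : ∫ r in (0 : ℝ)..chord R x θ, (r : ℂ) * cexp ((⟪F (polarPt r θ), t⟫ : ℝ) * I)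
      = ∫ r in (0 : ℝ)..chord R x θ, (r : ℂ) * cexp ((m * dirComp t (k * θ) / r ^ k : ℝ) * I) := by
    rw [intervalIntegral.integral_of_le hρ.le, intervalIntegral.integral_of_le hρ.le]
    refine setIntegral_congr_fun measurableSet_Ioc fun r hr => ?_
    simp only [hF r θ hr.1]
  have h := two_mul_integral_eq_paretoCharFun hkp hρ (m * dirComp t (k * θ))
  rw [e]
  push_cast at h ⊢
  linear_combination (1 / (R : ℂ) ^ 2) * h

lemma continuous_radial (hp : 1 ≤ p) (hx : ‖x‖ < R) : Continuous fun θ =>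
    (((chord R x θ / R) ^ 2 : ℝ) : ℂ) *
      paretoCharFun p (m * dirComp t (k * θ) / chord R x θ ^ k) := by
  have h1 := continuous_chord R x
  have h2 := continuous_dirComp t
  refine Continuous.mul (by fun_prop) ((continuous_paretoCharFun hp).comp ?_)
  exact Continuous.div (by fun_prop) (by fun_prop) fun θ => pow_ne_zero _ (chord_pos hx θ).ne'

lemma angAvg_comp_mul {F : Type*} [NormedAddCommGroup F] [NormedSpace ℝ F] (hkp : k * p = 2)
    {f : ℝ → F} (hf : Continuous f) (hp : Function.Periodic f (2 * Real.pi)) :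
    angAvg (fun θ => f (k * θ)) = angAvg f := by
  have hk : k ≤ 2 := Nat.le_of_dvd two_pos ⟨p, hkp.symm⟩
  interval_cases k
  · omega
  · simp
  · exact_mod_cast angAvg_comp_two_mul hf hp

/-- The AM-GM bound √y ≤ (l/2) y + 1/(2l) reduces to the exactly known average of y; l = (1 +
X)^(1/4) is the optimal weight. -/
lemma angAvg_sqrt_inv_le {X : ℝ} (hX : 0 ≤ X) :
    angAvg (fun θ => √((1 + X * Real.cos θ ^ 2)⁻¹)) ≤ (√(√(1 + X)))⁻¹ := by
  set l := √(√(1 + X)) with hl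
  have hl0 : 0 < l := by positivity
  have hl2 : l ^ 2 = √(1 + X) := Real.sq_sqrt (Real.sqrt_nonneg _)
  have hpos : ∀ θ, 0 < 1 + X * Real.cos θ ^ 2 := fun θ => by positivity
  have hc : Continuous fun θ => (1 + X * Real.cos θ ^ 2)⁻¹ :=
    Continuous.inv₀ (by fun_prop) fun θ => (hpos θ).ne'
  have h : ∀ θ, √((1 + X * Real.cos θ ^ 2)⁻¹)
      ≤ l / 2 * (1 + X * Real.cos θ ^ 2)⁻¹ + l⁻¹ / 2 := by
    intro θ
    have h1 : 0 ≤ (1 + X * Real.cos θ ^ 2)⁻¹ := (inv_pos.2 (hpos θ)).le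
    set v := √((1 + X * Real.cos θ ^ 2)⁻¹) with hv
    rw [← Real.sq_sqrt h1, ← hv]
    have : 0 ≤ (l * v - 1) ^ 2 / (2 * l) := by positivity
    have e : (l * v - 1) ^ 2 / (2 * l) = l / 2 * v ^ 2 + l⁻¹ / 2 - v := by field_simp; ring
    linarith
  refine (angAvg_mono hc.sqrt (by fun_prop) h).trans (le_of_eq ?_)
  rw [angAvg_add (by fun_prop) continuous_const, angAvg_const_mul, angAvg_const,
    angAvg_inv_one_add_mul_cos_sq hX, ← hl2]
  field_simp
  ring

/-- The decay of the Pareto function is averaged over the angle, where directions with cosine near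
zero contribute none. The prefactor is harmless: its g-th power is at most exp(π|x|²) when R =
`discRadius g`. -/
lemma exists_norm_radialCharFun_le (hkp : k * p = 2) (hm : 0 < m) :
    ∃ c : ℝ, 0 < c ∧ c ≤ 1 ∧ ∀ (R : ℝ) (x t : Plane), ‖x‖ < R →
      ‖radialCharFun k p m R x t‖
        ≤ (1 + (‖x‖ / R) ^ 2) * (√(√(1 + c * (m * ‖t‖) ^ p / (4 * R ^ 2))))⁻¹ := by
  have hp : 1 ≤ p := by rcases p with _ | p <;> omega
  have hp2 : p ≤ 2 := Nat.le_of_dvd two_pos ⟨k, by rw [mul_comm]; exact hkp.symm⟩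
  obtain ⟨c₀, hc₀, hE₀⟩ := exists_norm_paretoCharFun_sq_le hp hp2
  refine ⟨min c₀ 1, by positivity, min_le_right _ _, fun R x t hx => ?_⟩
  set c := min c₀ 1
  have hc : 0 < c := by positivity
  have hE : ∀ A, ‖paretoCharFun p A‖ ^ 2 ≤ (1 + c * |A| ^ p)⁻¹ := fun A =>
    (hE₀ A).trans (by gcongr; exact min_le_left _ _)
  have hR : 0 < R := (norm_nonneg x).trans_lt hx
  set X := c * (m * ‖t‖) ^ p / (4 * R ^ 2) with hX
  have hX0 : 0 ≤ X := by positivity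
  obtain ⟨α, hα⟩ := exists_dirComp_eq t
  set h : ℝ → ℝ := fun θ => √((1 + X * Real.cos (k * θ + α) ^ 2)⁻¹) with hh
  have hpos : ∀ θ, 0 < 1 + X * Real.cos θ ^ 2 := fun θ => by positivity
  have hhc : Continuous h :=
    (Continuous.inv₀ (by fun_prop) fun θ => (hpos _).ne').sqrt
  have hhpi : ∀ θ, h (θ + Real.pi) = h θ := by
    intro θ
    simp only [hh]
    rw [show k * (θ + Real.pi) + α = (k * θ + α) + k * Real.pi by ring, Real.cos_add_nat_mul_pi,
      mul_pow, ← pow_mul, mul_comm k 2, pow_mul]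
    norm_num
  have hρ := continuous_chord R x
  have hle : ∀ θ, ‖(((chord R x θ / R) ^ 2 : ℝ) : ℂ) *
      paretoCharFun p (m * dirComp t (k * θ) / chord R x θ ^ k)‖ ≤ (chord R x θ / R) ^ 2 * h θ := by
    intro θ
    have hρ0 := chord_pos hx θ
    rw [norm_mul, norm_real, Real.norm_of_nonneg (sq_nonneg _)]
    refine mul_le_mul_of_nonneg_left ?_ (sq_nonneg _)
    refine Real.le_sqrt_of_sq_le ((hE _).trans ?_)
    refine inv_anti₀ (hpos _) ?_
    have h1 : |m * dirComp t (k * θ) / chord R x θ ^ k| ^ p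
        = (m * ‖t‖) ^ p * |Real.cos (k * θ + α)| ^ p / chord R x θ ^ 2 := by
      rw [abs_div, div_pow, abs_of_pos (pow_pos hρ0 k), ← pow_mul, hkp, hα, ← mul_assoc, abs_mul,
        mul_pow, abs_of_nonneg (mul_nonneg hm.le (norm_nonneg t))]
    have h2 : Real.cos (k * θ + α) ^ 2 ≤ |Real.cos (k * θ + α)| ^ p := by
      rw [← sq_abs]
      exact pow_le_pow_of_le_one (abs_nonneg _) (Real.abs_cos_le_one _) hp2
    have h3 : chord R x θ ^ 2 ≤ 4 * R ^ 2 := by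
      have := chord_le hx θ
      nlinarith
    rw [h1, hX]
    have : c * (m * ‖t‖) ^ p / (4 * R ^ 2) * Real.cos (k * θ + α) ^ 2
        ≤ c * (m * ‖t‖) ^ p / chord R x θ ^ 2 * |Real.cos (k * θ + α)| ^ p := by
      gcongr
    calc _ ≤ 1 + c * (m * ‖t‖) ^ p / chord R x θ ^ 2 * |Real.cos (k * θ + α)| ^ p := by linarith
      _ = _ := by ring
  refine (norm_angAvg_le (continuous_radial hp hx) (by fun_prop) hle).trans ?_
  have hper : Function.Periodic (fun θ => (chord R x θ / R) ^ 2 * h θ) (2 * Real.pi) := by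
    intro θ
    simp only
    rw [chord_periodic R x θ, two_mul, ← add_assoc, hhpi, hhpi]
  have hle2 : ∀ θ, (2 : ℝ)⁻¹ • ((chord R x θ / R) ^ 2 * h θ
      + (chord R x (θ + Real.pi) / R) ^ 2 * h (θ + Real.pi)) ≤ (1 + (‖x‖ / R) ^ 2) * h θ := by
    intro θ
    have h1 := chord_sq_add_chord_sq hx θ
    have h2 := dirComp_sq_le x θ
    have h3 : 0 ≤ h θ := Real.sqrt_nonneg _
    rw [hhpi, smul_eq_mul, ← add_mul, ← mul_assoc]
    refine mul_le_mul_of_nonneg_right ?_ h3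
    rw [div_pow, div_pow, ← add_div, h1, div_pow]
    have : 1 + ‖x‖ ^ 2 / R ^ 2 = 2⁻¹ * ((2 * R ^ 2 + 2 * ‖x‖ ^ 2) / R ^ 2) := by field_simp
    rw [this]
    exact mul_le_mul_of_nonneg_left
      (div_le_div_of_nonneg_right (by linarith) (by positivity)) (by norm_num)
  -- The majorant h is π-periodic, so opposite chords combine and (ρ² + ρ'²)/2 ≤ R² + |x|² replaces
  -- the cruder bound (R + |x|)², which would cost a factor unbounded in g.
  rw [angAvg_eq_pair (by fun_prop) hper Real.pi]
  refine (angAvg_mono (by fun_prop) (by fun_prop) hle2).trans ?_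
  rw [angAvg_const_mul]
  refine mul_le_mul_of_nonneg_left ?_ (by positivity)
  set f : ℝ → ℝ := fun θ => √((1 + X * Real.cos θ ^ 2)⁻¹) with hf
  have hfc : Continuous f := (Continuous.inv₀ (by fun_prop) fun θ => (hpos θ).ne').sqrt
  have hfp : Function.Periodic f (2 * Real.pi) := fun θ => by simp only [hf, Real.cos_add_two_pi]
  have e1 := angAvg_comp_mul hkp (f := fun θ => f (θ + α)) (by fun_prop)
    (fun θ => by simp only; rw [add_right_comm]; exact hfp _)
  have e2 := angAvg_comp_add hfp α
  calc angAvg h = angAvg f := by rw [← e2, ← e1]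
    _ ≤ _ := angAvg_sqrt_inv_le hX0

/-- The fourth root turns the exponent N into ⌊N/4⌋ ≥ N/8, to which Bernoulli's inequality of order
n applies. -/
lemma inv_sqrt_sqrt_pow_le {a X : ℝ} (hX : 0 ≤ X) (ha : 0 ≤ a) {n N : ℕ} (hn : 0 < n)
    (hN : 4 * n ≤ N) :
    ((1 + a) * (√(√(1 + X)))⁻¹) ^ N ≤ Real.exp (N * a) * ((1 + N * X / (8 * n)) ^ n)⁻¹ := by
  rw [mul_pow]
  have h1 : (1 + a) ^ N ≤ Real.exp (N * a) := by
    rw [Real.exp_nat_mul]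
    gcongr
    linarith [Real.add_one_le_exp a]
  gcongr
  rw [inv_pow]
  refine inv_anti₀ (by positivity) ?_
  set l := √(√(1 + X)) with hl
  have hl4 : l ^ 4 = 1 + X := by
    rw [show 4 = 2 * 2 from rfl, pow_mul, Real.sq_sqrt (Real.sqrt_nonneg _),
      Real.sq_sqrt (by linarith)]
  have hl1 : 1 ≤ l := Real.one_le_sqrt.2 (Real.one_le_sqrt.2 (by linarith))
  have hn0 : (0 : ℝ) < n := by exact_mod_cast hn
  have hdiv : (N : ℝ) / 8 ≤ (N / 4 : ℕ) := by
    have : N ≤ 8 * (N / 4) := by omega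
    have : (N : ℝ) ≤ 8 * (N / 4 : ℕ) := by exact_mod_cast this
    linarith
  calc (1 + N * X / (8 * n)) ^ n ≤ (1 + (N / 4 : ℕ) * X / n) ^ n := by
        have : N * X / (8 * n) = (N / 8) * X / n := by field_simp
        rw [this]
        gcongr
    _ ≤ (1 + X) ^ (N / 4) := one_add_pow_le_one_add_pow hX hn (by omega)
    _ = l ^ (4 * (N / 4)) := by rw [← hl4, ← pow_mul]
    _ ≤ l ^ N := pow_le_pow_right₀ hl1 (Nat.mul_div_le N 4)

end RadialCharFun

/-! ### From a bound on transforms in the plane to asymptotic densities. -/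

/-- The scale r g is the inverse width of the transform. Dilating the plane by it costs (r g)⁻²,
which cancels the factor (r g)² of the hypothesis; 3 is the least integer power integrable in
dimension 2. -/
lemma hasAsymptoticPDF_of_norm_charFun_sub_le {Ω : ℕ → Type*} [∀ g, MeasurableSpace (Ω g)]
    (P : ∀ g, Measure (Ω g)) [∀ g, IsProbabilityMeasure (P g)] {X : ∀ g, Ω g → Plane}
    (hX : ∀ g, Measurable (X g)) {p : ℕ → Plane → ℝ} {Q : ℕ → Plane → ℂ} {e r : ℕ → ℝ} {C : ℝ}
    (h : ∀ᶠ g in atTop, 0 < r g ∧ Integrable (Q g) ∧ (∀ q, (p g q : ℂ) = invCharFun (Q g) q) ∧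
      ∀ t, ‖charFun ((P g).map (X g)) t - Q g t‖ ≤ C * (e g * r g ^ 2) * ((1 + r g * ‖t‖) ^ 3)⁻¹) :
    HasAsymptoticPDF P X p e := by
  refine ⟨((2 * Real.pi) ^ Module.finrank ℝ Plane)⁻¹ * (C * ∫ t : Plane, ((1 + ‖t‖) ^ 3)⁻¹), ?_⟩
  filter_upwards [h] with g ⟨hr, hQi, hp, hb⟩
  have hi₀ := integrable_inv_one_add_norm_pow (volume : Measure Plane) (n := 3) (by simp)
  have hn : ∀ t : Plane, ((1 + ‖r g • t‖) ^ 3)⁻¹ = ((1 + r g * ‖t‖) ^ 3)⁻¹ := fun t => by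
    rw [norm_smul, Real.norm_of_nonneg hr.le]
  have hi : Integrable fun t : Plane => C * (e g * r g ^ 2) * ((1 + r g * ‖t‖) ^ 3)⁻¹ := by
    simp only [← hn]
    exact (hi₀.comp_smul hr.ne').const_mul _
  have hDi : Integrable fun t => charFun ((P g).map (X g)) t - Q g t :=
    hi.mono' (measurable_charFun.aestronglyMeasurable.sub hQi.aestronglyMeasurable)
      (ae_of_all _ hb)
  obtain ⟨h1, h2⟩ := hasPDF_and_abs_sub_le (P g) (hX g) hQi hp hDi
  refine ⟨h1, ?_⟩
  filter_upwards [h2] with q hq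
  refine hq.trans ?_
  rw [mul_assoc]
  gcongr
  calc ∫ t, ‖charFun ((P g).map (X g)) t - Q g t‖
      ≤ ∫ t, C * (e g * r g ^ 2) * ((1 + r g * ‖t‖) ^ 3)⁻¹ := integral_mono hDi.norm hi hb
    _ = _ := by
      simp only [← hn]
      rw [integral_const_mul, Measure.integral_comp_smul volume (fun t => ((1 + ‖t‖) ^ 3)⁻¹),
        show Module.finrank ℝ Plane = 2 by simp, abs_of_pos (by positivity), smul_eq_mul]
      field_simp

/-! ### Expansion of the single-star characteristic function of the shear. -/

section ShearCharFun

variable {R m : ℝ} {x t : Plane}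

lemma angAvg_comp_dirComp_two_mul {F : Type*} [NormedAddCommGroup F] [NormedSpace ℝ F]
    {f : ℝ → F} (hf : Continuous f) (t : Plane) :
    angAvg (fun θ => f (dirComp t (2 * θ))) = angAvg fun θ => f (‖t‖ * Real.cos θ) := by
  have hc := continuous_dirComp t
  rw [← angAvg_comp_dirComp]
  exact angAvg_comp_two_mul (f := fun θ => f (dirComp t θ)) (by fun_prop)
    fun θ => by simp only; rw [dirComp_periodic t θ]

lemma dirComp_two_mul_add_pi (t : Plane) (θ : ℝ) :
    dirComp t (2 * (θ + Real.pi)) = dirComp t (2 * θ) := by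
  rw [mul_add, dirComp_periodic t]

lemma dirComp_two_mul_add_pi_div_two (t : Plane) (θ : ℝ) :
    dirComp t (2 * (θ + Real.pi / 2)) = -dirComp t (2 * θ) := by
  rw [← dirComp_add_pi]; congr 1; ring

lemma angAvg_abs_dirComp_two_mul (t : Plane) :
    angAvg (fun θ => |dirComp t (2 * θ)|) = 2 / Real.pi * ‖t‖ := by
  rw [angAvg_comp_dirComp_two_mul (f := fun s => |s|) continuous_abs]
  simp only [abs_mul, abs_norm]
  rw [angAvg_const_mul, angAvg_abs_cos, mul_comm]

lemma angAvg_dirComp_two_mul_sq (t : Plane) :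
    angAvg (fun θ => dirComp t (2 * θ) ^ 2) = ‖t‖ ^ 2 / 2 := by
  rw [← angAvg_dirComp_sq, angAvg_comp_dirComp_two_mul (f := fun s => s ^ 2) (by fun_prop),
    angAvg_comp_dirComp (fun s => s ^ 2)]

lemma dirComp_two_mul_periodic (t : Plane) :
    Function.Periodic (fun θ => dirComp t (2 * θ)) (2 * Real.pi) := by
  intro θ
  simp only
  rw [mul_add, mul_comm 2 (2 * Real.pi)]
  have h := (dirComp_periodic t).nat_mul 2 (2 * θ)
  rw [mul_comm]
  push_cast at h
  rw [mul_comm θ 2, mul_comm (2 * Real.pi) 2]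
  exact h

/-- Two pairings: opposite directions remove the square roots in the chords, and a quarter turn,
under which `dirComp t (2 * θ)` only changes sign, replaces 2d² by |x|². -/
lemma angAvg_dirComp_two_mul_sq_div (hx : ‖x‖ < R) :
    angAvg (fun θ => dirComp t (2 * θ) ^ 2 / chord R x θ ^ 2)
      = ‖t‖ ^ 2 / 2 * (R ^ 2 / (R ^ 2 - ‖x‖ ^ 2) ^ 2) := by
  have h1 := continuous_chord R x
  have h2 := continuous_dirComp t
  have h2' := continuous_dirComp x
  have hS : 0 < R ^ 2 - ‖x‖ ^ 2 := by nlinarith [norm_nonneg x]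
  have hc : Continuous fun θ => dirComp t (2 * θ) ^ 2 / chord R x θ ^ 2 :=
    Continuous.div (by fun_prop) (by fun_prop) fun θ => pow_ne_zero _ (chord_pos hx θ).ne'
  have hp : Function.Periodic (fun θ => dirComp t (2 * θ) ^ 2 / chord R x θ ^ 2)
      (2 * Real.pi) := by
    intro θ
    have := dirComp_two_mul_periodic t θ
    simp only at this ⊢
    rw [this, chord_periodic R x θ]
  have e1 : ∀ θ, (2 : ℝ)⁻¹ • (dirComp t (2 * θ) ^ 2 / chord R x θ ^ 2
      + dirComp t (2 * (θ + Real.pi)) ^ 2 / chord R x (θ + Real.pi) ^ 2)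
      = dirComp t (2 * θ) ^ 2 * (R ^ 2 - ‖x‖ ^ 2 + 2 * dirComp x θ ^ 2)
        / (R ^ 2 - ‖x‖ ^ 2) ^ 2 := by
    intro θ
    have p1 := chord_pos hx θ
    have p2 := chord_pos hx (θ + Real.pi)
    have e2 := chord_sq_add_chord_sq hx θ
    have e3 := chord_mul_chord hx θ
    rw [dirComp_two_mul_add_pi, smul_eq_mul, ← e3]
    field_simp
    linear_combination dirComp t (2 * θ) ^ 2 * (e2 - 2 * e3)
  rw [angAvg_eq_pair hc hp Real.pi]
  simp only [e1]
  have hc2 : Continuous fun θ => dirComp t (2 * θ) ^ 2 *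
      (R ^ 2 - ‖x‖ ^ 2 + 2 * dirComp x θ ^ 2) / (R ^ 2 - ‖x‖ ^ 2) ^ 2 := by fun_prop
  have hp2 : Function.Periodic (fun θ => dirComp t (2 * θ) ^ 2 *
      (R ^ 2 - ‖x‖ ^ 2 + 2 * dirComp x θ ^ 2) / (R ^ 2 - ‖x‖ ^ 2) ^ 2) (2 * Real.pi) := by
    intro θ
    have := dirComp_two_mul_periodic t θ
    simp only at this ⊢
    rw [this, dirComp_periodic x θ]
  have e4 : ∀ θ, (2 : ℝ)⁻¹ • (dirComp t (2 * θ) ^ 2 *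
      (R ^ 2 - ‖x‖ ^ 2 + 2 * dirComp x θ ^ 2) / (R ^ 2 - ‖x‖ ^ 2) ^ 2
      + dirComp t (2 * (θ + Real.pi / 2)) ^ 2 *
      (R ^ 2 - ‖x‖ ^ 2 + 2 * dirComp x (θ + Real.pi / 2) ^ 2) / (R ^ 2 - ‖x‖ ^ 2) ^ 2)
      = R ^ 2 / (R ^ 2 - ‖x‖ ^ 2) ^ 2 * dirComp t (2 * θ) ^ 2 := by
    intro θ
    have e5 := dirComp_sq_add_sq x θ
    rw [dirComp_two_mul_add_pi_div_two, smul_eq_mul]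
    generalize dirComp x (θ + Real.pi / 2) = d at *
    field_simp
    linear_combination 2 * dirComp t (2 * θ) ^ 2 * e5
  rw [angAvg_eq_pair hc2 hp2 (Real.pi / 2)]
  simp only [e4]
  rw [angAvg_const_mul, angAvg_dirComp_two_mul_sq, mul_comm]

/-- For opposite directions the logarithms add up to that of the power of the point, which is
constant in θ; what is left is odd under a quarter turn. -/
lemma angAvg_dirComp_two_mul_mul_log (hx : ‖x‖ < R) (hR : 0 < R) :
    angAvg (fun θ => dirComp t (2 * θ) * Real.log (chord R x θ / R)) = 0 := by
  have h1 := continuous_chord R x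
  have h2 := continuous_dirComp t
  have hl : Continuous fun θ => Real.log (chord R x θ / R) :=
    Continuous.log (by fun_prop) fun θ => (div_pos (chord_pos hx θ) hR).ne'
  have hp : Function.Periodic (fun θ => dirComp t (2 * θ) * Real.log (chord R x θ / R))
      (2 * Real.pi) := by
    intro θ
    have := dirComp_two_mul_periodic t θ
    simp only at this ⊢
    rw [this, chord_periodic R x θ]
  have e1 : ∀ θ, (2 : ℝ)⁻¹ • (dirComp t (2 * θ) * Real.log (chord R x θ / R)
      + dirComp t (2 * (θ + Real.pi)) * Real.log (chord R x (θ + Real.pi) / R))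
      = Real.log ((R ^ 2 - ‖x‖ ^ 2) / R ^ 2) / 2 * dirComp t (2 * θ) := by
    intro θ
    have p1 := chord_pos hx θ
    have p2 := chord_pos hx (θ + Real.pi)
    rw [dirComp_two_mul_add_pi, smul_eq_mul, ← chord_mul_chord hx θ, sq, mul_div_mul_comm,
      Real.log_mul (div_pos p1 hR).ne' (div_pos p2 hR).ne']
    ring
  rw [angAvg_eq_pair (by fun_prop) hp Real.pi]
  simp only [e1]
  rw [angAvg_const_mul, angAvg_eq_zero_of_antiperiodic (by fun_prop) (dirComp_two_mul_periodic t)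
    (dirComp_two_mul_add_pi_div_two t), mul_zero]

/-- The leading term, obtained by replacing both chords by their geometric mean, is odd under a
quarter turn. The deviation of opposite chords from it provides the factor |x|². -/
lemma abs_angAvg_dirComp_two_mul_cube_div_le (hx : ‖x‖ ≤ R / 2) (hR : 0 < R) :
    |angAvg (fun θ => dirComp t (2 * θ) ^ 3 / chord R x θ ^ 4)|
      ≤ 32 * ‖x‖ ^ 2 * ‖t‖ ^ 3 * (R ^ 6)⁻¹ := by
  have hx' : ‖x‖ < R := by linarith
  have h1 := continuous_chord R x
  have h2 := continuous_dirComp t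
  have h2' := continuous_dirComp x
  set S := R ^ 2 - ‖x‖ ^ 2 with hSd
  have hS : 3 / 4 * R ^ 2 ≤ S := by nlinarith [norm_nonneg x]
  have hS0 : 0 < S := by nlinarith
  have hc : Continuous fun θ => dirComp t (2 * θ) ^ 3 / chord R x θ ^ 4 :=
    Continuous.div (by fun_prop) (by fun_prop) fun θ => pow_ne_zero _ (chord_pos hx' θ).ne'
  have hp : Function.Periodic (fun θ => dirComp t (2 * θ) ^ 3 / chord R x θ ^ 4)
      (2 * Real.pi) := by
    intro θ
    have := dirComp_two_mul_periodic t θ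
    simp only at this ⊢
    rw [this, chord_periodic R x θ]
  have e1 : ∀ θ, (2 : ℝ)⁻¹ • (dirComp t (2 * θ) ^ 3 / chord R x θ ^ 4
      + dirComp t (2 * (θ + Real.pi)) ^ 3 / chord R x (θ + Real.pi) ^ 4)
      = (S ^ 2)⁻¹ * dirComp t (2 * θ) ^ 3
        + dirComp t (2 * θ) ^ 3 * (8 * dirComp x θ ^ 2 * (S + dirComp x θ ^ 2)) / S ^ 4 := by
    intro θ
    have p1 := chord_pos hx' θ
    have p2 := chord_pos hx' (θ + Real.pi)
    have e2 := chord_sq_add_chord_sq hx' θ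
    have e3 := chord_mul_chord hx' θ
    rw [← hSd] at e3
    have e2' : chord R x θ ^ 2 + chord R x (θ + Real.pi) ^ 2 = 2 * S + 4 * dirComp x θ ^ 2 := by
      rw [e2]; ring
    have e4 : chord R x θ ^ 4 + chord R x (θ + Real.pi) ^ 4
        = 2 * S ^ 2 + 16 * dirComp x θ ^ 2 * (S + dirComp x θ ^ 2) := by
      have : chord R x θ ^ 4 + chord R x (θ + Real.pi) ^ 4
        = (chord R x θ ^ 2 + chord R x (θ + Real.pi) ^ 2) ^ 2
          - 2 * (chord R x θ * chord R x (θ + Real.pi)) ^ 2 := by ring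
      rw [this, e2', e3]; ring
    have e5 : (chord R x θ ^ 4)⁻¹ + (chord R x (θ + Real.pi) ^ 4)⁻¹
        = (chord R x θ ^ 4 + chord R x (θ + Real.pi) ^ 4) / S ^ 4 := by
      rw [← e3]; field_simp; ring
    rw [dirComp_two_mul_add_pi, smul_eq_mul, div_eq_mul_inv, div_eq_mul_inv, ← mul_add, e5, e4]
    field_simp
    ring
  have ha3 : angAvg (fun θ => dirComp t (2 * θ) ^ 3) = 0 := by
    refine angAvg_eq_zero_of_antiperiodic (a := Real.pi / 2) (by fun_prop) (fun θ => ?_) fun θ => ?_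
    · have := dirComp_two_mul_periodic t θ
      simp only at this ⊢
      rw [this]
    · rw [dirComp_two_mul_add_pi_div_two]; ring
  rw [angAvg_eq_pair hc hp Real.pi]
  simp only [e1]
  rw [angAvg_add (by fun_prop) (by fun_prop), angAvg_const_mul, ha3, mul_zero, zero_add,
    ← Real.norm_eq_abs]
  refine norm_angAvg_le_const (by fun_prop) fun θ => ?_
  have hb := abs_dirComp_le t (2 * θ)
  have hd := dirComp_sq_le x θ
  have hS4 : (3 / 4 * R ^ 2) ^ 4 ≤ S ^ 4 := by gcongr
  rw [norm_div, norm_mul, norm_pow, Real.norm_eq_abs, Real.norm_of_nonneg (by positivity),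
    Real.norm_of_nonneg (by positivity)]
  calc |dirComp t (2 * θ)| ^ 3 * (8 * dirComp x θ ^ 2 * (S + dirComp x θ ^ 2)) / S ^ 4
      ≤ ‖t‖ ^ 3 * (8 * ‖x‖ ^ 2 * (S + ‖x‖ ^ 2)) / (3 / 4 * R ^ 2) ^ 4 := by gcongr
    _ = (8 * 256 / 81) * (‖x‖ ^ 2 * ‖t‖ ^ 3 * (R ^ 6)⁻¹) := by
      rw [hSd, sub_add_cancel]; field_simp; ring
    _ ≤ 32 * (‖x‖ ^ 2 * ‖t‖ ^ 3 * (R ^ 6)⁻¹) := by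
      gcongr; norm_num
    _ = _ := by ring

/-- The pointwise expansion of index 1 is averaged. The real part yields the displayed terms, and
the imaginary part averages to an error of the final order. -/
lemma norm_radialCharFun_shear_sub_le (hx : ‖x‖ ≤ R / 2) (hR : 0 < R) (hm : 0 < m) :
    ‖radialCharFun 2 1 m R x t
        - ((1 - m * ‖t‖ / R ^ 2 + (m * ‖t‖) ^ 2 / (4 * (R ^ 2 - ‖x‖ ^ 2) ^ 2) : ℝ) : ℂ)‖
      ≤ (3 * ‖x‖ ^ 2 * (m * ‖t‖) ^ 3 + 3 * (m * ‖t‖) ^ 4) * (R ^ 8)⁻¹ := by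
  have hx' : ‖x‖ < R := by linarith
  have h1 := continuous_chord R x
  have h2 := continuous_dirComp t
  have hρ0 : ∀ θ, 0 < chord R x θ := fun θ => chord_pos hx' θ
  have hpi := Real.pi_pos
  set D : ℝ → ℝ := fun θ => dirComp t (2 * θ) with hD
  have hDc : Continuous D := by fun_prop
  set ρ := chord R x with hρ
  have hl : Continuous fun θ => Real.log (ρ θ / R) :=
    Continuous.log (by fun_prop) fun θ => (div_pos (hρ0 θ) hR).ne'
  have hc2 : Continuous fun θ => D θ ^ 2 / ρ θ ^ 2 :=
    Continuous.div (by fun_prop) (by fun_prop) fun θ => pow_ne_zero _ (hρ0 θ).ne'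
  have hc4 : Continuous fun θ => D θ ^ 3 / ρ θ ^ 4 :=
    Continuous.div (by fun_prop) (by fun_prop) fun θ => pow_ne_zero _ (hρ0 θ).ne'
  -- The imaginary part with the chord replaced by R is odd under a quarter turn and averages to
  -- zero exactly. Its singular A log|A| behaviour thus never has to be expanded; only the
  -- dependence on the radius does.
  set im₀ : ℝ → ℝ := fun θ => (paretoCharFun 1 (m * D θ / R ^ 2)).im with him
  have him_c : Continuous im₀ :=
    continuous_im.comp ((continuous_paretoCharFun le_rfl).comp (by fun_prop))
  set G : ℝ → ℝ := fun θ => (R ^ 2)⁻¹ * ρ θ ^ 2 - Real.pi / 2 * m / R ^ 2 * |D θ|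
    + m ^ 2 / (2 * R ^ 2) * (D θ ^ 2 / ρ θ ^ 2) with hG
  set H : ℝ → ℝ := fun θ => im₀ θ + 2 * m / R ^ 2 * (D θ * Real.log (ρ θ / R))
    - m ^ 3 / (12 * R ^ 6) * D θ ^ 3 + m ^ 3 / (12 * R ^ 2) * (D θ ^ 3 / ρ θ ^ 4) with hH
  have hGc : Continuous G := by fun_prop
  have hHc : Continuous H := by fun_prop
  have hGa : angAvg G = 1 - m * ‖t‖ / R ^ 2 + (m * ‖t‖) ^ 2 / (4 * (R ^ 2 - ‖x‖ ^ 2) ^ 2) := by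
    have hS0 : 0 < R ^ 2 - ‖x‖ ^ 2 := by nlinarith [norm_nonneg x]
    simp only [hG]
    rw [angAvg_add (by fun_prop) (by fun_prop), angAvg_sub (by fun_prop) (by fun_prop),
      angAvg_const_mul, angAvg_const_mul, angAvg_const_mul, angAvg_chord_sq hx',
      angAvg_abs_dirComp_two_mul, angAvg_dirComp_two_mul_sq_div hx']
    field_simp
    ring
  have hHa : |angAvg H| ≤ 3 * ‖x‖ ^ 2 * (m * ‖t‖) ^ 3 * (R ^ 8)⁻¹ := by
    have z1 : angAvg im₀ = 0 := by
      refine angAvg_eq_zero_of_antiperiodic (a := Real.pi / 2) him_c (fun θ => ?_) fun θ => ?_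
      · have := dirComp_two_mul_periodic t θ
        simp only [him, hD] at this ⊢
        rw [this]
      · simp only [him, hD]
        rw [dirComp_two_mul_add_pi_div_two, mul_neg, neg_div, im_paretoCharFun_neg le_rfl]
    have z3 : angAvg (fun θ => D θ ^ 3) = 0 := by
      refine angAvg_eq_zero_of_antiperiodic (a := Real.pi / 2) (by fun_prop) (fun θ => ?_)
        fun θ => ?_
      · have := dirComp_two_mul_periodic t θ
        simp only [hD] at this ⊢
        rw [this]
      · simp only [hD]
        rw [dirComp_two_mul_add_pi_div_two]; ring
    simp only [hH]
    rw [angAvg_add (by fun_prop) (by fun_prop), angAvg_sub (by fun_prop) (by fun_prop),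
      angAvg_add (by fun_prop) (by fun_prop), angAvg_const_mul, angAvg_const_mul, angAvg_const_mul,
      z1, z3, angAvg_dirComp_two_mul_mul_log hx' hR]
    simp only [mul_zero, add_zero, sub_zero, zero_add]
    rw [abs_mul, abs_of_pos (by positivity)]
    calc _ ≤ m ^ 3 / (12 * R ^ 2) * (32 * ‖x‖ ^ 2 * ‖t‖ ^ 3 * (R ^ 6)⁻¹) := by
          gcongr; exact abs_angAvg_dirComp_two_mul_cube_div_le hx hR
      _ = 32 / 12 * (‖x‖ ^ 2 * (m * ‖t‖) ^ 3 * (R ^ 8)⁻¹) := by field_simp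
      _ ≤ 3 * (‖x‖ ^ 2 * (m * ‖t‖) ^ 3 * (R ^ 8)⁻¹) := by gcongr; norm_num
      _ = _ := by ring
  have hGH : angAvg (fun θ => (G θ : ℂ) + I * (H θ : ℂ)) = ((angAvg G : ℝ) : ℂ) + I * ((angAvg H : ℝ) : ℂ) := by
    rw [angAvg_add (by fun_prop) (by fun_prop), angAvg_const_mul_complex, angAvg_ofReal,
      angAvg_ofReal]
  have hpt : ∀ θ, ‖(((ρ θ / R) ^ 2 : ℝ) : ℂ) *
      paretoCharFun 1 (m * dirComp t ((2 : ℕ) * θ) / ρ θ ^ 2) - ((G θ : ℂ) + I * (H θ : ℂ))‖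
      ≤ 3 * (m * ‖t‖) ^ 4 * (R ^ 8)⁻¹ := by
    intro θ
    have p0 := hρ0 θ
    have hρR : R / 2 ≤ ρ θ := by linarith [le_chord hx' θ]
    have hDb : |D θ| ≤ ‖t‖ := abs_dirComp_le t (2 * θ)
    set B := m * D θ with hB
    have hB4 : B ^ 4 ≤ (m * ‖t‖) ^ 4 := by
      rw [← Even.pow_abs (by decide : Even 4) B, hB, abs_mul, abs_of_pos hm]
      gcongr
    have a1 := abs_re_paretoCharFun_one_sub_le (B / ρ θ ^ 2)
    have a2 := abs_sq_mul_im_paretoCharFun_sub_le hR hρR B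
    have e0 : m * dirComp t ((2 : ℕ) * θ) / ρ θ ^ 2 = B / ρ θ ^ 2 := by simp [hB, hD]
    rw [e0]
    set E := paretoCharFun 1 (B / ρ θ ^ 2) with hE
    have e1 : (((ρ θ / R) ^ 2 : ℝ) : ℂ) * E - ((G θ : ℂ) + I * (H θ : ℂ))
        = (((ρ θ / R) ^ 2 * E.re - G θ : ℝ) : ℂ) + (((ρ θ / R) ^ 2 * E.im - H θ : ℝ) : ℂ) * I := by
      conv_lhs => rw [← re_add_im E]
      push_cast; ring
    have e2 : (ρ θ / R) ^ 2 * E.re - G θ = (ρ θ / R) ^ 2 *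
        (E.re - (1 - Real.pi / 2 * |B / ρ θ ^ 2| + (B / ρ θ ^ 2) ^ 2 / 2)) := by
      simp only [hG]
      rw [abs_div, abs_of_pos (pow_pos p0 2), hB, abs_mul, abs_of_pos hm]
      field_simp
    have e3 : (ρ θ / R) ^ 2 * E.im - H θ = (R ^ 2)⁻¹ * (ρ θ ^ 2 * E.im
        - R ^ 2 * (paretoCharFun 1 (B / R ^ 2)).im
        - (2 * B * Real.log (ρ θ / R) - B ^ 3 / 12 * ((R ^ 4)⁻¹ - (ρ θ ^ 4)⁻¹))) := by
      simp only [hH, him]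
      rw [hB]
      field_simp
      ring
    have b1 : |(ρ θ / R) ^ 2 * E.re - G θ| ≤ B ^ 4 * (R ^ 8)⁻¹ := by
      rw [e2, abs_mul, abs_of_pos (by positivity)]
      calc _ ≤ (ρ θ / R) ^ 2 * ((B / ρ θ ^ 2) ^ 4 / 72) := by gcongr
        _ = B ^ 4 / (72 * R ^ 2 * ρ θ ^ 6) := by field_simp
        _ ≤ B ^ 4 / (72 * R ^ 2 * (R / 2) ^ 6) := by gcongr
        _ = 64 / 72 * (B ^ 4 * (R ^ 8)⁻¹) := by field_simp; norm_num
        _ ≤ 1 * (B ^ 4 * (R ^ 8)⁻¹) := by gcongr; norm_num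
        _ = _ := one_mul _
    have b2 : |(ρ θ / R) ^ 2 * E.im - H θ| ≤ 2 * (B ^ 4 * (R ^ 8)⁻¹) := by
      rw [e3, abs_mul, abs_of_pos (by positivity)]
      calc _ ≤ (R ^ 2)⁻¹ * (2 * (B ^ 4 * (R ^ 6)⁻¹)) := by gcongr
        _ = _ := by field_simp
    rw [e1]
    refine (norm_add_le _ _).trans ?_
    rw [norm_mul, norm_I, mul_one, norm_real, norm_real, Real.norm_eq_abs, Real.norm_eq_abs]
    calc _ ≤ 3 * (B ^ 4 * (R ^ 8)⁻¹) := by linarith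
      _ ≤ 3 * ((m * ‖t‖) ^ 4 * (R ^ 8)⁻¹) := by gcongr
      _ = _ := by ring
  have hcr := continuous_radial (k := 2) (m := m) (t := t) (p := 1) le_rfl hx'
  have hmain := norm_angAvg_le_const (f := fun θ => (((ρ θ / R) ^ 2 : ℝ) : ℂ) *
      paretoCharFun 1 (m * dirComp t ((2 : ℕ) * θ) / ρ θ ^ 2) - ((G θ : ℂ) + I * (H θ : ℂ)))
      (hcr.sub (by fun_prop)) hpt
  rw [angAvg_sub hcr (by fun_prop), hGH, hGa] at hmain
  have hr : angAvg (fun θ => (((ρ θ / R) ^ 2 : ℝ) : ℂ) *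
      paretoCharFun 1 (m * dirComp t ((2 : ℕ) * θ) / ρ θ ^ 2)) = radialCharFun 2 1 m R x t := rfl
  rw [hr] at hmain
  set v : ℂ := ((1 - m * ‖t‖ / R ^ 2 + (m * ‖t‖) ^ 2 / (4 * (R ^ 2 - ‖x‖ ^ 2) ^ 2) : ℝ) : ℂ)
  have e : radialCharFun 2 1 m R x t - v
      = (radialCharFun 2 1 m R x t - (v + I * ((angAvg H : ℝ) : ℂ))) + I * ((angAvg H : ℝ) : ℂ) := by ring
  rw [e]
  refine (norm_add_le _ _).trans ?_
  rw [norm_mul I, norm_I, one_mul, norm_real, Real.norm_eq_abs]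
  linarith

end ShearCharFun

/-! ### The g-th power of the shear characteristic function. -/

section ShearComparison

lemma abs_exp_neg_sub_sum_le (n : ℕ) {z : ℝ} (hz : 0 ≤ z) :
    |Real.exp (-z) - ∑ k ∈ Finset.range n, (-z) ^ k / (k.factorial : ℝ)| ≤ z ^ n / n.factorial := by
  have h := norm_exp_sub_sum_le_of_re_nonpos n (z := ((-z : ℝ) : ℂ)) (by simpa using hz)
  rw [norm_real, Real.norm_eq_abs, abs_neg, abs_of_nonneg hz] at h
  rw [← Real.norm_eq_abs, ← norm_real]
  exact_mod_cast h

lemma abs_inv_one_sub_sq_sub_le {y : ℝ} (hy : y ≤ 1 / 4) :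
    |((1 - y) ^ 2)⁻¹ - 1 - 2 * y| ≤ 6 * y ^ 2 := by
  have h1 : 0 < 1 - y := by linarith
  have e : ((1 - y) ^ 2)⁻¹ - 1 - 2 * y = y ^ 2 * (3 - 2 * y) / (1 - y) ^ 2 := by
    field_simp; ring
  rw [e, abs_of_nonneg (by have : 0 ≤ 3 - 2 * y := by linarith
                           positivity), div_le_iff₀ (by positivity)]
  have : 3 - 2 * y ≤ 6 * (1 - y) ^ 2 := by nlinarith
  nlinarith [sq_nonneg y]

variable {ν T ε : ℝ}

/-- The coefficient of `ε³` in the cumulant expansion of the characteristic function of the shear. -/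
def shearCubic (ν T : ℝ) : ℝ := T ^ 3 / 12 - ν * T ^ 2 / 2

/-- One majorant Y = (1 + ν)(1 + T)³ for all the monomials that occur, so that every error below
becomes a power of Y. -/
lemma shear_powers_le (hν : 0 ≤ ν) (hT : 0 ≤ T) :
    1 ≤ (1 + ν) * (1 + T) ^ 3 ∧ T ≤ (1 + ν) * (1 + T) ^ 3 ∧ T ^ 2 ≤ (1 + ν) * (1 + T) ^ 3 ∧
      T ^ 3 ≤ (1 + ν) * (1 + T) ^ 3 ∧ ν * T ^ 2 ≤ (1 + ν) * (1 + T) ^ 3 ∧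
      ν * T ^ 3 ≤ (1 + ν) * (1 + T) ^ 3 ∧ |shearCubic ν T| ≤ (1 + ν) * (1 + T) ^ 3 := by
  have h2 : 0 ≤ T ^ 2 := by positivity
  have h3 : 0 ≤ T ^ 3 := by positivity
  have h4 : 0 ≤ ν * T := by positivity
  have h5 : 0 ≤ ν * T ^ 2 := by positivity
  have h6 : 0 ≤ ν * T ^ 3 := by positivity
  have e : (1 + ν) * (1 + T) ^ 3 = 1 + 3 * T + 3 * T ^ 2 + T ^ 3 + ν + 3 * (ν * T)
      + 3 * (ν * T ^ 2) + ν * T ^ 3 := by ring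
  rw [e, abs_le, shearCubic]
  refine ⟨?_, ?_, ?_, ?_, ?_, ?_, ?_, ?_⟩ <;> linarith

-- `shearCubic` is chosen to match the order ε³ of the logarithm: T³/12 compensates the products of
-- lower terms, and -νT²/2 comes from 1/(1 - νε)² = 1 + 2νε + O(ε²).
set_option maxHeartbeats 400000 in
lemma abs_shear_factor_sub_exp_le (hν : 0 ≤ ν) (hT : 0 ≤ T) (hε : 0 ≤ ε) (hε1 : ε ≤ 1)
    (hνε : ν * ε ≤ 1 / 4) :
    |1 - ε * T + ε ^ 2 * T ^ 2 / (4 * (1 - ν * ε) ^ 2)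
        - Real.exp (-(ε * T + ε ^ 2 * T ^ 2 / 4 + ε ^ 3 * shearCubic ν T))|
      ≤ 6 * ε ^ 4 * ((1 + ν) * (1 + T) ^ 3) ^ 4 := by
  obtain ⟨y1, y2, y3, y4, y5, y6, y7⟩ := shear_powers_le hν hT
  set Y := (1 + ν) * (1 + T) ^ 3 with hY
  have hY0 : 0 ≤ Y := by linarith
  set c := shearCubic ν T with hc
  set b := T ^ 2 / 4 + ε * c with hb
  have hc0 : c = T ^ 3 / 12 - ν * T ^ 2 / 2 := rfl
  have hbnn : 0 ≤ b := by
    have : b = T ^ 2 / 4 * (1 - 2 * (ν * ε)) + ε * T ^ 3 / 12 := by rw [hb, hc0]; ring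
    rw [this]
    have : 0 ≤ 1 - 2 * (ν * ε) := by linarith
    positivity
  have hbY : b ≤ Y := by
    have : b ≤ T ^ 2 / 4 + ε * T ^ 3 / 12 := by
      rw [hb, hc0]
      have : 0 ≤ ε * (ν * T ^ 2 / 2) := by positivity
      linarith
    have : ε * T ^ 3 ≤ T ^ 3 := mul_le_of_le_one_left (by positivity) hε1
    linarith
  set z := ε * T + ε ^ 2 * T ^ 2 / 4 + ε ^ 3 * c with hz
  have hzb : z = ε * T + ε ^ 2 * b := by rw [hz, hb]; ring
  have hz0 : 0 ≤ z := by rw [hzb]; positivity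
  have hz2 : z ≤ 2 * (ε * Y) := by
    rw [hzb]
    have h1 : ε * T ≤ ε * Y := by gcongr
    have h2 : ε ^ 2 * b ≤ ε * Y := by
      have : ε ^ 2 ≤ ε := by nlinarith
      gcongr
    linarith
  have hexp := abs_exp_neg_sub_sum_le 4 hz0
  have hsum : ∑ k ∈ Finset.range 4, (-z) ^ k / (k.factorial : ℝ)
      = 1 - z + z ^ 2 / 2 - z ^ 3 / 6 := by
    simp [Finset.sum_range_succ, Nat.factorial]; ring
  rw [hsum] at hexp
  have hz4 : z ^ 4 / (Nat.factorial 4 : ℕ) ≤ ε ^ 4 * Y ^ 4 := by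
    calc z ^ 4 / (Nat.factorial 4 : ℕ) ≤ (2 * (ε * Y)) ^ 4 / (Nat.factorial 4 : ℕ) := by gcongr
      _ = 2 / 3 * (ε ^ 4 * Y ^ 4) := by norm_num [Nat.factorial]; ring
      _ ≤ 1 * (ε ^ 4 * Y ^ 4) := by gcongr; norm_num
      _ = _ := one_mul _
  have hpoly : 1 - ε * T + ε ^ 2 * T ^ 2 / (4 * (1 - ν * ε) ^ 2) - (1 - z + z ^ 2 / 2 - z ^ 3 / 6)
      = ε ^ 2 * T ^ 2 / 4 * (((1 - ν * ε) ^ 2)⁻¹ - 1 - 2 * (ν * ε))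
        - ε ^ 4 * (b ^ 2 / 2 + T * c - (3 * T ^ 2 * b + 3 * ε * T * b ^ 2 + ε ^ 2 * b ^ 3) / 6) := by
    have hne : 1 - ν * ε ≠ 0 := by linarith
    have e1 : ε ^ 2 * T ^ 2 / (4 * (1 - ν * ε) ^ 2) = ε ^ 2 * T ^ 2 / 4 * ((1 - ν * ε) ^ 2)⁻¹ := by
      field_simp
    rw [e1, hzb]
    generalize ((1 - ν * ε) ^ 2)⁻¹ = w
    have hb' : b = T ^ 2 / 4 + ε * (T ^ 3 / 12 - ν * T ^ 2 / 2) := hb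
    rw [hc0, hb']
    ring
  have hA : |ε ^ 2 * T ^ 2 / 4 * (((1 - ν * ε) ^ 2)⁻¹ - 1 - 2 * (ν * ε))| ≤ 2 * ε ^ 4 * Y ^ 4 := by
    rw [abs_mul, abs_of_nonneg (by positivity)]
    calc _ ≤ ε ^ 2 * T ^ 2 / 4 * (6 * (ν * ε) ^ 2) := by
          gcongr; exact abs_inv_one_sub_sq_sub_le hνε
      _ = 6 / 4 * ε ^ 4 * (ν * (ν * T ^ 2)) := by ring
      _ ≤ 2 * ε ^ 4 * Y ^ 4 := by
        have hνY : ν ≤ Y := by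
          have : 1 ≤ (1 + T) ^ 3 := one_le_pow₀ (by linarith)
          calc ν ≤ (1 + ν) * 1 := by linarith
            _ ≤ Y := by rw [hY]; gcongr
        have : ν * (ν * T ^ 2) ≤ Y * Y := by gcongr
        have : Y * Y ≤ Y ^ 4 := by
          rw [← sq]; exact pow_le_pow_right₀ y1 (by norm_num)
        gcongr
        · norm_num
        · linarith
  have hB : |ε ^ 4 * (b ^ 2 / 2 + T * c - (3 * T ^ 2 * b + 3 * ε * T * b ^ 2 + ε ^ 2 * b ^ 3) / 6)|
      ≤ 3 * ε ^ 4 * Y ^ 4 := by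
    rw [abs_mul, abs_of_nonneg (by positivity), show 3 * ε ^ 4 * Y ^ 4 = ε ^ 4 * (3 * Y ^ 4) by ring]
    gcongr
    have q1 : b ^ 2 ≤ Y ^ 2 := by gcongr
    have q2 : |T * c| ≤ Y ^ 2 := by
      rw [abs_mul, abs_of_nonneg hT, sq]; gcongr
    have q3 : T ^ 2 * b ≤ Y ^ 2 := by rw [sq Y]; gcongr
    have q4 : ε * T * b ^ 2 ≤ Y ^ 3 := by
      calc ε * T * b ^ 2 ≤ 1 * Y * Y ^ 2 := by gcongr
        _ = _ := by ring
    have q5 : ε ^ 2 * b ^ 3 ≤ Y ^ 3 := by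
      calc ε ^ 2 * b ^ 3 ≤ 1 * Y ^ 3 := by gcongr; exact pow_le_one₀ hε hε1
        _ = _ := by ring
    have q6 : Y ^ 2 ≤ Y ^ 4 := pow_le_pow_right₀ y1 (by norm_num)
    have q7 : Y ^ 3 ≤ Y ^ 4 := pow_le_pow_right₀ y1 (by norm_num)
    have p1 : 0 ≤ b ^ 2 := by positivity
    have p3 : 0 ≤ T ^ 2 * b := by positivity
    have p4 : 0 ≤ ε * T * b ^ 2 := by positivity
    have p5 : 0 ≤ ε ^ 2 * b ^ 3 := by positivity
    rw [abs_le] at q2 ⊢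
    constructor <;> linarith [q2.1, q2.2]
  have key : 1 - ε * T + ε ^ 2 * T ^ 2 / (4 * (1 - ν * ε) ^ 2) - Real.exp (-z)
      = (1 - ε * T + ε ^ 2 * T ^ 2 / (4 * (1 - ν * ε) ^ 2) - (1 - z + z ^ 2 / 2 - z ^ 3 / 6))
        - (Real.exp (-z) - (1 - z + z ^ 2 / 2 - z ^ 3 / 6)) := by ring
  rw [key, hpoly]
  refine (abs_sub _ _).trans ((add_le_add (abs_sub _ _) le_rfl).trans ?_)
  linarith

/-- After the g-th power each order of ε drops by one; the corrections to T are small, so their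
exponential is expanded to second order while exp(-T) is kept. -/
lemma abs_exp_neg_sub_shear_poly_le (hν : 0 ≤ ν) (hT : 0 ≤ T) (hε : 0 ≤ ε) (hε1 : ε ≤ 1)
    (hνε : ν * ε ≤ 1 / 4) :
    |Real.exp (-(T + ε * T ^ 2 / 4 + ε ^ 2 * shearCubic ν T))
        - Real.exp (-T) * (1 - ε * T ^ 2 / 4 + ε ^ 2 * (T ^ 4 / 32 - shearCubic ν T))|
      ≤ 3 * ε ^ 3 * ((1 + ν) * (1 + T) ^ 3) ^ 4 * Real.exp (-T) := by
  obtain ⟨y1, y2, y3, y4, y5, y6, y7⟩ := shear_powers_le hν hT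
  set Y := (1 + ν) * (1 + T) ^ 3 with hY
  have hY0 : 0 ≤ Y := by linarith
  set c := shearCubic ν T with hc
  have hc0 : c = T ^ 3 / 12 - ν * T ^ 2 / 2 := rfl
  set y := ε * T ^ 2 / 4 + ε ^ 2 * c with hy
  have hynn : 0 ≤ y := by
    have : y = ε * T ^ 2 / 4 * (1 - 2 * (ν * ε)) + ε ^ 2 * T ^ 3 / 12 := by rw [hy, hc0]; ring
    rw [this]
    have : 0 ≤ 1 - 2 * (ν * ε) := by linarith
    positivity
  have hyY : y ≤ ε * Y := by
    have h1 : y ≤ ε * (T ^ 2 / 4 + ε * T ^ 3 / 12) := by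
      rw [hy, hc0]
      have : 0 ≤ ε ^ 2 * (ν * T ^ 2 / 2) := by positivity
      linarith
    refine h1.trans (mul_le_mul_of_nonneg_left ?_ hε)
    have : ε * T ^ 3 ≤ T ^ 3 := mul_le_of_le_one_left (by positivity) hε1
    linarith
  have hexp := abs_exp_neg_sub_sum_le 3 hynn
  have hsum : ∑ k ∈ Finset.range 3, (-y) ^ k / (k.factorial : ℝ) = 1 - y + y ^ 2 / 2 := by
    simp [Finset.sum_range_succ, Nat.factorial]; ring
  rw [hsum] at hexp
  have q6 : Y ^ 2 ≤ Y ^ 4 := pow_le_pow_right₀ y1 (by norm_num)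
  have q7 : Y ^ 3 ≤ Y ^ 4 := pow_le_pow_right₀ y1 (by norm_num)
  have h3 : y ^ 3 / (Nat.factorial 3 : ℕ) ≤ ε ^ 3 * Y ^ 4 := by
    calc y ^ 3 / (Nat.factorial 3 : ℕ) ≤ (ε * Y) ^ 3 / (Nat.factorial 3 : ℕ) := by gcongr
      _ ≤ (ε * Y) ^ 3 := div_le_self (by positivity) (by norm_num [Nat.factorial])
      _ = ε ^ 3 * Y ^ 3 := by ring
      _ ≤ _ := by gcongr
  have e1 : Real.exp (-(T + ε * T ^ 2 / 4 + ε ^ 2 * c))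
        - Real.exp (-T) * (1 - ε * T ^ 2 / 4 + ε ^ 2 * (T ^ 4 / 32 - c))
      = ((Real.exp (-y) - (1 - y + y ^ 2 / 2)) + ε ^ 3 * (T ^ 2 * c / 4 + ε * c ^ 2 / 2))
        * Real.exp (-T) := by
    rw [show -(T + ε * T ^ 2 / 4 + ε ^ 2 * c) = -y + -T by rw [hy]; ring, Real.exp_add]
    linear_combination (Real.exp (-T)) * (y / 2 + ε * T ^ 2 / 8 + ε ^ 2 * c / 2 - 1) * hy
  have h4 : |ε ^ 3 * (T ^ 2 * c / 4 + ε * c ^ 2 / 2)| ≤ ε ^ 3 * Y ^ 4 := by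
    rw [abs_mul, abs_of_nonneg (by positivity)]
    gcongr
    have p1 : |T ^ 2 * c| ≤ Y ^ 2 := by
      rw [abs_mul, abs_of_nonneg (by positivity), sq Y]; gcongr
    have p2 : ε * c ^ 2 ≤ Y ^ 2 := by
      calc ε * c ^ 2 ≤ 1 * |c| ^ 2 := by rw [sq_abs]; gcongr
        _ ≤ 1 * Y ^ 2 := by gcongr
        _ = _ := one_mul _
    have p3 : 0 ≤ ε * c ^ 2 := by positivity
    rw [abs_le] at p1 ⊢
    constructor <;> linarith [p1.1, p1.2]
  rw [e1, abs_mul, abs_of_pos (Real.exp_pos _)]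
  gcongr
  refine (abs_add_le _ _).trans ?_
  have : 0 ≤ ε ^ 3 * Y ^ 4 := by positivity
  linarith

/-- The asymptotic expansion of the characteristic function of the shear. -/
def shearCharFunApprox (m : ℝ) (x : Plane) (g : ℕ) (t : Plane) : ℝ :=
  Real.exp (-(kappaStar m * ‖t‖)) *
    (1 - (g : ℝ)⁻¹ * (kappaStar m * ‖t‖) ^ 2 / 4 + ((g : ℝ)⁻¹) ^ 2 *
      ((kappaStar m * ‖t‖) ^ 4 / 32 - shearCubic (Real.pi * ‖x‖ ^ 2) (kappaStar m * ‖t‖)))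

-- The intermediate object is exp(-z), z being the cubic exponent: telescoping compares φ^g with
-- exp(-gz), and the expansion in ε then gives the approximation. Both steps cost ε³Y⁴ times the
-- decay.
set_option maxHeartbeats 800000 in
lemma exists_norm_radialCharFun_pow_sub_shear_le {m : ℝ} (hm : 0 < m) (x : Plane) :
    ∃ C : ℝ, ∀ᶠ g : ℕ in atTop, ∀ t : Plane,
      ‖radialCharFun 2 1 m (discRadius g) x t ^ g - (shearCharFunApprox m x g t : ℂ)‖
        ≤ C * (g : ℝ) ^ (-3 : ℝ) * ((1 + ‖t‖) ^ 3)⁻¹ := by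
  obtain ⟨c, hc0, hc1, hdec⟩ := exists_norm_radialCharFun_le (k := 2) (p := 1) (by norm_num) hm
  have hpi := Real.pi_pos
  set κ := kappaStar m with hκ
  have hκ0 : 0 < κ := mul_pos hpi hm
  set ν := Real.pi * ‖x‖ ^ 2 with hν
  have hν0 : 0 ≤ ν := by positivity
  -- 960 = 4 · 2 · 8 · 15: from X = cTε/4, from g - 1 ≥ g/2, and from the denominator 8n of
  -- `inv_sqrt_sqrt_pow_le` with n = 15.
  set c' := c / 960 with hc'
  have hc'0 : 0 < c' := by positivity
  set d := min 1 (c' * κ) with hd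
  have hd0 : 0 < d := by positivity
  refine ⟨12 * (1 + ν) ^ 4 * (Real.exp ν + 1) * (c'⁻¹) ^ 12 * (d⁻¹) ^ 3, ?_⟩
  filter_upwards [eventually_ge_atTop 100, tendsto_discRadius.eventually_gt_atTop (2 * ‖x‖),
    tendsto_natCast_atTop_atTop.eventually_ge_atTop (4 * ν)] with g hg hR hgν t
  have hg0 : (0 : ℝ) < g := by have : 0 < g := by omega
                               exact_mod_cast this
  have hg1 : (1 : ℝ) ≤ g := by have : 1 ≤ g := by omega
                               exact_mod_cast this
  set R := discRadius g with hRd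
  have hR0 : 0 < R := by linarith [norm_nonneg x]
  have hx2 : ‖x‖ ≤ R / 2 := by linarith
  have hx1 : ‖x‖ < R := by linarith
  have hR2 : R ^ 2 = g / Real.pi := discRadius_sq g
  set ε := (g : ℝ)⁻¹ with hε
  have hε0 : 0 < ε := by positivity
  have hε1 : ε ≤ 1 := inv_le_one_of_one_le₀ hg1
  have hgε : g * ε = 1 := mul_inv_cancel₀ hg0.ne'
  have hνε : ν * ε ≤ 1 / 4 := by
    rw [hε, ← div_eq_mul_inv, div_le_iff₀ hg0]; linarith
  set T := κ * ‖t‖ with hT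
  have hT0 : 0 ≤ T := by positivity
  have hRε : (R ^ 2)⁻¹ = Real.pi * ε := by rw [hR2, hε]; field_simp
  set φ := radialCharFun 2 1 m R x t
  set z := ε * T + ε ^ 2 * T ^ 2 / 4 + ε ^ 3 * shearCubic ν T with hz
  obtain ⟨y1, y2, y3, y4, y5, y6, y7⟩ := shear_powers_le hν0 hT0
  set Y := (1 + ν) * (1 + T) ^ 3 with hY
  have hY0 : 0 ≤ Y := by linarith
  set X := c * (m * ‖t‖) ^ 1 / (4 * R ^ 2) with hX
  have hXe : X = c * T * ε / 4 := by
    rw [hX, hT, hκ, kappaStar, hR2, hε]; field_simp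
  have hX0 : 0 ≤ X := by rw [hXe]; positivity
  set M := (1 + (‖x‖ / R) ^ 2) * (√(√(1 + X)))⁻¹ with hM
  have hφM : ‖φ‖ ≤ M := hdec R x t hx1
  have hψM : ‖((Real.exp (-z) : ℝ) : ℂ)‖ ≤ M := by
    rw [norm_real, Real.norm_of_nonneg (Real.exp_pos _).le]
    have hzX : X ≤ z := by
      have h1 : z = ε * T + ε ^ 2 * T ^ 2 / 4 * (1 - 2 * (ν * ε)) + ε ^ 3 * T ^ 3 / 12 := by
        rw [hz, shearCubic]; ring
      have h2 : 0 ≤ 1 - 2 * (ν * ε) := by linarith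
      have h3 : 0 ≤ ε ^ 2 * T ^ 2 / 4 * (1 - 2 * (ν * ε)) := by positivity
      have h4 : 0 ≤ ε ^ 3 * T ^ 3 / 12 := by positivity
      have h5 : 0 ≤ T * ε := by positivity
      have h6 := mul_le_of_le_one_left h5 hc1
      rw [h1, hXe]
      linarith
    have hX1 : 1 ≤ 1 + X := by linarith
    have hs : √(√(1 + X)) ≤ 1 + X :=
      Real.sqrt_le_iff.2 ⟨by linarith, Real.sqrt_le_iff.2 ⟨by positivity, by
        calc 1 + X ≤ (1 + X) ^ 4 := le_self_pow₀ hX1 (by norm_num)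
          _ = _ := by ring⟩⟩
    calc Real.exp (-z) ≤ (1 + X)⁻¹ := by
          rw [Real.exp_neg]
          gcongr
          linarith [Real.add_one_le_exp z]
      _ ≤ 1 * (√(√(1 + X)))⁻¹ := by
        rw [one_mul]
        gcongr
      _ ≤ M := by
        rw [hM]
        gcongr
        linarith [sq_nonneg (‖x‖ / R)]
  have hd1 : ‖φ - ((Real.exp (-z) : ℝ) : ℂ)‖ ≤ 12 * ε ^ 4 * Y ^ 4 := by
    have h1 := norm_radialCharFun_shear_sub_le (t := t) hx2 hR0 hm
    have h2 := abs_shear_factor_sub_exp_le hν0 hT0 hε0.le hε1 hνε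
    have e1 : 1 - m * ‖t‖ / R ^ 2 + (m * ‖t‖) ^ 2 / (4 * (R ^ 2 - ‖x‖ ^ 2) ^ 2)
        = 1 - ε * T + ε ^ 2 * T ^ 2 / (4 * (1 - ν * ε) ^ 2) := by
      have e2 : R ^ 2 - ‖x‖ ^ 2 = (1 - ν * ε) / (Real.pi * ε) := by
        rw [hR2, hν, hε]; field_simp
      have : 1 - ν * ε ≠ 0 := by linarith
      rw [e2, div_eq_mul_inv _ (R ^ 2), hRε, hT, hκ, kappaStar]
      field_simp
    rw [e1] at h1
    have e3 : (3 * ‖x‖ ^ 2 * (m * ‖t‖) ^ 3 + 3 * (m * ‖t‖) ^ 4) * (R ^ 8)⁻¹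
        = (3 * (ν * T ^ 3) + 3 * (T * T ^ 3)) * ε ^ 4 := by
      have : (R ^ 8)⁻¹ = (Real.pi * ε) ^ 4 := by rw [← hRε]; ring
      rw [this, hT, hκ, kappaStar, hν]; ring
    have e4 : (3 * (ν * T ^ 3) + 3 * (T * T ^ 3)) * ε ^ 4 ≤ 6 * Y ^ 4 * ε ^ 4 := by
      gcongr
      have q1 : Y ≤ Y ^ 4 := le_self_pow₀ y1 (by norm_num)
      have q2 : Y ^ 2 ≤ Y ^ 4 := pow_le_pow_right₀ y1 (by norm_num)
      have q3 : T * T ^ 3 ≤ Y ^ 2 := by rw [sq]; gcongr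
      linarith
    have h4 := norm_sub_le_norm_sub_add_norm_sub φ
      ((1 - ε * T + ε ^ 2 * T ^ 2 / (4 * (1 - ν * ε) ^ 2) : ℝ) : ℂ) ((Real.exp (-z) : ℝ) : ℂ)
    rw [← ofReal_sub, norm_real, Real.norm_eq_abs] at h4
    linarith
  have hpow := norm_pow_sub_pow_le_mul hφM hψM g
  have hMg : M ^ (g - 1) ≤ Real.exp ν * ((1 + c' * T) ^ 15)⁻¹ := by
    refine (inv_sqrt_sqrt_pow_le hX0 (sq_nonneg _) (n := 15) (by norm_num)
      (by omega : 4 * 15 ≤ g - 1)).trans ?_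
    have hcast : ((g - 1 : ℕ) : ℝ) = g - 1 := by
      rw [Nat.cast_sub (by omega), Nat.cast_one]
    have hg2 : (2 : ℝ) ≤ g := by exact_mod_cast (by omega : 2 ≤ g)
    rw [hcast]
    gcongr
    · have : (‖x‖ / R) ^ 2 = ν * ε := by rw [div_pow, hR2, hν, hε]; field_simp
      rw [this]
      have : (g - 1) * (ν * ε) = ν * (g * ε) - ν * ε := by ring
      rw [this, hgε]
      have : 0 ≤ ν * ε := by positivity
      linarith
    · rw [hXe, hc']
      have h1 : (g : ℝ) / 2 ≤ g - 1 := by linarith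
      have h2 : (g - 1) * (c * T * ε / 4) / (8 * (15 : ℕ)) ≥ (g / 2) * (c * T * ε / 4) / (8 * 15) := by
        push_cast; gcongr
      have h3 : (g / 2) * (c * T * ε / 4) / (8 * 15) = c / 960 * T * (g * ε) := by ring
      rw [h3, hgε, mul_one] at h2
      exact h2
  have hexpT : Real.exp (-T) ≤ ((1 + c' * T) ^ 15)⁻¹ := by
    rw [Real.exp_neg]
    gcongr
    have : T = (15 : ℕ) * (T / 15) := by push_cast; ring
    rw [this, Real.exp_nat_mul]
    have h1 : c' * ((15 : ℕ) * (T / 15)) ≤ T / 15 := by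
      have := mul_le_of_le_one_left hT0 hc1
      rw [hc']; push_cast; linarith
    gcongr
    linarith [Real.add_one_le_exp (T / 15)]
  have hψg : ((Real.exp (-z) : ℝ) : ℂ) ^ g
      = ((Real.exp (-(T + ε * T ^ 2 / 4 + ε ^ 2 * shearCubic ν T)) : ℝ) : ℂ) := by
    rw [← ofReal_pow, ← Real.exp_nat_mul]
    congr 2
    rw [hz]
    linear_combination (-T - ε * T ^ 2 / 4 - ε ^ 2 * shearCubic ν T) * hgε
  have hQ := abs_exp_neg_sub_shear_poly_le hν0 hT0 hε0.le hε1 hνε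
  have htot := norm_sub_le_norm_sub_add_norm_sub (φ ^ g) (((Real.exp (-z) : ℝ) : ℂ) ^ g)
    (shearCharFunApprox m x g t : ℂ)
  -- 15 = 12 + 3: twelve powers absorb Y⁴ and three remain for integrability in the plane.
  set W := ((1 + c' * T) ^ 15)⁻¹ with hW
  have hW0 : 0 ≤ W := by positivity
  have h2 : ‖((Real.exp (-z) : ℝ) : ℂ) ^ g - (shearCharFunApprox m x g t : ℂ)‖
      ≤ 3 * ε ^ 3 * Y ^ 4 * W := by
    rw [hψg, ← ofReal_sub, norm_real, Real.norm_eq_abs]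
    refine hQ.trans ?_
    gcongr
  have h1 : ‖φ ^ g - ((Real.exp (-z) : ℝ) : ℂ) ^ g‖ ≤ 12 * ε ^ 3 * Y ^ 4 * (Real.exp ν * W) := by
    calc _ ≤ g * (12 * ε ^ 4 * Y ^ 4) * (Real.exp ν * W) := hpow.trans (by gcongr)
      _ = (g * ε) * (12 * ε ^ 3 * Y ^ 4 * (Real.exp ν * W)) := by ring
      _ = _ := by rw [hgε, one_mul]
  have hTc : (1 + T) ≤ c'⁻¹ * (1 + c' * T) := by
    have : c'⁻¹ * (1 + c' * T) = c'⁻¹ + T := by field_simp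
    rw [this]
    have : 1 ≤ c'⁻¹ := (one_le_inv₀ hc'0).2 (by rw [hc']; linarith)
    linarith
  have hdt : 1 + ‖t‖ ≤ d⁻¹ * (1 + c' * T) := by
    rw [inv_mul_eq_div, le_div_iff₀ hd0, hT]
    have h1 : d ≤ 1 := min_le_left _ _
    have h2 : d ≤ c' * κ := min_le_right _ _
    have h3 := mul_le_mul_of_nonneg_right h2 (norm_nonneg t)
    linarith
  set w := 1 + c' * T with hw
  have hw0 : 0 < w := by positivity
  have hfin : Y ^ 4 * W ≤ (1 + ν) ^ 4 * (c'⁻¹) ^ 12 * (d⁻¹) ^ 3 * ((1 + ‖t‖) ^ 3)⁻¹ := by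
    rw [hY, hW, mul_pow, ← pow_mul]
    calc (1 + ν) ^ 4 * (1 + T) ^ (3 * 4) * (w ^ 15)⁻¹
        ≤ (1 + ν) ^ 4 * (c'⁻¹ * w) ^ (3 * 4) * (w ^ 15)⁻¹ := by gcongr
      _ = (1 + ν) ^ 4 * (c'⁻¹) ^ 12 * (w ^ 3)⁻¹ := by
        have hw15 : w ^ 12 * (w ^ 15)⁻¹ = (w ^ 3)⁻¹ := by field_simp
        rw [mul_pow, ← hw15]
        ring
      _ = (1 + ν) ^ 4 * (c'⁻¹) ^ 12 * (d⁻¹) ^ 3 * ((d⁻¹ * w) ^ 3)⁻¹ := by field_simp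
      _ ≤ _ := by gcongr
  have hg3 : (g : ℝ) ^ (-3 : ℝ) = ε ^ 3 := by
    rw [Real.rpow_neg hg0.le, hε, inv_pow]; norm_cast
  rw [hg3]
  calc _ ≤ 12 * ε ^ 3 * Y ^ 4 * (Real.exp ν * W) + 3 * ε ^ 3 * Y ^ 4 * W :=
        htot.trans (add_le_add h1 h2)
    _ ≤ 12 * ε ^ 3 * Y ^ 4 * (Real.exp ν * W) + 12 * ε ^ 3 * Y ^ 4 * W := by gcongr; norm_num
    _ = 12 * ε ^ 3 * (Real.exp ν + 1) * (Y ^ 4 * W) := by ring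
    _ ≤ 12 * ε ^ 3 * (Real.exp ν + 1) * ((1 + ν) ^ 4 * (c'⁻¹) ^ 12 * (d⁻¹) ^ 3
        * ((1 + ‖t‖) ^ 3)⁻¹) := by gcongr
    _ = _ := by ring

end ShearComparison

/-! ### Inversion of the expansion: Laplace integrals for Legendre polynomials. -/

section ShearInversion

/-- The angular average of `(κ + i b cos θ)⁻ⁿ`. -/
def angMoment (κ b : ℝ) (n : ℕ) : ℂ := angAvg fun θ => (((κ : ℂ) + (b * Real.cos θ : ℝ) * I) ^ n)⁻¹

variable {κ b : ℝ}

lemma add_mul_I_ne_zero (hκ : 0 < κ) (s : ℝ) : (κ : ℂ) + s * I ≠ 0 := by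
  intro h
  have := congrArg re h
  simp at this
  linarith

lemma continuous_inv_pow_add_mul_I (hκ : 0 < κ) (n : ℕ) {f : ℝ → ℝ} (hf : Continuous f) :
    Continuous fun θ => (((κ : ℂ) + (f θ : ℝ) * I) ^ n)⁻¹ :=
  Continuous.inv₀ (by fun_prop) fun _ => pow_ne_zero _ (add_mul_I_ne_zero hκ _)

/-- Bonnet's recursion: the moment of index n + 1 is P_n(κ/√S)/S^((n+1)/2) with S = κ² + b². It
follows by integrating the derivative of i b sin θ (κ + i b cos θ)^(-(n+1)) over a period. -/
lemma angMoment_recursion (hκ : 0 < κ) (b : ℝ) (n : ℕ) :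
    ((n + 1 : ℕ) : ℂ) * (κ ^ 2 + b ^ 2) * angMoment κ b (n + 2)
      = (2 * (n : ℂ) + 1) * κ * angMoment κ b (n + 1) - n * angMoment κ b n := by
  set w : ℝ → ℂ := fun θ => (κ : ℂ) + (b * Real.cos θ : ℝ) * I with hw
  have hw0 : ∀ θ, w θ ≠ 0 := fun θ => add_mul_I_ne_zero hκ _
  have hwc : ∀ k, Continuous fun θ => (w θ ^ k)⁻¹ := fun k =>
    continuous_inv_pow_add_mul_I hκ k (by fun_prop)
  set F' : ℝ → ℂ := fun θ => -(n : ℂ) * (w θ ^ n)⁻¹ + (2 * (n : ℂ) + 1) * κ * (w θ ^ (n + 1))⁻¹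
    - ((n + 1 : ℕ) : ℂ) * (κ ^ 2 + b ^ 2) * (w θ ^ (n + 2))⁻¹ with hF'
  have hd : ∀ θ : ℝ, HasDerivAt (fun θ : ℝ => (b * Real.sin θ : ℝ) * I * (w θ ^ (n + 1))⁻¹)
      (F' θ) θ := by
    intro θ
    have h1 : HasDerivAt (fun θ : ℝ => ((b * Real.sin θ : ℝ) : ℂ) * I)
        ((b * Real.cos θ : ℝ) * I) θ :=
      ((Real.hasDerivAt_sin θ).const_mul b).ofReal_comp.mul_const I
    have h2 : HasDerivAt w ((b * -Real.sin θ : ℝ) * I) θ :=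
      (((Real.hasDerivAt_cos θ).const_mul b).ofReal_comp.mul_const I).const_add _
    refine (h1.mul ((h2.pow (n + 1)).inv (pow_ne_zero _ (hw0 θ)))).congr_deriv ?_
    have hb : ((b * Real.cos θ : ℝ) : ℂ) * I = w θ - κ := by simp only [hw]; ring
    have hs : (((b * Real.sin θ : ℝ) : ℂ) * I) ^ 2 = -b ^ 2 - (w θ - κ) ^ 2 := by
      rw [← hb, mul_pow, mul_pow, I_sq]
      have := Real.sin_sq_add_cos_sq θ
      have h3 : (((Real.sin θ) ^ 2 + (Real.cos θ) ^ 2 : ℝ) : ℂ) = 1 := by rw [this]; simp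
      push_cast at h3 ⊢
      linear_combination (-(b : ℂ) ^ 2) * h3
    have h0 := hw0 θ
    rw [hb]
    have e : ((b * -Real.sin θ : ℝ) : ℂ) * I = -(((b * Real.sin θ : ℝ) : ℂ) * I) := by
      push_cast; ring
    rw [e]
    generalize ((b * Real.sin θ : ℝ) : ℂ) * I = σ at *
    simp only [hF']
    push_cast
    simp only [Pi.inv_apply, Pi.pow_apply]
    field_simp
    linear_combination ((n : ℂ) + 1) * w θ ^ (3 * n + 2) * hs
  have hFc : Continuous F' := by fun_prop
  have hint := intervalIntegral.integral_eq_sub_of_hasDerivAt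
    (a := -Real.pi) (b := Real.pi) (fun θ _ => hd θ) (hFc.intervalIntegrable _ _)
  have h0 : angAvg F' = 0 := by
    rw [angAvg, hint]; simp
  have h1 : angAvg F' = -(n : ℂ) * angMoment κ b n + (2 * (n : ℂ) + 1) * κ * angMoment κ b (n + 1)
      - ((n + 1 : ℕ) : ℂ) * (κ ^ 2 + b ^ 2) * angMoment κ b (n + 2) := by
    simp only [hF']
    rw [angAvg_sub (by fun_prop) (by fun_prop), angAvg_add (by fun_prop) (by fun_prop),
      angAvg_const_mul_complex, angAvg_const_mul_complex, angAvg_const_mul_complex]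
    rfl
  rw [h0] at h1
  linear_combination h1

/-- After rationalizing, the imaginary part is odd under θ ↦ θ + π and the real part is a known
average. -/
lemma angMoment_one (hκ : 0 < κ) (b : ℝ) :
    angMoment κ b 1 = ((√(κ ^ 2 + b ^ 2))⁻¹ : ℝ) := by
  have hpos : ∀ θ, 0 < κ ^ 2 + b ^ 2 * Real.cos θ ^ 2 := fun θ => by positivity
  have e : ∀ θ, (((κ : ℂ) + (b * Real.cos θ : ℝ) * I) ^ 1)⁻¹
      = ((κ⁻¹ * (1 + (b / κ) ^ 2 * Real.cos θ ^ 2)⁻¹ : ℝ) : ℂ)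
        - I * ((b * Real.cos θ * (κ ^ 2 + b ^ 2 * Real.cos θ ^ 2)⁻¹ : ℝ) : ℂ) := by
    intro θ
    have h1 := add_mul_I_ne_zero hκ (b * Real.cos θ)
    have h2 : ((κ ^ 2 + b ^ 2 * Real.cos θ ^ 2 : ℝ) : ℂ) ≠ 0 := by exact_mod_cast (hpos θ).ne'
    have h3 : κ⁻¹ * (1 + (b / κ) ^ 2 * Real.cos θ ^ 2)⁻¹
        = κ * (κ ^ 2 + b ^ 2 * Real.cos θ ^ 2)⁻¹ := by
      have := hpos θ
      field_simp
    rw [h3, pow_one]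
    refine (eq_inv_of_mul_eq_one_left ?_).symm
    rw [ofReal_mul, ofReal_mul (b * _), ofReal_inv]
    generalize hσ : ((κ ^ 2 + b ^ 2 * Real.cos θ ^ 2 : ℝ) : ℂ) = σ at *
    field_simp
    rw [← hσ]
    push_cast
    linear_combination (-(b : ℂ) ^ 2 * Complex.cos θ ^ 2) * I_sq
  have hc1 : Continuous fun θ => (1 + (b / κ) ^ 2 * Real.cos θ ^ 2)⁻¹ :=
    Continuous.inv₀ (by fun_prop) fun θ => by positivity
  have hc2 : Continuous fun θ => (κ ^ 2 + b ^ 2 * Real.cos θ ^ 2)⁻¹ :=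
    Continuous.inv₀ (by fun_prop) fun θ => (hpos θ).ne'
  have z : angAvg (fun θ => b * Real.cos θ * (κ ^ 2 + b ^ 2 * Real.cos θ ^ 2)⁻¹) = 0 :=
    angAvg_eq_zero_of_antiperiodic (a := Real.pi) (by fun_prop)
      (fun θ => by simp only [Real.cos_add_two_pi])
      fun θ => by rw [Real.cos_add_pi]; ring
  rw [angMoment]
  simp only [e]
  rw [angAvg_sub (by fun_prop) (by fun_prop), angAvg_const_mul_complex, angAvg_ofReal, angAvg_ofReal,
    z, angAvg_const_mul, angAvg_inv_one_add_mul_cos_sq (by positivity), ofReal_zero, mul_zero,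
    sub_zero]
  congr 1
  have h1 : 1 + (b / κ) ^ 2 = (κ ^ 2 + b ^ 2) / κ ^ 2 := by field_simp
  rw [h1, Real.sqrt_div (by positivity), Real.sqrt_sq hκ.le]
  field_simp

lemma integrable_norm_pow_mul_exp (hκ : 0 < κ) (k : ℕ) :
    Integrable fun t : Plane => ‖t‖ ^ k * Real.exp (-(κ * ‖t‖)) := by
  set n := k + 3 with hn
  have hn0 : (0 : ℝ) < n := by positivity
  set K := max 1 (n / κ) with hK
  have hK0 : 0 < K := by positivity
  have hi := (integrable_inv_one_add_norm_pow (volume : Measure Plane) (n := 3)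
    (by simp)).const_mul (K ^ n)
  refine hi.mono' (Continuous.aestronglyMeasurable (by fun_prop)) (ae_of_all _ fun t => ?_)
  have ht := norm_nonneg t
  rw [Real.norm_of_nonneg (by positivity), Real.exp_neg, ← div_eq_mul_inv, ← div_eq_mul_inv,
    div_le_div_iff₀ (Real.exp_pos _) (by positivity)]
  have h1 : 1 + ‖t‖ ≤ K * (1 + κ * ‖t‖ / n) := by
    have a1 : 1 ≤ K := le_max_left _ _
    have a2 : n / κ ≤ K := le_max_right _ _
    have a3 : n / κ * (κ * ‖t‖ / n) ≤ K * (κ * ‖t‖ / n) := by gcongr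
    have a4 : n / κ * (κ * ‖t‖ / n) = ‖t‖ := by field_simp
    linarith
  have h2 : (1 + κ * ‖t‖ / n) ^ n ≤ Real.exp (κ * ‖t‖) := by
    have : κ * ‖t‖ = n * (κ * ‖t‖ / n) := by field_simp
    rw [this, Real.exp_nat_mul, ← this]
    gcongr
    linarith [Real.add_one_le_exp (κ * ‖t‖ / n)]
  calc ‖t‖ ^ k * (1 + ‖t‖) ^ 3 ≤ (1 + ‖t‖) ^ k * (1 + ‖t‖) ^ 3 := by gcongr; linarith
    _ = (1 + ‖t‖) ^ n := by rw [hn, pow_add]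
    _ ≤ (K * (1 + κ * ‖t‖ / n)) ^ n := by gcongr
    _ = K ^ n * (1 + κ * ‖t‖ / n) ^ n := mul_pow _ _ _
    _ ≤ _ := by gcongr

/-- In polar coordinates the radial integral is a Laplace transform at κ + i `dirComp q θ`, and
rotating the angle replaces q by its length. -/
lemma integral_cexp_mul_norm_pow_mul_exp (hκ : 0 < κ) (k : ℕ) (q : Plane) :
    ∫ t : Plane, cexp (-((⟪q, t⟫ : ℝ)) * I) * ((‖t‖ ^ k * Real.exp (-(κ * ‖t‖)) : ℝ) : ℂ)
      = 2 * Real.pi * ((k + 1).factorial * angMoment κ ‖q‖ (k + 2)) := by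
  rw [integral_plane_eq_polar]
  set w : ℝ → ℂ := fun θ => (κ : ℂ) + (dirComp q θ : ℝ) * I with hw
  have hq := continuous_dirComp q
  have hre : ∀ θ, (w θ).re = κ := fun θ => by simp [hw]
  have e1 : ∀ p ∈ polarCoord.target,
      (p.1 • (cexp (-((⟪q, polarPt p.1 p.2⟫ : ℝ)) * I) *
        ((‖polarPt p.1 p.2‖ ^ k * Real.exp (-(κ * ‖polarPt p.1 p.2‖)) : ℝ) : ℂ)))
      = (p.1 : ℂ) ^ (k + 1) * cexp (-(w p.2 * p.1)) := by
    rintro ⟨r, θ⟩ hp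
    have hr : 0 < r := hp.1
    have hin : (⟪q, polarPt r θ⟫ : ℝ) = r * dirComp q θ := by
      rw [plane_inner, dirComp, polarPt_zero, polarPt_one]; ring
    simp only
    rw [norm_polarPt hr.le, hin, real_smul]
    push_cast
    have : cexp (-(w θ * r)) = cexp (-(r * dirComp q θ) * I) * cexp (-(κ * r)) := by
      rw [← Complex.exp_add]; congr 1; simp only [hw]; ring
    rw [this]; ring
  rw [setIntegral_congr_fun polarCoord.open_target.measurableSet e1, polarCoord_target]
  have hint : IntegrableOn (fun p : ℝ × ℝ => (p.1 : ℂ) ^ (k + 1) * cexp (-(w p.2 * p.1)))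
      (Set.Ioi 0 ×ˢ Set.Ioo (-Real.pi) Real.pi) (volume.prod volume) := by
    rw [IntegrableOn, ← Measure.prod_restrict]
    have h1 := integrableOn_pow_mul_cexp_neg_mul (k + 1) (z := (κ : ℂ)) (by simpa using hκ)
    have h2 : IntegrableOn (fun _ : ℝ => (1 : ℂ)) (Set.Ioo (-Real.pi) Real.pi) := by simp
    refine (h1.mul_prod h2).mono (Continuous.aestronglyMeasurable (by fun_prop))
      (ae_of_all _ fun p => le_of_eq ?_)
    rw [mul_one, norm_mul, norm_mul, Complex.norm_exp, Complex.norm_exp]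
    congr 2
    simp [hw]
  rw [Measure.volume_eq_prod, ← Measure.prod_restrict, integral_prod_symm _ (by rwa [Measure.prod_restrict])]
  have e2 : ∀ θ, ∫ r in Set.Ioi (0 : ℝ), (r : ℂ) ^ (k + 1) * cexp (-(w θ * r))
      = (k + 1).factorial * (w θ ^ (k + 2))⁻¹ := fun θ => by
    rw [integral_pow_mul_cexp_neg_mul (k + 1) (by rw [hre]; exact hκ), div_eq_mul_inv]
  simp only [e2]
  rw [integral_const_mul, ← integral_Ioc_eq_integral_Ioo, ← intervalIntegral.integral_of_le
    (by linarith [Real.pi_pos]), angMoment,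
    ← angAvg_comp_dirComp (fun s => (((κ : ℂ) + (s : ℝ) * I) ^ (k + 2))⁻¹) q, angAvg, real_smul]
  have : (Real.pi : ℂ) ≠ 0 := by exact_mod_cast Real.pi_ne_zero
  simp only [hw]
  generalize (∫ θ in (-Real.pi)..Real.pi, (((κ : ℂ) + (dirComp q θ : ℝ) * I) ^ (k + 2))⁻¹) = J
  push_cast
  field_simp

/-- The coefficient of `‖t‖ ^ k * exp (-κ ‖t‖)` in `shearCharFunApprox`. -/
def shearCoeff (m : ℝ) (x : Plane) (g : ℕ) : ℕ → ℝ
  | 0 => 1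
  | 1 => 0
  | 2 => -(g : ℝ)⁻¹ * kappaStar m ^ 2 / 4
      + ((g : ℝ)⁻¹) ^ 2 * (Real.pi * ‖x‖ ^ 2) * kappaStar m ^ 2 / 2
  | 3 => -((g : ℝ)⁻¹) ^ 2 * kappaStar m ^ 3 / 12
  | 4 => ((g : ℝ)⁻¹) ^ 2 * kappaStar m ^ 4 / 32
  | _ => 0

lemma shearCharFunApprox_eq_sum (m : ℝ) (x : Plane) (g : ℕ) (t : Plane) :
    shearCharFunApprox m x g t = ∑ k ∈ Finset.range 5,
      shearCoeff m x g k * (‖t‖ ^ k * Real.exp (-(kappaStar m * ‖t‖))) := by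
  simp only [Finset.sum_range_succ, Finset.sum_range_zero, shearCoeff, shearCharFunApprox,
    shearCubic]
  ring

lemma integrable_shearCharFunApprox {m : ℝ} (hm : 0 < m) (x : Plane) (g : ℕ) :
    Integrable fun t => (shearCharFunApprox m x g t : ℂ) := by
  have hκ : 0 < kappaStar m := mul_pos Real.pi_pos hm
  simp only [shearCharFunApprox_eq_sum]
  have h := integrable_finsetSum (Finset.range 5) fun k _ =>
    (integrable_norm_pow_mul_exp hκ k).const_mul (shearCoeff m x g k)
  exact h.ofReal

lemma angMoment_values (hκ : 0 < κ) (b : ℝ) :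
    angMoment κ b 2 = ((κ / (κ ^ 2 + b ^ 2) * (√(κ ^ 2 + b ^ 2))⁻¹ : ℝ) : ℂ) ∧
    angMoment κ b 4 = ((κ * (5 * κ ^ 2 - 3 * (κ ^ 2 + b ^ 2)) / (2 * (κ ^ 2 + b ^ 2) ^ 3)
      * (√(κ ^ 2 + b ^ 2))⁻¹ : ℝ) : ℂ) ∧
    angMoment κ b 5 = (((35 * κ ^ 4 - 30 * κ ^ 2 * (κ ^ 2 + b ^ 2) + 3 * (κ ^ 2 + b ^ 2) ^ 2)
      / (8 * (κ ^ 2 + b ^ 2) ^ 4) * (√(κ ^ 2 + b ^ 2))⁻¹ : ℝ) : ℂ) ∧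
    angMoment κ b 6 = ((κ * (63 * κ ^ 4 - 70 * κ ^ 2 * (κ ^ 2 + b ^ 2) + 15 * (κ ^ 2 + b ^ 2) ^ 2)
      / (8 * (κ ^ 2 + b ^ 2) ^ 5) * (√(κ ^ 2 + b ^ 2))⁻¹ : ℝ) : ℂ) := by
  have h1 := angMoment_one hκ b
  have r0 := angMoment_recursion hκ b 0
  have r1 := angMoment_recursion hκ b 1
  have r2 := angMoment_recursion hκ b 2
  have r3 := angMoment_recursion hκ b 3
  have r4 := angMoment_recursion hκ b 4
  have hS : ((κ : ℂ) ^ 2 + (b : ℂ) ^ 2) ≠ 0 := by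
    have : κ ^ 2 + b ^ 2 ≠ 0 := by positivity
    exact_mod_cast this
  push_cast at *
  generalize ((√(κ ^ 2 + b ^ 2) : ℝ) : ℂ)⁻¹ = s at *
  set S : ℂ := (κ : ℂ) ^ 2 + (b : ℂ) ^ 2
  norm_num at r0 r1 r2 r3 r4
  have h2 : angMoment κ b 2 = κ / S * s := by
    rw [h1] at r0
    field_simp
    linear_combination r0
  have h3 : angMoment κ b 3 = (3 * κ ^ 2 - S) / (2 * S ^ 2) * s := by
    rw [h1, h2] at r1
    have : angMoment κ b 3 = (3 * κ * (κ / S * s) - s) / (2 * S) := by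
      rw [eq_div_iff (by simpa using hS)]; linear_combination r1
    rw [this]; field_simp
  have h4 : angMoment κ b 4 = κ * (5 * κ ^ 2 - 3 * S) / (2 * S ^ 3) * s := by
    rw [h2, h3] at r2
    have : angMoment κ b 4 = (5 * κ * ((3 * κ ^ 2 - S) / (2 * S ^ 2) * s) - 2 * (κ / S * s)) / (3 * S) := by
      rw [eq_div_iff (by simpa using hS)]; linear_combination r2
    rw [this]; field_simp; ring
  have h5 : angMoment κ b 5 = (35 * κ ^ 4 - 30 * κ ^ 2 * S + 3 * S ^ 2) / (8 * S ^ 4) * s := by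
    rw [h3, h4] at r3
    have : angMoment κ b 5 = (7 * κ * (κ * (5 * κ ^ 2 - 3 * S) / (2 * S ^ 3) * s)
        - 3 * ((3 * κ ^ 2 - S) / (2 * S ^ 2) * s)) / (4 * S) := by
      rw [eq_div_iff (by simpa using hS)]; linear_combination r3
    rw [this]; field_simp; ring
  have h6 : angMoment κ b 6 = κ * (63 * κ ^ 4 - 70 * κ ^ 2 * S + 15 * S ^ 2) / (8 * S ^ 5) * s := by
    rw [h4, h5] at r4
    have : angMoment κ b 6 = (9 * κ * ((35 * κ ^ 4 - 30 * κ ^ 2 * S + 3 * S ^ 2) / (8 * S ^ 4) * s)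
        - 4 * (κ * (5 * κ ^ 2 - 3 * S) / (2 * S ^ 3) * s)) / (5 * S) := by
      rw [eq_div_iff (by simpa using hS)]; linear_combination r4
    rw [this]; field_simp; ring
  exact ⟨h2, h4, h5, h6⟩

/-- Termwise inversion of `shearCharFunApprox_eq_sum`; the factorials 3!, 4!, 5! and the Legendre
values of `angMoment_values` reproduce `hOne` and `hTwo`. -/
lemma shearApprox_eq_invCharFun {m : ℝ} (hm : 0 < m) (x : Plane) (g : ℕ) (q : Plane) :
    (shearApprox m x g q : ℂ) = invCharFun (fun t => (shearCharFunApprox m x g t : ℂ)) q := by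
  have hκ : 0 < kappaStar m := mul_pos Real.pi_pos hm
  have e : ∀ t : Plane, cexp (-((⟪q, t⟫ : ℝ)) * I) * (shearCharFunApprox m x g t : ℂ)
      = ∑ k ∈ Finset.range 5, (shearCoeff m x g k : ℂ) * (cexp (-((⟪q, t⟫ : ℝ)) * I) *
        ((‖t‖ ^ k * Real.exp (-(kappaStar m * ‖t‖)) : ℝ) : ℂ)) := by
    intro t
    rw [shearCharFunApprox_eq_sum, ofReal_sum, Finset.mul_sum]
    refine Finset.sum_congr rfl fun k _ => ?_
    push_cast; ring
  have hi : ∀ k, Integrable fun t : Plane => cexp (-((⟪q, t⟫ : ℝ)) * I) *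
      ((‖t‖ ^ k * Real.exp (-(kappaStar m * ‖t‖)) : ℝ) : ℂ) := by
    intro k
    refine (integrable_norm_pow_mul_exp hκ k).mono
      (Continuous.aestronglyMeasurable (by fun_prop)) (ae_of_all _ fun t => ?_)
    rw [norm_mul, ← ofReal_neg, norm_exp_ofReal_mul_I, one_mul, norm_real]
  rw [invCharFun]
  simp only [e]
  rw [integral_finsetSum _ fun k _ => (hi k).const_mul _]
  simp only [integral_const_mul, integral_cexp_mul_norm_pow_mul_exp hκ]
  obtain ⟨a2, a4, a5, a6⟩ := angMoment_values hκ ‖q‖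
  have hS : 0 < kappaStar m ^ 2 + ‖q‖ ^ 2 := by positivity
  have hrp : (kappaStar m ^ 2 + ‖q‖ ^ 2) ^ (3 / 2 : ℝ)
      = (kappaStar m ^ 2 + ‖q‖ ^ 2) * √(kappaStar m ^ 2 + ‖q‖ ^ 2) := by
    rw [show (3 / 2 : ℝ) = 1 + 1 / 2 by norm_num, Real.rpow_add hS, Real.rpow_one,
      Real.sqrt_eq_rpow]
  have hs : 0 < √(kappaStar m ^ 2 + ‖q‖ ^ 2) := Real.sqrt_pos.2 hS
  have hr : kappaStar m * ‖x‖ ^ 2 / m = Real.pi * ‖x‖ ^ 2 := by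
    rw [kappaStar]; field_simp
  have hpi := Real.pi_ne_zero
  -- The comparison of closed forms is carried out over ℝ, so that the complex integral only has to
  -- be matched linearly in the four moments.
  have key : ∀ v2 v4 v5 v6 : ℝ,
      v2 = kappaStar m / (kappaStar m ^ 2 + ‖q‖ ^ 2) * (√(kappaStar m ^ 2 + ‖q‖ ^ 2))⁻¹ →
      v4 = kappaStar m * (5 * kappaStar m ^ 2 - 3 * (kappaStar m ^ 2 + ‖q‖ ^ 2))
        / (2 * (kappaStar m ^ 2 + ‖q‖ ^ 2) ^ 3) * (√(kappaStar m ^ 2 + ‖q‖ ^ 2))⁻¹ →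
      v5 = (35 * kappaStar m ^ 4 - 30 * kappaStar m ^ 2 * (kappaStar m ^ 2 + ‖q‖ ^ 2)
        + 3 * (kappaStar m ^ 2 + ‖q‖ ^ 2) ^ 2) / (8 * (kappaStar m ^ 2 + ‖q‖ ^ 2) ^ 4)
        * (√(kappaStar m ^ 2 + ‖q‖ ^ 2))⁻¹ →
      v6 = kappaStar m * (63 * kappaStar m ^ 4 - 70 * kappaStar m ^ 2 * (kappaStar m ^ 2 + ‖q‖ ^ 2)
        + 15 * (kappaStar m ^ 2 + ‖q‖ ^ 2) ^ 2) / (8 * (kappaStar m ^ 2 + ‖q‖ ^ 2) ^ 5)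
        * (√(kappaStar m ^ 2 + ‖q‖ ^ 2))⁻¹ →
      shearApprox m x g q = (2 * Real.pi)⁻¹ * (v2 + 6 * shearCoeff m x g 2 * v4
        + 24 * shearCoeff m x g 3 * v5 + 120 * shearCoeff m x g 4 * v6) := by
    rintro v2 v4 v5 v6 rfl rfl rfl rfl
    simp only [shearApprox, hOne, hTwo, hrp, shearCoeff]
    rw [hr]
    generalize √(kappaStar m ^ 2 + ‖q‖ ^ 2) = s at *
    generalize kappaStar m = κ at *
    generalize ‖q‖ = G at *
    rw [div_eq_mul_inv _ (g : ℝ), div_eq_mul_inv _ ((g : ℝ) ^ 2), ← inv_pow]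
    generalize (g : ℝ)⁻¹ = ε at *
    field_simp
    ring
  rw [key _ _ _ _ rfl rfl rfl rfl]
  simp only [Finset.sum_range_succ, Finset.sum_range_zero, a2, a4, a5, a6]
  generalize kappaStar m / (kappaStar m ^ 2 + ‖q‖ ^ 2) * (√(kappaStar m ^ 2 + ‖q‖ ^ 2))⁻¹ = v2
  generalize kappaStar m * (5 * kappaStar m ^ 2 - 3 * (kappaStar m ^ 2 + ‖q‖ ^ 2))
        / (2 * (kappaStar m ^ 2 + ‖q‖ ^ 2) ^ 3) * (√(kappaStar m ^ 2 + ‖q‖ ^ 2))⁻¹ = v4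
  generalize (35 * kappaStar m ^ 4 - 30 * kappaStar m ^ 2 * (kappaStar m ^ 2 + ‖q‖ ^ 2)
        + 3 * (kappaStar m ^ 2 + ‖q‖ ^ 2) ^ 2) / (8 * (kappaStar m ^ 2 + ‖q‖ ^ 2) ^ 4)
        * (√(kappaStar m ^ 2 + ‖q‖ ^ 2))⁻¹ = v5
  generalize kappaStar m * (63 * kappaStar m ^ 4 - 70 * kappaStar m ^ 2 *
        (kappaStar m ^ 2 + ‖q‖ ^ 2) + 15 * (kappaStar m ^ 2 + ‖q‖ ^ 2) ^ 2)
        / (8 * (kappaStar m ^ 2 + ‖q‖ ^ 2) ^ 5) * (√(kappaStar m ^ 2 + ‖q‖ ^ 2))⁻¹ = v6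
  have hd : Module.finrank ℝ Plane = 2 := by simp
  have h0 : shearCoeff m x g 0 = 1 := rfl
  have h1 : shearCoeff m x g 1 = 0 := rfl
  have hpi' : (Real.pi : ℂ) ≠ 0 := by exact_mod_cast hpi
  rw [hd, real_smul, h0, h1]
  simp only [Nat.factorial]
  push_cast
  field_simp
  ring

end ShearInversion

/-! ### The density of the shear. -/

lemma measurable_shearField (m : ℝ) : Measurable fun z : Plane =>
    (m / ‖z‖ ^ 4) • (!₂[z 0 ^ 2 - z 1 ^ 2, 2 * z 0 * z 1] : Plane) := by
  have h : Measurable fun z : Plane => prodEquivPlane (z 0 ^ 2 - z 1 ^ 2, 2 * z 0 * z 1) :=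
    prodEquivPlane.measurable.comp (Continuous.measurable (by fun_prop))
  exact Measurable.smul (measurable_const.div (measurable_norm.pow_const 4)) h

lemma shear_eq_sum (m : ℝ) {g : ℕ} (ξ : Fin g → Plane) (x : Plane) :
    shear m ξ x = 0 + ∑ j, (m / ‖ξ j - x‖ ^ 4) •
      (!₂[(ξ j - x) 0 ^ 2 - (ξ j - x) 1 ^ 2, 2 * (ξ j - x) 0 * (ξ j - x) 1] : Plane) := by
  have h4 : ∀ z : Plane, ‖z‖ ^ 4 = (z 0 ^ 2 + z 1 ^ 2) ^ 2 := fun z => by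
    rw [← plane_norm_sq, ← pow_mul]
  rw [zero_add]
  ext i
  fin_cases i
  · simp [shear, h4, div_mul_eq_mul_div]
  · simp only [shear, h4]
    simp
    refine Finset.sum_congr rfl fun j _ => ?_
    ring

theorem hasAsymptoticPDF_shear {m : ℝ} (hm : 0 < m) (x : Plane)
    {Ω : ℕ → Type*} [∀ g, MeasurableSpace (Ω g)] (P : ∀ g, Measure (Ω g))
    [∀ g, IsProbabilityMeasure (P g)] (ξ : ∀ g, Fin g → Ω g → Plane)
    (hmeas : ∀ g j, Measurable (ξ g j)) (hindep : ∀ g, iIndepFun (ξ g) (P g))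
    (hunif : ∀ g j,
      pdf.IsUniform (ξ g j) (Metric.closedBall 0 (discRadius g)) (P g) volume) :
    HasAsymptoticPDF P (fun g ω => shear m (fun j => ξ g j ω) x) (shearApprox m x)
      (fun g => (g : ℝ) ^ (-3 : ℝ)) := by
  have hF := measurable_shearField m
  have hX : ∀ g, Measurable fun ω => shear m (fun j => ξ g j ω) x := by
    intro g
    simp only [shear_eq_sum]
    exact (Finset.measurable_sum _ fun j _ =>
      hF.comp ((hmeas g j).sub_const x)).const_add _
  obtain ⟨C, hC⟩ := exists_norm_radialCharFun_pow_sub_shear_le hm x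
  refine hasAsymptoticPDF_of_norm_charFun_sub_le P hX (Q := fun g t => shearCharFunApprox m x g t)
    (r := fun _ => 1) (C := C) ?_
  filter_upwards [hC, tendsto_discRadius.eventually_gt_atTop ‖x‖] with g hg hR
  refine ⟨one_pos, integrable_shearCharFunApprox hm x g, shearApprox_eq_invCharFun hm x g, fun t => ?_⟩
  simp only [shear_eq_sum]
  rw [charFun_map_sum_uniform hR hF (hmeas g) (hindep g) (hunif g),
    starCharFun_eq_radialCharFun (k := 2) (p := 1) (m := m) (by norm_num) hR]
  · simpa using hg t
  · intro r θ hr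
    rw [plane_inner, norm_polarPt hr.le, dirComp]
    simp only [PiLp.smul_apply, smul_eq_mul, polarPt_zero, polarPt_one]
    simp
    -- The field is m (cos 2θ, sin 2θ)/r² in polar coordinates, hence k = 2 and p = 1.
    rw [Real.cos_two_mul, Real.sin_two_mul]
    have := Real.sin_sq_add_cos_sq θ
    field_simp
    linear_combination (-(t 0)) * this

/-! ### Expansion of the single-star characteristic function of the lensing map. -/

section LensingCharFun

variable {R m : ℝ} {x t : Plane}

/-- `dirComp t` is odd under θ ↦ θ + π, so only the difference of opposite chords counts. This
average is the source of the drift term -κ_* x. -/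
lemma angAvg_dirComp_mul_chord (R : ℝ) (x t : Plane) :
    angAvg (fun θ => dirComp t θ * chord R x θ) = -((⟪t, x⟫ : ℝ) / 2) := by
  have h1 := continuous_chord R x
  have h2 := continuous_dirComp t
  have h2' := continuous_dirComp x
  have hp : Function.Periodic (fun θ => dirComp t θ * chord R x θ) (2 * Real.pi) := fun θ => by
    simp only; rw [dirComp_periodic t θ, chord_periodic R x θ]
  have e1 : ∀ θ, (2 : ℝ)⁻¹ • (dirComp t θ * chord R x θ
      + dirComp t (θ + Real.pi) * chord R x (θ + Real.pi)) = -(dirComp t θ * dirComp x θ) := by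
    intro θ
    have h := chord_sub_chord R x θ
    rw [dirComp_add_pi, smul_eq_mul]
    linear_combination dirComp t θ / 2 * h
  rw [angAvg_eq_pair (by fun_prop) hp Real.pi]
  simp only [e1]
  rw [angAvg_neg, angAvg_dirComp_mul]

lemma sq_mul_abs_log_le {c : ℝ} (hc0 : 0 < c) (hc1 : c ≤ 1) : c ^ 2 * |Real.log c| ≤ 1 := by
  have h := Real.one_sub_inv_le_log_of_pos hc0
  rw [abs_of_nonpos (Real.log_nonpos hc0.le hc1)]
  have h2 : -Real.log c ≤ c⁻¹ := by linarith
  calc c ^ 2 * -Real.log c ≤ c ^ 2 * c⁻¹ := by gcongr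
    _ = c := by field_simp
    _ ≤ 1 := hc1

lemma abs_log_chord_div_le (hx : ‖x‖ ≤ R / 2) (hR : 0 < R) (θ : ℝ) :
    |Real.log (R / chord R x θ)| ≤ 1 := by
  have hx' : ‖x‖ < R := by linarith
  have h1 : R / 2 ≤ chord R x θ := by linarith [le_chord hx' θ]
  have h2 : chord R x θ ≤ 2 * R := by linarith [chord_le hx' θ]
  have h0 := chord_pos hx' θ
  have hu : R / chord R x θ ≤ 2 := by rw [div_le_iff₀ h0]; linarith
  have hl : 2⁻¹ ≤ R / chord R x θ := by rw [le_div_iff₀ h0]; linarith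
  have hlog2 := Real.log_two_lt_d9
  have a1 := Real.log_le_log (by positivity) hu
  have a2 := Real.log_le_log (by norm_num) hl
  rw [Real.log_inv] at a2
  rw [abs_le]
  constructor <;> linarith

/-- The logarithm splits into log(|t|/R) and terms in m, in R/ρ ∈ [1/2, 2], and in the cosine factor
c, for which c²|log c| ≤ 1. Hence the angle leaves the logarithm at the cost of O(|t|²). -/
lemma abs_dirComp_sq_mul_log_sub_le (hx : ‖x‖ ≤ R / 2) (hR : 0 < R) (hm : 0 < m) (θ : ℝ) :
    |dirComp t θ ^ 2 * Real.log |m * dirComp t θ / chord R x θ|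
        - dirComp t θ ^ 2 * Real.log (‖t‖ / R)| ≤ ‖t‖ ^ 2 * (|Real.log m| + 2) := by
  have h0 := chord_pos (by linarith : ‖x‖ < R) θ
  rcases eq_or_ne (dirComp t θ) 0 with hD | hD
  · rw [hD]; simp; positivity
  have hD0 : 0 < |dirComp t θ| := abs_pos.2 hD
  have hDt := abs_dirComp_le t θ
  have ht : 0 < ‖t‖ := hD0.trans_le hDt
  set c := |dirComp t θ| / ‖t‖ with hc
  have hc0 : 0 < c := by positivity
  have hc1 : c ≤ 1 := (div_le_one ht).2 hDt
  have e1 : Real.log |m * dirComp t θ / chord R x θ|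
      = Real.log m + Real.log c + Real.log (R / chord R x θ) + Real.log (‖t‖ / R) := by
    rw [← Real.log_mul hm.ne' hc0.ne', ← Real.log_mul (by positivity) (by positivity),
      ← Real.log_mul (by positivity) (by positivity), abs_div, abs_mul, abs_of_pos hm,
      abs_of_pos h0, hc]
    congr 1
    field_simp
  have e2 : dirComp t θ ^ 2 = ‖t‖ ^ 2 * c ^ 2 := by
    rw [hc, div_pow, sq_abs]; field_simp
  rw [e1, e2, ← mul_sub, add_sub_cancel_right, abs_mul, abs_of_nonneg (by positivity), mul_assoc]
  gcongr
  have b1 := sq_mul_abs_log_le hc0 hc1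
  have b2 := abs_log_chord_div_le hx hR θ
  have hc2 : c ^ 2 ≤ 1 := pow_le_one₀ hc0.le hc1
  calc c ^ 2 * |Real.log m + Real.log c + Real.log (R / chord R x θ)|
      ≤ c ^ 2 * (|Real.log m| + |Real.log c| + |Real.log (R / chord R x θ)|) := by
        gcongr; exact abs_add_three _ _ _
    _ = c ^ 2 * |Real.log m| + c ^ 2 * |Real.log c| + c ^ 2 * |Real.log (R / chord R x θ)| := by
        ring
    _ ≤ 1 * |Real.log m| + 1 + 1 * 1 := by gcongr
    _ = _ := by ring

/-- The pointwise expansion of index 2 is averaged: 2iA gives the linear phase, and A² log|A| gives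
the leading quadratic term with log(|t|/R). -/
lemma norm_radialCharFun_lensing_sub_le (hx : ‖x‖ ≤ R / 2) (hR : 0 < R) (hm : 0 < m) :
    ‖radialCharFun 1 2 m R x t - (1 - (m * (⟪t, x⟫ : ℝ) / R ^ 2 : ℝ) * I
        + ((m * ‖t‖) ^ 2 * Real.log (‖t‖ / R) / (2 * R ^ 2) : ℝ))‖
      ≤ (m ^ 2 * (|Real.log m| + 10) * ‖t‖ ^ 2 + 16 * m ^ 3 * ‖t‖ ^ 3 / R) / R ^ 2 := by
  have hx' : ‖x‖ < R := by linarith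
  have h1 := continuous_chord R x
  have h2 := continuous_dirComp t
  set ρ := chord R x with hρ
  set D := dirComp t with hD
  set l := Real.log (‖t‖ / R) with hl
  set G : ℝ → ℝ := fun θ => (R ^ 2)⁻¹ * ρ θ ^ 2 + m ^ 2 * l / R ^ 2 * D θ ^ 2 with hG
  set H : ℝ → ℝ := fun θ => 2 * m / R ^ 2 * (D θ * ρ θ) with hH
  have hGc : Continuous G := by fun_prop
  have hHc : Continuous H := by fun_prop
  have hGa : angAvg G = 1 + (m * ‖t‖) ^ 2 * l / (2 * R ^ 2) := by
    simp only [hG]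
    rw [angAvg_add (by fun_prop) (by fun_prop), angAvg_const_mul, angAvg_const_mul,
      angAvg_chord_sq hx', angAvg_dirComp_sq]
    field_simp
  have hHa : angAvg H = -(m * (⟪t, x⟫ : ℝ) / R ^ 2) := by
    simp only [hH]
    rw [angAvg_const_mul, angAvg_dirComp_mul_chord]
    ring
  have hGH : angAvg (fun θ => (G θ : ℂ) + I * (H θ : ℂ))
      = ((angAvg G : ℝ) : ℂ) + I * ((angAvg H : ℝ) : ℂ) := by
    rw [angAvg_add (by fun_prop) (by fun_prop), angAvg_const_mul_complex, angAvg_ofReal,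
      angAvg_ofReal]
  have hpt : ∀ θ, ‖(((ρ θ / R) ^ 2 : ℝ) : ℂ) *
      paretoCharFun 2 (m * dirComp t ((1 : ℕ) * θ) / ρ θ ^ 1) - ((G θ : ℂ) + I * (H θ : ℂ))‖
      ≤ (m ^ 2 * (|Real.log m| + 10) * ‖t‖ ^ 2 + 16 * m ^ 3 * ‖t‖ ^ 3 / R) / R ^ 2 := by
    intro θ
    have p0 : 0 < ρ θ := chord_pos hx' θ
    have hρR : R / 2 ≤ ρ θ := by linarith [le_chord hx' θ]
    have hDb : |D θ| ≤ ‖t‖ := abs_dirComp_le t θ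
    set A := m * D θ / ρ θ with hA
    have e0 : m * dirComp t ((1 : ℕ) * θ) / ρ θ ^ 1 = A := by simp [hA, hD]
    rw [e0]
    have a1 := norm_paretoCharFun_two_sub_le A
    have a2 : |D θ ^ 2 * Real.log |A| - D θ ^ 2 * l| ≤ ‖t‖ ^ 2 * (|Real.log m| + 2) :=
      abs_dirComp_sq_mul_log_sub_le hx hR hm θ
    set E := paretoCharFun 2 A with hE
    have hρc : (ρ θ : ℂ) ≠ 0 := by exact_mod_cast p0.ne'
    have hRc : (R : ℂ) ≠ 0 := by exact_mod_cast hR.ne'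
    have e1 : (((ρ θ / R) ^ 2 : ℝ) : ℂ) * E - ((G θ : ℂ) + I * (H θ : ℂ))
        = (((ρ θ / R) ^ 2 : ℝ) : ℂ) * (E - (1 + (2 * A : ℝ) * I + (A ^ 2 * Real.log |A| : ℝ)))
          + ((m ^ 2 / R ^ 2 * (D θ ^ 2 * Real.log |A| - D θ ^ 2 * l) : ℝ) : ℂ) := by
      simp only [hG, hH]
      generalize Real.log |A| = la
      rw [hA]
      push_cast
      field_simp
      ring
    have hA2 : (ρ θ / R) ^ 2 * A ^ 2 ≤ m ^ 2 * ‖t‖ ^ 2 / R ^ 2 := by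
      have : (ρ θ / R) ^ 2 * A ^ 2 = m ^ 2 * |D θ| ^ 2 / R ^ 2 := by
        rw [hA, sq_abs]; field_simp
      rw [this]; gcongr
    have hA3 : (ρ θ / R) ^ 2 * |A| ^ 3 ≤ 2 * m ^ 3 * ‖t‖ ^ 3 / R / R ^ 2 := by
      have e : (ρ θ / R) ^ 2 * |A| ^ 3 = m ^ 3 * |D θ| ^ 3 / ρ θ / R ^ 2 := by
        rw [hA, abs_div, abs_mul, abs_of_pos hm, abs_of_pos p0]; field_simp
      rw [e]
      refine div_le_div_of_nonneg_right ?_ (by positivity)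
      calc m ^ 3 * |D θ| ^ 3 / ρ θ ≤ m ^ 3 * ‖t‖ ^ 3 / (R / 2) := by gcongr
        _ = _ := by field_simp
    rw [e1]
    refine (norm_add_le _ _).trans ?_
    rw [norm_mul, norm_real, norm_real, Real.norm_of_nonneg (sq_nonneg _), Real.norm_eq_abs,
      abs_mul (m ^ 2 / R ^ 2), abs_of_pos (show 0 < m ^ 2 / R ^ 2 by positivity)]
    calc _ ≤ (ρ θ / R) ^ 2 * (8 * (A ^ 2 + |A| ^ 3))
          + m ^ 2 / R ^ 2 * (‖t‖ ^ 2 * (|Real.log m| + 2)) := by gcongr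
      _ = 8 * ((ρ θ / R) ^ 2 * A ^ 2) + 8 * ((ρ θ / R) ^ 2 * |A| ^ 3)
          + m ^ 2 / R ^ 2 * (‖t‖ ^ 2 * (|Real.log m| + 2)) := by ring
      _ ≤ 8 * (m ^ 2 * ‖t‖ ^ 2 / R ^ 2) + 8 * (2 * m ^ 3 * ‖t‖ ^ 3 / R / R ^ 2)
          + m ^ 2 / R ^ 2 * (‖t‖ ^ 2 * (|Real.log m| + 2)) := by gcongr
      _ = _ := by ring
  have hcr := continuous_radial (k := 1) (m := m) (t := t) (p := 2) (by norm_num) hx'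
  have hmain := norm_angAvg_le_const (f := fun θ => (((ρ θ / R) ^ 2 : ℝ) : ℂ) *
      paretoCharFun 2 (m * dirComp t ((1 : ℕ) * θ) / ρ θ ^ 1) - ((G θ : ℂ) + I * (H θ : ℂ)))
      (hcr.sub (by fun_prop)) hpt
  rw [angAvg_sub hcr (by fun_prop), hGH, hGa, hHa] at hmain
  refine le_trans (le_of_eq ?_) hmain
  congr 2
  push_cast
  ring

/-- The hypothesis on |t| together with ρ ≥ R/2 keeps |A| ≤ 1, where the logarithm is negative and
provides the damping. -/
lemma norm_radialCharFun_lensing_le (hx : ‖x‖ ≤ R / 2) (hR : 0 < R) (hm : 0 < m)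
    (ht : 2 * m * ‖t‖ ≤ R) :
    ‖radialCharFun 1 2 m R x t‖
      ≤ 1 + (m * ‖t‖) ^ 2 / (2 * R ^ 2) * (Real.log (2 * m * ‖t‖ / R) + 20) := by
  have hx' : ‖x‖ < R := by linarith
  have h1 := continuous_chord R x
  have h2 := continuous_dirComp t
  set l := Real.log (2 * m * ‖t‖ / R) with hl
  have hpt : ∀ θ, ‖(((chord R x θ / R) ^ 2 : ℝ) : ℂ) *
      paretoCharFun 2 (m * dirComp t ((1 : ℕ) * θ) / chord R x θ ^ 1)‖
      ≤ (R ^ 2)⁻¹ * chord R x θ ^ 2 + m ^ 2 / R ^ 2 * (l + 20) * dirComp t θ ^ 2 := by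
    intro θ
    have p0 : 0 < chord R x θ := chord_pos hx' θ
    have hρR : R / 2 ≤ chord R x θ := by linarith [le_chord hx' θ]
    have hDb : |dirComp t θ| ≤ ‖t‖ := abs_dirComp_le t θ
    set A := m * dirComp t θ / chord R x θ with hA
    have e0 : m * dirComp t ((1 : ℕ) * θ) / chord R x θ ^ 1 = A := by simp [hA]
    have hAb : |A| ≤ 2 * m * ‖t‖ / R := by
      rw [hA, abs_div, abs_mul, abs_of_pos hm, abs_of_pos p0]
      calc m * |dirComp t θ| / chord R x θ ≤ m * ‖t‖ / (R / 2) := by gcongr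
        _ = _ := by field_simp
    have hA1 : |A| ≤ 1 := hAb.trans ((div_le_one hR).2 ht)
    have hlog : A ^ 2 * Real.log |A| ≤ A ^ 2 * l := by
      rcases eq_or_ne A 0 with h0 | h0
      · rw [h0]; simp
      · have := Real.log_le_log (abs_pos.2 h0) hAb
        gcongr
    have h := norm_paretoCharFun_two_le hA1
    rw [e0, norm_mul, norm_real, Real.norm_of_nonneg (sq_nonneg _)]
    calc _ ≤ (chord R x θ / R) ^ 2 * (1 + A ^ 2 * l + 20 * A ^ 2) := by
          gcongr; linarith
      _ = _ := by rw [hA]; field_simp; ring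
  refine (norm_angAvg_le (continuous_radial (by norm_num) hx') (by fun_prop) hpt).trans
    (le_of_eq ?_)
  rw [angAvg_add (by fun_prop) (by fun_prop), angAvg_const_mul, angAvg_const_mul,
    angAvg_chord_sq hx', angAvg_dirComp_sq]
  field_simp

end LensingCharFun

/-! ### Inversion of a Gaussian times a quadratic polynomial. -/

section GaussianInversion

/-- The Fourier transform of `s ^ k * exp (-b s²)` at `-v`. -/
def gaussMoment (b v : ℝ) (k : ℕ) : ℂ :=
  ∫ s : ℝ, (s : ℂ) ^ k * (cexp (-(v * s : ℝ) * I) * (Real.exp (-b * s ^ 2) : ℝ))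

variable {b : ℝ}

lemma integrable_gaussMoment (hb : 0 < b) (v : ℝ) (k : ℕ) :
    Integrable fun s : ℝ => (s : ℂ) ^ k * (cexp (-(v * s : ℝ) * I) * (Real.exp (-b * s ^ 2) : ℝ)) := by
  have h := integrable_rpow_mul_exp_neg_mul_sq hb (s := k)
    (by have : (0 : ℝ) ≤ k := Nat.cast_nonneg k
        linarith)
  refine h.mono (Continuous.aestronglyMeasurable (by fun_prop)) (ae_of_all _ fun s => ?_)
  rw [norm_mul, norm_mul, norm_mul, ← ofReal_neg, norm_exp_ofReal_mul_I, one_mul, norm_real,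
    Real.rpow_natCast, norm_pow, norm_pow, norm_real]

lemma gaussMoment_zero (hb : 0 < b) (v : ℝ) :
    gaussMoment b v 0 = (√(Real.pi / b) * Real.exp (-v ^ 2 / (4 * b)) : ℝ) := by
  have h := fourierIntegral_gaussian (b := b) (by simpa using hb) (-v)
  have e : gaussMoment b v 0 = ∫ s : ℝ, cexp (I * (-v : ℂ) * s) * cexp (-(b : ℂ) * s ^ 2) := by
    rw [gaussMoment]
    congr 1 with s
    rw [pow_zero, one_mul]
    push_cast
    congr 2
    ring
  rw [e, h]
  have h1 : ((Real.pi : ℂ) / b) ^ (1 / 2 : ℂ) = ((√(Real.pi / b) : ℝ) : ℂ) := by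
    rw [Real.sqrt_eq_rpow, ofReal_cpow (by positivity)]
    push_cast
    rfl
  rw [h1]
  push_cast
  congr 2
  ring

/-- The integral over ℝ of the derivative of the integrand for k = 0 vanishes; `gaussMoment_two`
uses that for k = 1. -/
lemma gaussMoment_one (hb : 0 < b) (v : ℝ) :
    gaussMoment b v 1 = -(v * I / (2 * b)) * gaussMoment b v 0 := by
  have i0 := integrable_gaussMoment hb v 0
  have i1 := integrable_gaussMoment hb v 1
  have hd : ∀ s : ℝ, HasDerivAt
      (fun s : ℝ => (s : ℂ) ^ 0 * (cexp (-(v * s : ℝ) * I) * (Real.exp (-b * s ^ 2) : ℝ)))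
      (-(v * I) * ((s : ℂ) ^ 0 * (cexp (-(v * s : ℝ) * I) * (Real.exp (-b * s ^ 2) : ℝ)))
        - 2 * b * ((s : ℂ) ^ 1 * (cexp (-(v * s : ℝ) * I) * (Real.exp (-b * s ^ 2) : ℝ)))) s := by
    intro s
    have h1 : HasDerivAt (fun s : ℝ => cexp (-(v * s : ℝ) * I))
        (cexp (-(v * s : ℝ) * I) * (-(v * 1 : ℝ) * I)) s :=
      ((((hasDerivAt_id s).const_mul v).ofReal_comp.neg).mul_const I).cexp
    have h2 : HasDerivAt (fun s : ℝ => ((Real.exp (-b * s ^ 2) : ℝ) : ℂ))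
        ((Real.exp (-b * s ^ 2) * (-b * (2 * s)) : ℝ) : ℂ) s := by
      have h3 : HasDerivAt (fun s : ℝ => -b * s ^ 2) (-b * (2 * s)) s := by
        simpa using (hasDerivAt_pow 2 s).const_mul (-b)
      exact h3.exp.ofReal_comp
    simp only [pow_zero, one_mul]
    refine (h1.mul h2).congr_deriv ?_
    push_cast
    ring
  have h := integral_eq_zero_of_hasDerivAt_of_integrable hd
    ((i0.const_mul _).sub (i1.const_mul _)) i0
  rw [integral_sub (i0.const_mul _) (i1.const_mul _), integral_const_mul, integral_const_mul] at h
  have hb' : (b : ℂ) ≠ 0 := by exact_mod_cast hb.ne'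
  have h' : -(v * I) * gaussMoment b v 0 - 2 * b * gaussMoment b v 1 = 0 := h
  field_simp
  linear_combination -h'

lemma gaussMoment_two (hb : 0 < b) (v : ℝ) :
    gaussMoment b v 2 = (1 - v ^ 2 / (2 * b)) / (2 * b) * gaussMoment b v 0 := by
  have i0 := integrable_gaussMoment hb v 0
  have i1 := integrable_gaussMoment hb v 1
  have i2 := integrable_gaussMoment hb v 2
  have hd : ∀ s : ℝ, HasDerivAt
      (fun s : ℝ => (s : ℂ) ^ 1 * (cexp (-(v * s : ℝ) * I) * (Real.exp (-b * s ^ 2) : ℝ)))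
      ((s : ℂ) ^ 0 * (cexp (-(v * s : ℝ) * I) * (Real.exp (-b * s ^ 2) : ℝ))
        - v * I * ((s : ℂ) ^ 1 * (cexp (-(v * s : ℝ) * I) * (Real.exp (-b * s ^ 2) : ℝ)))
        - 2 * b * ((s : ℂ) ^ 2 * (cexp (-(v * s : ℝ) * I) * (Real.exp (-b * s ^ 2) : ℝ)))) s := by
    intro s
    have h1 : HasDerivAt (fun s : ℝ => cexp (-(v * s : ℝ) * I))
        (cexp (-(v * s : ℝ) * I) * (-(v * 1 : ℝ) * I)) s :=
      ((((hasDerivAt_id s).const_mul v).ofReal_comp.neg).mul_const I).cexp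
    have h2 : HasDerivAt (fun s : ℝ => ((Real.exp (-b * s ^ 2) : ℝ) : ℂ))
        ((Real.exp (-b * s ^ 2) * (-b * (2 * s)) : ℝ) : ℂ) s := by
      have h3 : HasDerivAt (fun s : ℝ => -b * s ^ 2) (-b * (2 * s)) s := by
        simpa using (hasDerivAt_pow 2 s).const_mul (-b)
      exact h3.exp.ofReal_comp
    have h0 : HasDerivAt (fun s : ℝ => (s : ℂ)) 1 s := ofRealCLM.hasDerivAt
    simp only [pow_zero, one_mul, pow_one]
    refine (h0.mul (h1.mul h2)).congr_deriv ?_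
    simp only [Pi.mul_apply]
    push_cast
    ring
  have h := integral_eq_zero_of_hasDerivAt_of_integrable hd
    ((i0.sub (i1.const_mul _)).sub (i2.const_mul _)) i1
  have i01 : Integrable fun s : ℝ =>
      (s : ℂ) ^ 0 * (cexp (-(v * s : ℝ) * I) * (Real.exp (-b * s ^ 2) : ℝ))
        - v * I * ((s : ℂ) ^ 1 * (cexp (-(v * s : ℝ) * I) * (Real.exp (-b * s ^ 2) : ℝ))) :=
    i0.sub (i1.const_mul _)
  rw [integral_sub i01 (i2.const_mul _), integral_sub i0 (i1.const_mul _),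
    integral_const_mul, integral_const_mul] at h
  have hb' : (b : ℂ) ≠ 0 := by exact_mod_cast hb.ne'
  have h' : gaussMoment b v 0 - v * I * gaussMoment b v 1 - 2 * b * gaussMoment b v 2 = 0 := h
  rw [gaussMoment_one hb] at h'
  field_simp
  field_simp at h'
  rw [I_sq] at h'
  linear_combination -h'

/-- The product of a Gaussian characteristic function with a quadratic polynomial. -/
def gaussCharFun (a β : Plane) (σ d : ℝ) (t : Plane) : ℂ :=
  cexp ((⟪a, t⟫ : ℝ) * I) * ((Real.exp (-(σ ^ 2 * ‖t‖ ^ 2 / 2)) : ℝ) *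
    (1 - (⟪β, t⟫ : ℝ) * I - (d * ‖t‖ ^ 2 : ℝ)))

/-- The inverse Fourier transform of `gaussCharFun`. -/
def gaussApprox (a β : Plane) (σ d : ℝ) (q : Plane) : ℝ :=
  gaussianTwo a σ q * (1 - (β 0 * (q 0 - a 0) + β 1 * (q 1 - a 1)) / σ ^ 2
    + d * (((q 0 - a 0) ^ 2 + (q 1 - a 1) ^ 2 - 2 * σ ^ 2) / σ ^ 4))

lemma integrable_gaussMoment_mul {σ : ℝ} (hσ : 0 < σ) (v w : ℝ) (i j : ℕ) :
    Integrable fun p : ℝ × ℝ =>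
      ((p.1 : ℂ) ^ i * (cexp (-(v * p.1 : ℝ) * I) * (Real.exp (-(σ ^ 2 / 2) * p.1 ^ 2) : ℝ))) *
      ((p.2 : ℂ) ^ j * (cexp (-(w * p.2 : ℝ) * I) * (Real.exp (-(σ ^ 2 / 2) * p.2 ^ 2) : ℝ))) :=
  (integrable_gaussMoment (by positivity) v i).mul_prod
    (integrable_gaussMoment (by positivity) w j)

lemma cexp_mul_gaussCharFun (a β : Plane) (σ d : ℝ) (q t : Plane) :
    cexp (-((⟪q, t⟫ : ℝ)) * I) * gaussCharFun a β σ d t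
      = cexp (-((q 0 - a 0) * t 0 : ℝ) * I) * (Real.exp (-(σ ^ 2 / 2) * t 0 ^ 2) : ℝ) *
        (cexp (-((q 1 - a 1) * t 1 : ℝ) * I) * (Real.exp (-(σ ^ 2 / 2) * t 1 ^ 2) : ℝ)) *
        (1 - β 0 * I * t 0 - β 1 * I * t 1 - d * t 0 ^ 2 - d * t 1 ^ 2) := by
  have e1 : cexp (-((⟪q, t⟫ : ℝ)) * I) * cexp ((⟪a, t⟫ : ℝ) * I)
      = cexp (-((q 0 - a 0) * t 0 : ℝ) * I) * cexp (-((q 1 - a 1) * t 1 : ℝ) * I) := by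
    rw [← Complex.exp_add, ← Complex.exp_add, plane_inner, plane_inner]
    congr 1; push_cast; ring
  have e2 : Real.exp (-(σ ^ 2 * ‖t‖ ^ 2 / 2))
      = Real.exp (-(σ ^ 2 / 2) * t 0 ^ 2) * Real.exp (-(σ ^ 2 / 2) * t 1 ^ 2) := by
    rw [← Real.exp_add, plane_norm_sq]; congr 1; ring
  rw [gaussCharFun, e2, ← mul_assoc, e1, plane_norm_sq, plane_inner]
  push_cast
  ring

lemma integrable_gaussCharFun (a β : Plane) {σ : ℝ} (hσ : 0 < σ) (d : ℝ) :
    Integrable (gaussCharFun a β σ d) := by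
  rw [← (measurePreserving_prodEquivPlane).integrable_comp_emb prodEquivPlane.measurableEmbedding]
  have h := fun i j => integrable_gaussMoment_mul hσ (-a 0) (-a 1) i j
  refine ((((h 0 0).sub ((h 1 0).const_mul (β 0 * I))).sub ((h 0 1).const_mul (β 1 * I))).sub
    ((h 2 0).const_mul (d : ℂ))).sub ((h 0 2).const_mul (d : ℂ)) |>.congr (ae_of_all _ fun p => ?_)
  have h2 := cexp_mul_gaussCharFun a β σ d 0 !₂[p.1, p.2]
  simp only [inner_zero_left, ofReal_zero, neg_zero, zero_mul, Complex.exp_zero, one_mul,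
    PiLp.zero_apply, zero_sub] at h2
  simp only [Pi.sub_apply, Function.comp_apply, prodEquivPlane_apply]
  rw [h2]
  simp
  ring

/-- The transform factors over the two coordinates, so the planar integral is a combination of
products of one-dimensional moments. -/
lemma gaussApprox_eq_invCharFun (a β : Plane) {σ : ℝ} (hσ : 0 < σ) (d : ℝ) (q : Plane) :
    (gaussApprox a β σ d q : ℂ) = invCharFun (gaussCharFun a β σ d) q := by
  set v := q 0 - a 0 with hv
  set w := q 1 - a 1 with hw
  set b := σ ^ 2 / 2 with hb
  have hb0 : 0 < b := by positivity
  have hint : ∫ t, cexp (-((⟪q, t⟫ : ℝ)) * I) * gaussCharFun a β σ d t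
      = gaussMoment b v 0 * gaussMoment b w 0 - β 0 * I * (gaussMoment b v 1 * gaussMoment b w 0)
        - β 1 * I * (gaussMoment b v 0 * gaussMoment b w 1)
        - d * (gaussMoment b v 2 * gaussMoment b w 0)
        - d * (gaussMoment b v 0 * gaussMoment b w 2) := by
    simp only [cexp_mul_gaussCharFun, ← hv, ← hw]
    rw [integral_plane_eq_prod]
    have h := fun i j => integrable_gaussMoment_mul hσ v w i j
    simp only [gaussMoment, ← integral_prod_mul]
    rw [← integral_const_mul, ← integral_const_mul, ← integral_const_mul, ← integral_const_mul,
      ← Measure.volume_eq_prod, ← integral_sub (h 0 0) ((h 1 0).const_mul _),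
      ← integral_sub (by exact (h 0 0).sub ((h 1 0).const_mul _)) ((h 0 1).const_mul _),
      ← integral_sub (by exact ((h 0 0).sub ((h 1 0).const_mul _)).sub ((h 0 1).const_mul _))
        ((h 2 0).const_mul _),
      ← integral_sub (by exact (((h 0 0).sub ((h 1 0).const_mul _)).sub
        ((h 0 1).const_mul _)).sub ((h 2 0).const_mul _)) ((h 0 2).const_mul _)]
    congr 1 with p
    simp
    ring
  have hg : gaussMoment b v 0 * gaussMoment b w 0
      = ((2 * Real.pi / σ ^ 2 * Real.exp (-(v ^ 2 + w ^ 2) / (2 * σ ^ 2)) : ℝ) : ℂ) := by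
    rw [gaussMoment_zero hb0, gaussMoment_zero hb0, ← ofReal_mul]
    congr 1
    have h1 : √(Real.pi / b) * √(Real.pi / b) = 2 * Real.pi / σ ^ 2 := by
      rw [Real.mul_self_sqrt (by positivity), hb]; field_simp
    have h2 : Real.exp (-v ^ 2 / (4 * b)) * Real.exp (-w ^ 2 / (4 * b))
        = Real.exp (-(v ^ 2 + w ^ 2) / (2 * σ ^ 2)) := by
      rw [← Real.exp_add, hb]; congr 1; field_simp; ring
    rw [← h1, ← h2]; ring
  have hd : Module.finrank ℝ Plane = 2 := by simp
  have hσ' : (σ : ℂ) ≠ 0 := by exact_mod_cast hσ.ne'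
  have hpi : (Real.pi : ℂ) ≠ 0 := by exact_mod_cast Real.pi_ne_zero
  rw [invCharFun, hint, gaussMoment_one hb0, gaussMoment_one hb0, gaussMoment_two hb0,
    gaussMoment_two hb0, hd, real_smul]
  have e : gaussMoment b v 0 * gaussMoment b w 0
        - β 0 * I * (-(v * I / (2 * b)) * gaussMoment b v 0 * gaussMoment b w 0)
        - β 1 * I * (gaussMoment b v 0 * (-(w * I / (2 * b)) * gaussMoment b w 0))
        - d * ((1 - v ^ 2 / (2 * b)) / (2 * b) * gaussMoment b v 0 * gaussMoment b w 0)
        - d * (gaussMoment b v 0 * ((1 - w ^ 2 / (2 * b)) / (2 * b) * gaussMoment b w 0))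
      = (gaussMoment b v 0 * gaussMoment b w 0) * (1 - (β 0 * v + β 1 * w) / σ ^ 2
        + d * ((v ^ 2 + w ^ 2 - 2 * σ ^ 2) / σ ^ 4)) := by
    generalize gaussMoment b v 0 = x
    generalize gaussMoment b w 0 = y
    rw [hb]
    push_cast
    field_simp
    rw [I_sq]
    ring
  have hr : gaussApprox a β σ d q = ((2 * Real.pi) ^ 2)⁻¹ *
      (2 * Real.pi / σ ^ 2 * Real.exp (-(v ^ 2 + w ^ 2) / (2 * σ ^ 2)) *
      (1 - (β 0 * v + β 1 * w) / σ ^ 2 + d * ((v ^ 2 + w ^ 2 - 2 * σ ^ 2) / σ ^ 4))) := by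
    rw [gaussApprox, gaussianTwo, mul_pow, Real.sq_sqrt (by positivity), ← hv, ← hw]
    have := Real.pi_ne_zero
    field_simp
  rw [e, hg, hr]
  push_cast
  ring

end GaussianInversion

/-! ### Estimates for the normalized lensing map. -/

section LensingComparison

/-- The conditions on the number `g` of stars under which the estimates for the lensing map hold. -/
structure ManyStars (m : ℝ) (x : Plane) (g : ℕ) : Prop where
  le_g : 100 ≤ g
  one_le_log : 1 ≤ Real.log g
  norm_le : ‖x‖ ≤ discRadius g / 2
  one_le_radius : 1 ≤ discRadius g
  abs_log_constB_le : |Real.log (constB m)| ≤ Real.log g / 4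
  sq_log_log_le : Real.log (Real.log g) ^ 2 ≤ Real.log g
  mass_le : 2 * m ≤ √(discRadius g)
  log_mass_le : Real.log (2 * m) + 20 ≤ Real.log (discRadius g) / 4
  log_le : Real.log g / 4 ≤ Real.log (discRadius g)
  log_cube_le : Real.log g ^ 3 ≤ discRadius g ^ 4

lemma log_discRadius {g : ℕ} (hg : 0 < g) :
    Real.log (discRadius g) = (Real.log g - Real.log Real.pi) / 2 := by
  have : (0 : ℝ) < g := by exact_mod_cast hg
  rw [discRadius, Real.log_sqrt (by positivity), Real.log_div this.ne' Real.pi_ne_zero]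

lemma tendsto_log_natCast : Tendsto (fun g : ℕ => Real.log g) atTop atTop :=
  Real.tendsto_log_atTop.comp tendsto_natCast_atTop_atTop

lemma eventually_manyStars {m : ℝ} (x : Plane) : ∀ᶠ g in atTop, ManyStars m x g := by
  have hlog := tendsto_log_natCast
  have hR := tendsto_discRadius
  have h1 : ∀ᶠ L : ℝ in atTop, Real.log L ^ 2 ≤ L := by
    have := (Real.isLittleO_pow_log_id_atTop (n := 2)).bound one_pos
    filter_upwards [this, eventually_ge_atTop 0] with L hL hL0
    rw [one_mul, Real.norm_of_nonneg (sq_nonneg _), id, Real.norm_of_nonneg hL0] at hL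
    exact hL
  -- Used at y = g, where π⁻² g ≤ π⁻² g² = R⁴.
  have h2 : ∀ᶠ y : ℝ in atTop, Real.log y ^ 3 ≤ (Real.pi⁻¹) ^ 2 * y := by
    have := (Real.isLittleO_pow_log_id_atTop (n := 3)).bound (c := (Real.pi⁻¹) ^ 2)
      (by have := Real.pi_pos
          positivity)
    filter_upwards [this, eventually_ge_atTop 0] with L hL hL0
    rw [id, Real.norm_of_nonneg hL0] at hL
    exact (le_abs_self _).trans hL
  filter_upwards [eventually_ge_atTop 100, hlog.eventually_ge_atTop 1,
    hR.eventually_ge_atTop (2 * ‖x‖), hR.eventually_ge_atTop 1,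
    hlog.eventually_ge_atTop (4 * |Real.log (constB m)|), hlog.eventually h1,
    (Real.tendsto_sqrt_atTop.comp hR).eventually_ge_atTop (2 * m),
    (Real.tendsto_log_atTop.comp hR).eventually_ge_atTop (4 * (Real.log (2 * m) + 20)),
    hlog.eventually_ge_atTop (2 * Real.log Real.pi),
    tendsto_natCast_atTop_atTop.eventually h2] with g a1 a2 a3 a4 a5 a6 a7 a8 a9 a10
  simp only [Function.comp_apply] at a7 a8
  refine ⟨a1, a2, by linarith, a4, by linarith, a6, a7, by linarith, ?_, ?_⟩
  · rw [log_discRadius (by omega)]; linarith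
  · have hg1 : (1 : ℝ) ≤ g := by exact_mod_cast (by omega : 1 ≤ g)
    have : discRadius g ^ 4 = (Real.pi⁻¹) ^ 2 * (g : ℝ) ^ 2 := by
      rw [show 4 = 2 * 2 from rfl, pow_mul, discRadius_sq]; ring
    rw [this]
    refine a10.trans ?_
    have : (g : ℝ) ≤ (g : ℝ) ^ 2 := le_self_pow₀ hg1 (by norm_num)
    gcongr

variable {m : ℝ} {x : Plane} {g : ℕ}

lemma ManyStars.cast_pos (h : ManyStars m x g) : (0 : ℝ) < g := by
  have := h.le_g
  exact_mod_cast (by omega : 0 < g)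

lemma ManyStars.log_log_nonneg (h : ManyStars m x g) : 0 ≤ Real.log (Real.log g) :=
  Real.log_nonneg h.one_le_log

lemma ManyStars.sq_sigmaStar (h : ManyStars m x g) (hm : 0 < m) :
    sigmaStar m g ^ 2
      = kappaStar m ^ 2 / Real.pi * ((Real.log (constB m) + Real.log g / 2) / Real.log g) := by
  have hg := h.cast_pos
  have hL := h.one_le_log
  have hB := abs_le.1 h.abs_log_constB_le
  have hκ : 0 < kappaStar m := mul_pos Real.pi_pos hm
  have hB0 : 0 < constB m := by
    have := Real.pi_pos
    rw [constB]; positivity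
  have e : Real.log (constB m * √(g : ℝ)) = Real.log (constB m) + Real.log g / 2 := by
    rw [Real.log_mul hB0.ne' (Real.sqrt_pos.2 hg).ne', Real.log_sqrt hg.le]
  rw [sigmaStar, e, mul_pow, div_pow, Real.sq_sqrt Real.pi_pos.le, Real.sq_sqrt]
  exact div_nonneg (by linarith [hB.1]) (by linarith)

lemma ManyStars.le_sq_sigmaStar (h : ManyStars m x g) (hm : 0 < m) :
    kappaStar m ^ 2 / (4 * Real.pi) ≤ sigmaStar m g ^ 2 := by
  have hL := h.one_le_log
  have hB := abs_le.1 h.abs_log_constB_le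
  have hpi := Real.pi_pos
  rw [h.sq_sigmaStar hm]
  have : 1 / 4 ≤ (Real.log (constB m) + Real.log g / 2) / Real.log g := by
    rw [le_div_iff₀ (by linarith)]; linarith [hB.1]
  calc kappaStar m ^ 2 / (4 * Real.pi) = kappaStar m ^ 2 / Real.pi * (1 / 4) := by field_simp
    _ ≤ _ := by gcongr

lemma ManyStars.sq_sigmaStar_le (h : ManyStars m x g) (hm : 0 < m) :
    sigmaStar m g ^ 2 ≤ kappaStar m ^ 2 / Real.pi := by
  have hL := h.one_le_log
  have hB := abs_le.1 h.abs_log_constB_le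
  have hpi := Real.pi_pos
  rw [h.sq_sigmaStar hm]
  have : (Real.log (constB m) + Real.log g / 2) / Real.log g ≤ 1 := by
    rw [div_le_iff₀ (by linarith)]; linarith [hB.2]
  calc _ ≤ kappaStar m ^ 2 / Real.pi * 1 := by gcongr
    _ = _ := mul_one _

lemma ManyStars.sigmaStar_pos (h : ManyStars m x g) (hm : 0 < m) : 0 < sigmaStar m g := by
  have hκ : 0 < kappaStar m := mul_pos Real.pi_pos hm
  have hpi := Real.pi_pos
  have h1 := h.le_sq_sigmaStar hm
  have h2 : 0 < kappaStar m ^ 2 / (4 * Real.pi) := by positivity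
  have h3 : 0 ≤ sigmaStar m g := by rw [sigmaStar]; positivity
  exact lt_of_le_of_ne h3 fun h0 => by rw [← h0] at h1; norm_num at h1; linarith

/-- The part of the exponent of the approximate characteristic function that is expanded. -/
def lensingCorrection (m : ℝ) (x : Plane) (g : ℕ) (s : Plane) : ℂ :=
  (⟪(kappaStar m / √(Real.log g)) • x, s⟫ : ℝ) * I
    + (kappaStar m ^ 2 / (4 * Real.pi) * (Real.log (Real.log g) / Real.log g) * ‖s‖ ^ 2 : ℝ)

/-- `exp (-lensingExponent m x g s)` approximates the characteristic function of the normalized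
lensing map, up to a translation. -/
def lensingExponent (m : ℝ) (x : Plane) (g : ℕ) (s : Plane) : ℂ :=
  (sigmaStar m g ^ 2 * ‖s‖ ^ 2 / 2 : ℝ) + lensingCorrection m x g s

lemma ManyStars.re_lensingCorrection_nonneg (h : ManyStars m x g) (s : Plane) :
    0 ≤ (lensingCorrection m x g s).re := by
  have h1 := h.log_log_nonneg
  have h2 := h.one_le_log
  have hpi := Real.pi_pos
  rw [lensingCorrection, add_re, re_ofReal_mul, I_re, mul_zero, zero_add, ofReal_re]
  positivity

lemma ManyStars.le_re_lensingExponent (h : ManyStars m x g) (hm : 0 < m) (s : Plane) :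
    kappaStar m ^ 2 / (32 * Real.pi) * ‖s‖ ^ 2 ≤ (lensingExponent m x g s).re := by
  have h1 := h.re_lensingCorrection_nonneg s
  have h2 := h.le_sq_sigmaStar hm
  have hpi := Real.pi_pos
  rw [lensingExponent, add_re, ofReal_re]
  have h3 : kappaStar m ^ 2 / (32 * Real.pi) * ‖s‖ ^ 2
      = (1 / 4) * (kappaStar m ^ 2 / (4 * Real.pi) * ‖s‖ ^ 2 / 2) := by field_simp; ring
  have h4 : kappaStar m ^ 2 / (4 * Real.pi) * ‖s‖ ^ 2 / 2 ≤ sigmaStar m g ^ 2 * ‖s‖ ^ 2 / 2 := by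
    gcongr
  have h5 : 0 ≤ kappaStar m ^ 2 / (4 * Real.pi) * ‖s‖ ^ 2 / 2 := by positivity
  linarith

/-- The correction is O(1/√L) with L = log g, since log L ≤ √L. Its square is O(1/L), which is why
the linear term of its exponential suffices later. -/
lemma ManyStars.norm_lensingCorrection_le (h : ManyStars m x g) (hm : 0 < m) (s : Plane) :
    ‖lensingCorrection m x g s‖ ≤ (kappaStar m * ‖x‖ + kappaStar m ^ 2 / (4 * Real.pi))
      * (1 + ‖s‖) ^ 2 / √(Real.log g) := by
  have hκ : 0 < kappaStar m := mul_pos Real.pi_pos hm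
  have h1 := h.log_log_nonneg
  have h2 := h.one_le_log
  have h3 := h.sq_log_log_le
  have hpi := Real.pi_pos
  rw [lensingCorrection]
  set L := Real.log g
  have hL0 : 0 < L := by linarith
  have hs0 : 0 < √L := Real.sqrt_pos.2 hL0
  have hLs : √L ^ 2 = L := Real.sq_sqrt hL0.le
  have hll : Real.log L / L ≤ 1 / √L := by
    have : Real.log L ≤ √L := Real.le_sqrt_of_sq_le h3
    rw [div_le_div_iff₀ hL0 hs0]
    nlinarith
  have hll0 : 0 ≤ Real.log L / L := by positivity
  have hn := norm_nonneg s
  refine (norm_add_le _ _).trans ?_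
  rw [norm_mul, norm_I, mul_one, norm_real, norm_real, Real.norm_of_nonneg
    (show 0 ≤ kappaStar m ^ 2 / (4 * Real.pi) * (Real.log L / L) * ‖s‖ ^ 2 by positivity)]
  have b1 : ‖(⟪(kappaStar m / √L) • x, s⟫ : ℝ)‖ ≤ kappaStar m / √L * ‖x‖ * ‖s‖ := by
    refine (norm_inner_le_norm _ _).trans (le_of_eq ?_)
    rw [norm_smul, Real.norm_of_nonneg (by positivity)]
  have c1 : ‖s‖ ≤ (1 + ‖s‖) ^ 2 := by nlinarith
  have c2 : ‖s‖ ^ 2 ≤ (1 + ‖s‖) ^ 2 := by gcongr; linarith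
  calc _ ≤ kappaStar m / √L * ‖x‖ * (1 + ‖s‖) ^ 2
        + kappaStar m ^ 2 / (4 * Real.pi) * (1 / √L) * (1 + ‖s‖) ^ 2 :=
        add_le_add (b1.trans (by gcongr)) (by gcongr)
    _ = _ := by ring

lemma ManyStars.norm_lensingExponent_le (h : ManyStars m x g) (hm : 0 < m) (s : Plane) :
    ‖lensingExponent m x g s‖ ≤ (kappaStar m * ‖x‖ + kappaStar m ^ 2) * (1 + ‖s‖) ^ 2 := by
  have hκ : 0 < kappaStar m := mul_pos Real.pi_pos hm
  have hpi := Real.pi_gt_three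
  have h1 := h.norm_lensingCorrection_le hm s
  have h2 := h.sq_sigmaStar_le hm
  have hn := norm_nonneg s
  have hs1 : 1 ≤ √(Real.log g) := Real.one_le_sqrt.2 h.one_le_log
  have c2 : ‖s‖ ^ 2 ≤ (1 + ‖s‖) ^ 2 := by gcongr; linarith
  rw [lensingExponent]
  refine (norm_add_le _ _).trans ?_
  rw [norm_real, Real.norm_of_nonneg (by positivity)]
  have h3 : kappaStar m ^ 2 / Real.pi ≤ kappaStar m ^ 2 := div_le_self (by positivity) (by linarith)
  have h4 : kappaStar m ^ 2 / (4 * Real.pi) ≤ kappaStar m ^ 2 / 2 :=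
    div_le_div_of_nonneg_left (by positivity) (by norm_num) (by linarith)
  have h5 : (kappaStar m * ‖x‖ + kappaStar m ^ 2 / (4 * Real.pi)) * (1 + ‖s‖) ^ 2
      / √(Real.log g) ≤ (kappaStar m * ‖x‖ + kappaStar m ^ 2 / 2) * (1 + ‖s‖) ^ 2 := by
    refine (div_le_self (by positivity) hs1).trans ?_
    gcongr
  calc _ ≤ kappaStar m ^ 2 * (1 + ‖s‖) ^ 2 / 2
        + (kappaStar m * ‖x‖ + kappaStar m ^ 2 / 2) * (1 + ‖s‖) ^ 2 := by
        refine add_le_add ?_ (h1.trans h5)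
        exact div_le_div_of_nonneg_right
          (mul_le_mul (h2.trans h3) c2 (by positivity) (by positivity)) (by norm_num)
    _ = _ := by ring

lemma sq_mul_abs_log_le_cube {s : ℝ} (hs : 0 ≤ s) : s ^ 2 * |Real.log s| ≤ (1 + s) ^ 3 := by
  rcases eq_or_lt_of_le hs with h0 | h0
  · rw [← h0]; norm_num
  · have h1 := Real.log_le_sub_one_of_pos h0
    have h2 := Real.one_sub_inv_le_log_of_pos h0
    have h3 : |Real.log s| ≤ s + s⁻¹ := by
      have := inv_pos.2 h0
      rw [abs_le]; constructor <;> linarith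
    calc s ^ 2 * |Real.log s| ≤ s ^ 2 * (s + s⁻¹) := by gcongr
      _ = s ^ 3 + s := by field_simp
      _ ≤ _ := by nlinarith [sq_nonneg s]

/-- At t = s/√L, log(|t|/R) is -(L + log L)/2 up to log|s| and a constant. The parts L and log L
reproduce σ* and the log log term. -/
lemma ManyStars.norm_radialCharFun_sub_one_sub_le (h : ManyStars m x g) (hm : 0 < m) (s : Plane) :
    ‖radialCharFun 1 2 m (discRadius g) x ((√(Real.log g))⁻¹ • s)
        - (1 - lensingExponent m x g s / g)‖
      ≤ (Real.pi * (m ^ 2 * (|Real.log m| + 10) + 16 * m ^ 3) + kappaStar m ^ 2 *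
        (1 + |Real.log (constB m) + Real.log Real.pi / 2|)) * (1 + ‖s‖) ^ 3 / (g * Real.log g) := by
  have hκ : 0 < kappaStar m := mul_pos Real.pi_pos hm
  have hpi := Real.pi_pos
  have hg := h.cast_pos
  have hL1 := h.one_le_log
  have hR1 := h.one_le_radius
  have hσ := h.sq_sigmaStar hm
  have hR2 : discRadius g ^ 2 = g / Real.pi := discRadius_sq g
  have hlR := log_discRadius (g := g) (by exact_mod_cast hg)
  set R := discRadius g with hRd
  set L := Real.log g with hLd
  have hR0 : 0 < R := by linarith
  have hL0 : 0 < L := by linarith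
  have hs0 : 0 < √L := Real.sqrt_pos.2 hL0
  have hLs : √L ^ 2 = L := Real.sq_sqrt hL0.le
  have hs1 : 1 ≤ √L := Real.one_le_sqrt.2 hL1
  set t : Plane := (√L)⁻¹ • s with ht
  have hnt : ‖t‖ = ‖s‖ / √L := by
    rw [ht, norm_smul, Real.norm_of_nonneg (by positivity)]; ring
  have hit : (⟪t, x⟫ : ℝ) = (⟪s, x⟫ : ℝ) / √L := by
    rw [ht, inner_smul_left]; simp; ring
  have hmain := norm_radialCharFun_lensing_sub_le (t := t) h.norm_le hR0 hm
  have hn := norm_nonneg s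
  -- The value of `constB` enters only through this constant, whose contribution is of the order of
  -- the error.
  set b₀ := Real.log (constB m) + Real.log Real.pi / 2 with hb₀
  have hval : (1 - (m * (⟪t, x⟫ : ℝ) / R ^ 2 : ℝ) * I
        + ((m * ‖t‖) ^ 2 * Real.log (‖t‖ / R) / (2 * R ^ 2) : ℝ)) - (1 - lensingExponent m x g s / g)
      = ((kappaStar m ^ 2 / (2 * Real.pi) * (‖s‖ ^ 2 * Real.log ‖s‖ + ‖s‖ ^ 2 * b₀) / (g * L) : ℝ)
        : ℂ) := by
    have e1 : (m * ‖t‖) ^ 2 * Real.log (‖t‖ / R) / (2 * R ^ 2)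
        = kappaStar m ^ 2 / (2 * Real.pi) * (‖s‖ ^ 2 * Real.log ‖s‖
          - ‖s‖ ^ 2 * (Real.log L / 2 + (L - Real.log Real.pi) / 2)) / (g * L) := by
      rcases eq_or_lt_of_le hn with h0 | h0
      · rw [hnt, ← h0]; simp
      · have : Real.log (‖t‖ / R)
            = Real.log ‖s‖ - (Real.log L / 2 + (L - Real.log Real.pi) / 2) := by
          rw [hnt, Real.log_div (by positivity) hR0.ne', Real.log_div h0.ne' hs0.ne',
            Real.log_sqrt hL0.le, hlR]
          ring
        rw [this, hnt, mul_pow, div_pow, hLs, hR2, kappaStar]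
        field_simp
    have e2 : m * (⟪t, x⟫ : ℝ) / R ^ 2 = kappaStar m / √L * (⟪x, s⟫ : ℝ) / g := by
      rw [hit, hR2, real_inner_comm x s, kappaStar]; field_simp
    have e3 : sigmaStar m g ^ 2 * ‖s‖ ^ 2 / 2 + kappaStar m ^ 2 / (4 * Real.pi) *
          (Real.log L / L) * ‖s‖ ^ 2
        = kappaStar m ^ 2 / (2 * Real.pi) *
          (‖s‖ ^ 2 * (Real.log (constB m) + L / 2 + Real.log L / 2)) / L := by
      rw [hσ]; field_simp; ring
    have e4 : lensingExponent m x g s = (kappaStar m / √L * (⟪x, s⟫ : ℝ) : ℝ) * I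
        + ((sigmaStar m g ^ 2 * ‖s‖ ^ 2 / 2 + kappaStar m ^ 2 / (4 * Real.pi) *
          (Real.log L / L) * ‖s‖ ^ 2 : ℝ) : ℂ) := by
      rw [lensingExponent, lensingCorrection, ← hLd, inner_smul_left]
      simp only [conj_trivial]
      push_cast
      ring
    rw [e1, e2, e4, e3, hb₀]
    have hLc : (L : ℂ) ≠ 0 := by exact_mod_cast hL0.ne'
    have hgc : (g : ℂ) ≠ 0 := by exact_mod_cast hg.ne'
    push_cast
    field_simp
    ring
  have hb2 : |kappaStar m ^ 2 / (2 * Real.pi) * (‖s‖ ^ 2 * Real.log ‖s‖ + ‖s‖ ^ 2 * b₀) / (g * L)|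
      ≤ kappaStar m ^ 2 * (1 + |b₀|) * (1 + ‖s‖) ^ 3 / (g * L) := by
    rw [abs_div, abs_mul, abs_of_pos (show 0 < (g : ℝ) * L by positivity),
      abs_of_pos (show 0 < kappaStar m ^ 2 / (2 * Real.pi) by positivity)]
    refine div_le_div_of_nonneg_right ?_ (by positivity)
    have c0 : kappaStar m ^ 2 / (2 * Real.pi) ≤ kappaStar m ^ 2 :=
      div_le_self (by positivity) (by linarith [Real.pi_gt_three])
    have c1 := sq_mul_abs_log_le_cube hn
    have c2 : ‖s‖ ^ 2 ≤ (1 + ‖s‖) ^ 3 := by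
      have : 0 ≤ ‖s‖ ^ 3 := by positivity
      nlinarith [sq_nonneg ‖s‖]
    have c3 : |‖s‖ ^ 2 * Real.log ‖s‖ + ‖s‖ ^ 2 * b₀| ≤ (1 + |b₀|) * (1 + ‖s‖) ^ 3 := by
      refine (abs_add_le _ _).trans ?_
      rw [abs_mul, abs_mul, abs_of_nonneg (sq_nonneg ‖s‖)]
      calc _ ≤ (1 + ‖s‖) ^ 3 + (1 + ‖s‖) ^ 3 * |b₀| := by gcongr
        _ = _ := by ring
    rw [mul_assoc]
    gcongr
  have herr : (m ^ 2 * (|Real.log m| + 10) * ‖t‖ ^ 2 + 16 * m ^ 3 * ‖t‖ ^ 3 / R) / R ^ 2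
      ≤ Real.pi * (m ^ 2 * (|Real.log m| + 10) + 16 * m ^ 3) * (1 + ‖s‖) ^ 3 / (g * L) := by
    have c2 : ‖s‖ ^ 2 ≤ (1 + ‖s‖) ^ 3 := by
      have : 0 ≤ ‖s‖ ^ 3 := by positivity
      nlinarith [sq_nonneg ‖s‖]
    have d2 : ‖t‖ ^ 2 ≤ (1 + ‖s‖) ^ 3 / L := by
      rw [hnt, div_pow, hLs]; gcongr
    have d3 : ‖t‖ ^ 3 / R ≤ (1 + ‖s‖) ^ 3 / L := by
      refine (div_le_self (by positivity) hR1).trans ?_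
      rw [hnt, div_pow]
      have : L ≤ √L ^ 3 := by rw [pow_succ, hLs]; exact le_mul_of_one_le_right hL0.le hs1
      gcongr
      linarith
    have hR2i : (R ^ 2)⁻¹ = Real.pi / g := by rw [hR2, inv_div]
    rw [div_eq_mul_inv, hR2i, mul_div_assoc (16 * m ^ 3)]
    calc _ ≤ (m ^ 2 * (|Real.log m| + 10) * ((1 + ‖s‖) ^ 3 / L)
          + 16 * m ^ 3 * ((1 + ‖s‖) ^ 3 / L)) * (Real.pi / g) := by gcongr
      _ = _ := by field_simp
  have htri := norm_sub_le_norm_sub_add_norm_sub (radialCharFun 1 2 m R x t)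
    (1 - (m * (⟪t, x⟫ : ℝ) / R ^ 2 : ℝ) * I
        + ((m * ‖t‖) ^ 2 * Real.log (‖t‖ / R) / (2 * R ^ 2) : ℝ)) (1 - lensingExponent m x g s / g)
  rw [hval, norm_real, Real.norm_eq_abs] at htri
  refine htri.trans ((add_le_add (hmain.trans herr) hb2).trans (le_of_eq ?_))
  ring

lemma ManyStars.norm_exp_sub_one_sub_le (h : ManyStars m x g) (hm : 0 < m) (s : Plane) :
    ‖cexp (-(lensingExponent m x g s / g)) - (1 - lensingExponent m x g s / g)‖
      ≤ (kappaStar m * ‖x‖ + kappaStar m ^ 2) ^ 2 * (1 + ‖s‖) ^ 4 / (g * Real.log g) := by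
  have hg := h.cast_pos
  have hL1 := h.one_le_log
  have hLg : Real.log g ≤ g := Real.log_le_self hg.le
  have hn := h.norm_lensingExponent_le hm s
  have hre := h.le_re_lensingExponent hm s
  have hκ : 0 < kappaStar m := mul_pos Real.pi_pos hm
  have hpi := Real.pi_pos
  set M := lensingExponent m x g s
  have hre0 : 0 ≤ M.re := le_trans (by positivity) hre
  have hz : (-(M / g)).re ≤ 0 := by
    rw [neg_re, div_natCast_re]
    have : 0 ≤ M.re / g := by positivity
    linarith
  have h1 := norm_exp_sub_sum_le_of_re_nonpos 2 hz
  simp only [Finset.sum_range_succ, Finset.sum_range_zero, Nat.factorial, pow_zero, pow_one,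
    norm_neg, norm_div, norm_natCast] at h1
  norm_num at h1
  rw [← sub_eq_add_neg] at h1
  refine h1.trans ?_
  calc (‖M‖ / g) ^ 2 / 2 ≤ (‖M‖ / g) ^ 2 := div_le_self (by positivity) (by norm_num)
    _ ≤ ((kappaStar m * ‖x‖ + kappaStar m ^ 2) * (1 + ‖s‖) ^ 2 / g) ^ 2 := by gcongr
    _ = (kappaStar m * ‖x‖ + kappaStar m ^ 2) ^ 2 * (1 + ‖s‖) ^ 4 / (g * g) := by ring
    _ ≤ _ := by gcongr

/-- The near region is |t| ≤ √R: there log(2m|t|/R) ≤ log(2m) - (log R)/2, which outweighs the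
constant 20 and leaves at most -L/16. This factor L compensates the normalization of s. -/
lemma ManyStars.norm_radialCharFun_le_exp (h : ManyStars m x g) (hm : 0 < m) {s : Plane}
    (hs : ‖s‖ ≤ √(Real.log g) * √(discRadius g)) :
    ‖radialCharFun 1 2 m (discRadius g) x ((√(Real.log g))⁻¹ • s)‖
      ≤ Real.exp (-(kappaStar m ^ 2 / (32 * Real.pi) * ‖s‖ ^ 2 / g)) := by
  have hpi := Real.pi_pos
  have hg := h.cast_pos
  have hL1 := h.one_le_log
  have hR1 := h.one_le_radius
  have hmR := h.mass_le
  have hlm := h.log_mass_le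
  have hll := h.log_le
  have hR2 : discRadius g ^ 2 = g / Real.pi := discRadius_sq g
  set R := discRadius g with hRd
  set L := Real.log g with hLd
  have hR0 : 0 < R := by linarith
  have hL0 : 0 < L := by linarith
  have hs0 : 0 < √L := Real.sqrt_pos.2 hL0
  have hr0 : 0 < √R := Real.sqrt_pos.2 hR0
  have hRs : √R * √R = R := Real.mul_self_sqrt hR0.le
  have hLs : √L ^ 2 = L := Real.sq_sqrt hL0.le
  set t : Plane := (√L)⁻¹ • s with ht
  have hnt : ‖t‖ = ‖s‖ / √L := by
    rw [ht, norm_smul, Real.norm_of_nonneg (by positivity)]; ring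
  have htR : ‖t‖ ≤ √R := by rw [hnt, div_le_iff₀ hs0]; linarith
  have hmt : 2 * m * ‖t‖ ≤ R := by rw [← hRs]; gcongr
  refine (norm_radialCharFun_lensing_le h.norm_le hR0 hm hmt).trans ?_
  have key : (m * ‖t‖) ^ 2 / (2 * R ^ 2) * (Real.log (2 * m * ‖t‖ / R) + 20)
      ≤ (m * ‖t‖) ^ 2 / (2 * R ^ 2) * (-(L / 16)) := by
    rcases eq_or_lt_of_le (norm_nonneg t) with h0 | h0
    · rw [← h0]; simp
    · have h1 : Real.log (2 * m * ‖t‖ / R) ≤ Real.log (2 * m) - Real.log R / 2 := by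
        have e : Real.log (2 * m) - Real.log R / 2 = Real.log (2 * m * √R / R) := by
          rw [Real.log_div (by positivity) hR0.ne', Real.log_mul (by positivity) hr0.ne',
            Real.log_sqrt hR0.le]
          ring
        rw [e]
        exact Real.log_le_log (by positivity) (by gcongr)
      gcongr
      linarith
  have e : (m * ‖t‖) ^ 2 / (2 * R ^ 2) * (-(L / 16))
      = -(kappaStar m ^ 2 / (32 * Real.pi) * ‖s‖ ^ 2 / g) := by
    rw [hnt, mul_pow, div_pow, hLs, hR2, kappaStar]; field_simp; ring
  rw [e] at key
  linarith [Real.add_one_le_exp (-(kappaStar m ^ 2 / (32 * Real.pi) * ‖s‖ ^ 2 / g))]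

/-- In the far region |t| > √R no expansion is valid, but the uniform polynomial decay is already
smaller than any needed power of L. -/
lemma exists_norm_radialCharFun_pow_le (hm : 0 < m) (x : Plane) :
    ∃ C : ℝ, 0 < C ∧ ∀ g, ManyStars m x g → ∀ s : Plane,
      √(Real.log g) * √(discRadius g) < ‖s‖ →
      ‖radialCharFun 1 2 m (discRadius g) x ((√(Real.log g))⁻¹ • s)‖ ^ g
        ≤ C * (Real.log g)⁻¹ * ((1 + ‖s‖) ^ 3)⁻¹ := by
  obtain ⟨c, hc0, hc1, hdec⟩ := exists_norm_radialCharFun_le (k := 1) (p := 2) (by norm_num) hm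
  have hpi := Real.pi_pos
  set c' := c * m ^ 2 * Real.pi / 192 with hc'
  have hc'0 : 0 < c' := by positivity
  obtain ⟨K, hK0, hK⟩ := exists_one_add_sq_le hc'0
  refine ⟨Real.exp (Real.pi * ‖x‖ ^ 2) * K ^ 6, by positivity, fun g h s hs => ?_⟩
  have hg := h.cast_pos
  have hL1 := h.one_le_log
  have hR1 := h.one_le_radius
  have hcube := h.log_cube_le
  have hx := h.norm_le
  have hg100 := h.le_g
  have hR2 : discRadius g ^ 2 = g / Real.pi := discRadius_sq g
  set R := discRadius g with hRd
  set L := Real.log g with hLd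
  have hR0 : 0 < R := by linarith
  have hL0 : 0 < L := by linarith
  have hs0 : 0 < √L := Real.sqrt_pos.2 hL0
  have hs1 : 1 ≤ √L := Real.one_le_sqrt.2 hL1
  have hRs : √R ^ 2 = R := Real.sq_sqrt hR0.le
  have hLs : √L ^ 2 = L := Real.sq_sqrt hL0.le
  set t : Plane := (√L)⁻¹ • s with ht
  have hnt : ‖t‖ = ‖s‖ / √L := by
    rw [ht, norm_smul, Real.norm_of_nonneg (by positivity)]; ring
  set τ := ‖t‖ with hτ
  have hsτ : ‖s‖ = √L * τ := by rw [hnt]; field_simp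
  have hτR : √R ≤ τ := by
    rw [hnt, le_div_iff₀ hs0]; linarith
  have hτ0 : 0 ≤ τ := (Real.sqrt_nonneg R).trans hτR
  have hRτ : R ≤ τ ^ 2 := by rw [← hRs]; gcongr
  set X := c * (m * τ) ^ 2 / (4 * R ^ 2) with hX
  have hX0 : 0 ≤ X := by positivity
  have h1 : ‖radialCharFun 1 2 m R x t‖ ^ g
      ≤ Real.exp (Real.pi * ‖x‖ ^ 2) * ((1 + c' * τ ^ 2) ^ 6)⁻¹ := by
    refine (pow_le_pow_left₀ (norm_nonneg _) (hdec R x t (by linarith)) g).trans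
      ((inv_sqrt_sqrt_pow_le hX0 (sq_nonneg _) (n := 6) (by norm_num) (by omega)).trans
        (le_of_eq ?_))
    have e1 : (g : ℝ) * (‖x‖ / R) ^ 2 = Real.pi * ‖x‖ ^ 2 := by
      rw [div_pow, hR2]; field_simp
    have e2 : (g : ℝ) * X / (8 * (6 : ℕ)) = c' * τ ^ 2 := by
      rw [hX, hR2, hc']; push_cast; field_simp; ring
    rw [e1, e2]
  have h2 : (1 + τ) ^ 12 ≤ K ^ 6 * (1 + c' * τ ^ 2) ^ 6 := by
    have := hK τ
    rw [abs_of_nonneg hτ0] at this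
    calc (1 + τ) ^ 12 = ((1 + τ) ^ 2) ^ 6 := by ring
      _ ≤ (K * (1 + c' * τ ^ 2)) ^ 6 := by gcongr
      _ = _ := mul_pow _ _ _
  -- From τ ≥ √R follows τ^8 ≥ R⁴ ≥ L³, which pays for the factor L and for the powers of √L in |s|
  -- = √L τ.
  have h3 : L * (1 + ‖s‖) ^ 3 ≤ (1 + τ) ^ 12 := by
    have a1 : 1 + ‖s‖ ≤ √L * (1 + τ) := by rw [hsτ]; linarith
    have a2 : √L ≤ L := by
      calc √L ≤ √L ^ 2 := le_self_pow₀ hs1 (by norm_num)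
        _ = L := hLs
    have a3 : √L ^ 3 ≤ L ^ 2 := by
      calc √L ^ 3 = √L ^ 2 * √L := by ring
        _ ≤ L * L := by rw [hLs]; gcongr
        _ = _ := by ring
    calc L * (1 + ‖s‖) ^ 3 ≤ L * (√L * (1 + τ)) ^ 3 := by gcongr
      _ = L * √L ^ 3 * (1 + τ) ^ 3 := by ring
      _ ≤ L * L ^ 2 * (1 + τ) ^ 3 := by gcongr
      _ = L ^ 3 * (1 + τ) ^ 3 := by ring
      _ ≤ R ^ 4 * (1 + τ) ^ 3 := by gcongr
      _ ≤ (τ ^ 2) ^ 4 * (1 + τ) ^ 3 := by gcongr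
      _ = τ ^ 8 * (1 + τ) ^ 3 := by ring
      _ ≤ (1 + τ) ^ 8 * (1 + τ) ^ 3 := by gcongr; linarith
      _ = (1 + τ) ^ 11 := by ring
      _ ≤ _ := pow_le_pow_right₀ (by linarith) (by norm_num)
  refine h1.trans ?_
  rw [mul_assoc, mul_assoc]
  refine mul_le_mul_of_nonneg_left ?_ (Real.exp_pos _).le
  rw [← mul_inv, ← div_eq_mul_inv, inv_eq_one_div, div_le_div_iff₀ (by positivity) (by positivity),
    one_mul]
  exact h3.trans h2

lemma exists_gaussian_decay {c : ℝ} (hc : 0 < c) : ∃ K : ℝ, 0 < K ∧ ∀ s : ℝ, 0 ≤ s →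
    (1 + s) ^ 4 * Real.exp (-(c * s ^ 2 / 2)) ≤ K * ((1 + s) ^ 3)⁻¹ := by
  obtain ⟨K, hK0, hK⟩ := exists_one_add_sq_le (c := c / 8) (by positivity)
  refine ⟨K ^ 4, by positivity, fun s hs => ?_⟩
  have h := hK s
  rw [abs_of_nonneg hs] at h
  rw [Real.exp_neg, ← div_eq_mul_inv, ← div_eq_mul_inv, div_le_div_iff₀ (Real.exp_pos _)
    (by positivity)]
  calc (1 + s) ^ 4 * (1 + s) ^ 3 = (1 + s) ^ 7 := by ring
    _ ≤ (1 + s) ^ 8 := pow_le_pow_right₀ (by linarith) (by norm_num)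
    _ = ((1 + s) ^ 2) ^ 4 := by ring
    _ ≤ (K * (1 + c / 8 * s ^ 2)) ^ 4 := by gcongr
    _ = K ^ 4 * (1 + c / 8 * s ^ 2) ^ 4 := mul_pow _ _ _
    _ ≤ K ^ 4 * Real.exp (c * s ^ 2 / 2) := by
      have : c * s ^ 2 / 2 = (4 : ℕ) * (c / 8 * s ^ 2) := by push_cast; ring
      rw [this, Real.exp_nat_mul]
      gcongr
      linarith [Real.add_one_le_exp (c / 8 * s ^ 2)]

end LensingComparison

/-! ### The density of the lensing map. -/

section LensingMap

variable {m : ℝ} {x : Plane} {g : ℕ}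

/-- Near region: φ and exp(-M/g), with M the exponent, agree to order 1/(gL) and share a Gaussian
modulus bound, so telescoping leaves 1/L times Gaussian decay. -/
lemma ManyStars.norm_radialCharFun_pow_sub_exp_le (h : ManyStars m x g) (hm : 0 < m) {s : Plane}
    (hs : ‖s‖ ≤ √(Real.log g) * √(discRadius g)) :
    ‖radialCharFun 1 2 m (discRadius g) x ((√(Real.log g))⁻¹ • s) ^ g
        - cexp (-lensingExponent m x g s)‖
      ≤ (Real.pi * (m ^ 2 * (|Real.log m| + 10) + 16 * m ^ 3) + kappaStar m ^ 2 *
        (1 + |Real.log (constB m) + Real.log Real.pi / 2|)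
        + (kappaStar m * ‖x‖ + kappaStar m ^ 2) ^ 2) * (Real.log g)⁻¹
        * ((1 + ‖s‖) ^ 4 * Real.exp (-(kappaStar m ^ 2 / (32 * Real.pi) * ‖s‖ ^ 2 / 2))) := by
  have hpi := Real.pi_pos
  have hg := h.cast_pos
  have hg2 : (2 : ℝ) ≤ g := by exact_mod_cast le_trans (by norm_num) h.le_g
  have hL0 : 0 < Real.log g := by linarith [h.one_le_log]
  have ha := h.norm_radialCharFun_le_exp hm hs
  have h1 := h.norm_radialCharFun_sub_one_sub_le hm s
  have h2 := h.norm_exp_sub_one_sub_le hm s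
  have hre := h.le_re_lensingExponent hm s
  have hb : ‖cexp (-(lensingExponent m x g s / g))‖
      ≤ Real.exp (-(kappaStar m ^ 2 / (32 * Real.pi) * ‖s‖ ^ 2 / g)) := by
    rw [Complex.norm_exp, neg_re, div_natCast_re]
    gcongr
  have hpow := norm_pow_sub_pow_le_mul ha hb g
  have e : cexp (-(lensingExponent m x g s / g)) ^ g = cexp (-lensingExponent m x g s) := by
    have : (g : ℂ) ≠ 0 := by exact_mod_cast hg.ne'
    rw [← Complex.exp_nat_mul]
    congr 1
    field_simp
  rw [e] at hpow
  refine hpow.trans ?_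
  rw [norm_sub_rev] at h2
  have h3 := (norm_sub_le_norm_sub_add_norm_sub _ _ _).trans (add_le_add h1 h2)
  set K₁ := Real.pi * (m ^ 2 * (|Real.log m| + 10) + 16 * m ^ 3) + kappaStar m ^ 2 *
        (1 + |Real.log (constB m) + Real.log Real.pi / 2|)
  set K₂ := (kappaStar m * ‖x‖ + kappaStar m ^ 2) ^ 2
  set c := kappaStar m ^ 2 / (32 * Real.pi)
  have hK₁ : 0 ≤ K₁ := by positivity
  have hc : 0 ≤ c := by positivity
  have hexp : Real.exp (-(c * ‖s‖ ^ 2 / g)) ^ (g - 1) ≤ Real.exp (-(c * ‖s‖ ^ 2 / 2)) := by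
    rw [← Real.exp_nat_mul, Real.exp_le_exp, Nat.cast_sub (by linarith [h.le_g]), Nat.cast_one]
    have a1 : ((g : ℝ) - 1) * -(c * ‖s‖ ^ 2 / g) = -(c * ‖s‖ ^ 2 * (((g : ℝ) - 1) / g)) := by
      ring
    have a2 : (1 : ℝ) / 2 ≤ ((g : ℝ) - 1) / g := by
      rw [div_le_div_iff₀ (by norm_num) hg]; linarith
    rw [a1, neg_le_neg_iff, div_eq_mul_one_div]
    gcongr
  have hn : 1 ≤ 1 + ‖s‖ := by linarith [norm_nonneg s]
  have h4 : K₁ * (1 + ‖s‖) ^ 3 / (g * Real.log g) + K₂ * (1 + ‖s‖) ^ 4 / (g * Real.log g)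
      ≤ (K₁ + K₂) * (1 + ‖s‖) ^ 4 / (g * Real.log g) := by
    rw [← add_div, add_mul _ K₂]
    have := pow_le_pow_right₀ hn (show 3 ≤ 4 by norm_num)
    exact div_le_div_of_nonneg_right
      (add_le_add_left (mul_le_mul_of_nonneg_left this hK₁) _) (by positivity)
  calc _ ≤ g * ((K₁ + K₂) * (1 + ‖s‖) ^ 4 / (g * Real.log g))
        * Real.exp (-(c * ‖s‖ ^ 2 / 2)) := by
        gcongr
        exact h3.trans h4
    _ = _ := by field_simp

/-- `gaussCharFun` is the Gaussian factor times the linearization of the correction. The correction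
has nonnegative real part, so the remainder is at most half its square. -/
lemma ManyStars.norm_exp_lensingExponent_sub_le (h : ManyStars m x g) (hm : 0 < m) (s : Plane) :
    ‖cexp (-lensingExponent m x g s) - gaussCharFun 0 ((kappaStar m / √(Real.log g)) • x)
        (sigmaStar m g) (kappaStar m ^ 2 / (4 * Real.pi) * (Real.log (Real.log g) / Real.log g)) s‖
      ≤ (kappaStar m * ‖x‖ + kappaStar m ^ 2 / (4 * Real.pi)) ^ 2 * (Real.log g)⁻¹
        * ((1 + ‖s‖) ^ 4 * Real.exp (-(kappaStar m ^ 2 / (32 * Real.pi) * ‖s‖ ^ 2 / 2))) := by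
  have hpi := Real.pi_pos
  have hL0 : 0 < Real.log g := by linarith [h.one_le_log]
  have hz := h.norm_lensingCorrection_le hm s
  have hzre := h.re_lensingCorrection_nonneg s
  have hσ := h.le_sq_sigmaStar hm
  have e : cexp (-lensingExponent m x g s) - gaussCharFun 0 ((kappaStar m / √(Real.log g)) • x)
        (sigmaStar m g) (kappaStar m ^ 2 / (4 * Real.pi) * (Real.log (Real.log g) / Real.log g)) s
      = (Real.exp (-(sigmaStar m g ^ 2 * ‖s‖ ^ 2 / 2)) : ℝ)
        * (cexp (-lensingCorrection m x g s) - (1 - lensingCorrection m x g s)) := by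
    rw [gaussCharFun, lensingExponent, inner_zero_left, neg_add, Complex.exp_add,
      lensingCorrection]
    push_cast
    rw [zero_mul, Complex.exp_zero]
    ring
  rw [e, norm_mul, norm_real, Real.norm_of_nonneg (Real.exp_pos _).le]
  set z := lensingCorrection m x g s
  have h1 := norm_exp_sub_sum_le_of_re_nonpos 2 (z := -z) (by rw [neg_re]; linarith)
  simp only [Finset.sum_range_succ, Finset.sum_range_zero, Nat.factorial, pow_zero, pow_one,
    norm_neg] at h1
  norm_num at h1
  rw [← sub_eq_add_neg] at h1
  have h2 : Real.exp (-(sigmaStar m g ^ 2 * ‖s‖ ^ 2 / 2))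
      ≤ Real.exp (-(kappaStar m ^ 2 / (32 * Real.pi) * ‖s‖ ^ 2 / 2)) := by
    have : kappaStar m ^ 2 / (32 * Real.pi) ≤ kappaStar m ^ 2 / (4 * Real.pi) := by
      gcongr; norm_num
    have := this.trans hσ
    gcongr
  have h3 : ‖z‖ ^ 2 / 2 ≤ (kappaStar m * ‖x‖ + kappaStar m ^ 2 / (4 * Real.pi)) ^ 2
      * (Real.log g)⁻¹ * (1 + ‖s‖) ^ 4 := by
    refine (div_le_self (by positivity) (by norm_num)).trans
      ((pow_le_pow_left₀ (norm_nonneg _) hz 2).trans (le_of_eq ?_))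
    rw [div_pow, Real.sq_sqrt hL0.le]
    ring
  calc _ ≤ Real.exp (-(kappaStar m ^ 2 / (32 * Real.pi) * ‖s‖ ^ 2 / 2))
        * ((kappaStar m * ‖x‖ + kappaStar m ^ 2 / (4 * Real.pi)) ^ 2
      * (Real.log g)⁻¹ * (1 + ‖s‖) ^ 4) := mul_le_mul h2 (h1.trans h3) (norm_nonneg _) (Real.exp_pos _).le
    _ = _ := by ring

lemma exists_norm_radialCharFun_pow_sub_gaussCharFun_le (hm : 0 < m) (x : Plane) :
    ∃ C : ℝ, ∀ᶠ g : ℕ in atTop, ∀ s : Plane,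
      ‖radialCharFun 1 2 m (discRadius g) x ((√(Real.log g))⁻¹ • s) ^ g
        - gaussCharFun 0 ((kappaStar m / √(Real.log g)) • x) (sigmaStar m g)
          (kappaStar m ^ 2 / (4 * Real.pi) * (Real.log (Real.log g) / Real.log g)) s‖
      ≤ C * (Real.log g)⁻¹ * ((1 + ‖s‖) ^ 3)⁻¹ := by
  have hpi := Real.pi_pos
  have hκ : 0 < kappaStar m := mul_pos Real.pi_pos hm
  obtain ⟨C₀, hC₀, hfar⟩ := exists_norm_radialCharFun_pow_le hm x
  obtain ⟨K, hK, hdec⟩ := exists_gaussian_decay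
    (c := kappaStar m ^ 2 / (32 * Real.pi)) (by positivity)
  set K₁ := Real.pi * (m ^ 2 * (|Real.log m| + 10) + 16 * m ^ 3) + kappaStar m ^ 2 *
        (1 + |Real.log (constB m) + Real.log Real.pi / 2|)
        + (kappaStar m * ‖x‖ + kappaStar m ^ 2) ^ 2 with hK₁
  set K₂ := (kappaStar m * ‖x‖ + kappaStar m ^ 2 / (4 * Real.pi)) ^ 2
  have hK₁0 : 0 ≤ K₁ := by positivity
  have hK₂0 : 0 ≤ K₂ := by positivity
  refine ⟨K₁ * K + C₀ + K + K₂ * K, ?_⟩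
  filter_upwards [eventually_manyStars (m := m) x] with g h s
  have hL0 : 0 < (Real.log g)⁻¹ := inv_pos.2 (by linarith [h.one_le_log])
  have hd := hdec ‖s‖ (norm_nonneg s)
  have h2 := (h.norm_exp_lensingExponent_sub_le hm s).trans
    (mul_le_mul_of_nonneg_left hd (by positivity))
  have hT : 0 < ((1 + ‖s‖) ^ 3)⁻¹ := by positivity
  set T := ((1 + ‖s‖) ^ 3)⁻¹
  have h1 : ‖radialCharFun 1 2 m (discRadius g) x ((√(Real.log g))⁻¹ • s) ^ g
        - cexp (-lensingExponent m x g s)‖ ≤ (K₁ * K + C₀ + K) * (Real.log g)⁻¹ * T := by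
    -- Beyond the threshold the power and the exponential are bounded separately; there |s| ≥ √L, so
    -- a polynomial factor in |s| converts into 1/L.
    rcases le_or_gt ‖s‖ (√(Real.log g) * √(discRadius g)) with hs | hs
    · refine ((h.norm_radialCharFun_pow_sub_exp_le hm hs).trans
        (mul_le_mul_of_nonneg_left hd (by positivity))).trans ?_
      have : 0 ≤ (C₀ + K) * (Real.log g)⁻¹ * T := by positivity
      rw [← hK₁]
      linarith
    · have a1 := hfar g h s hs
      have a2 : ‖cexp (-lensingExponent m x g s)‖ ≤ (Real.log g)⁻¹ * (K * T) := by
        have hre := h.le_re_lensingExponent hm s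
        have hL : Real.log g ≤ (1 + ‖s‖) ^ 4 := by
          have b1 : √(Real.log g) ≤ ‖s‖ := by
            refine le_trans ?_ hs.le
            exact le_mul_of_one_le_right (Real.sqrt_nonneg _) (Real.one_le_sqrt.2 h.one_le_radius)
          have hn := norm_nonneg s
          calc Real.log g = √(Real.log g) ^ 2 := (Real.sq_sqrt (by linarith [h.one_le_log])).symm
            _ ≤ ‖s‖ ^ 2 := by gcongr
            _ ≤ (1 + ‖s‖) ^ 2 := by gcongr; linarith
            _ ≤ (1 + ‖s‖) ^ 4 := pow_le_pow_right₀ (by linarith) (by norm_num)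
        rw [Complex.norm_exp, neg_re]
        refine le_trans ?_ (mul_le_mul_of_nonneg_left hd hL0.le)
        rw [← mul_assoc]
        have c1 : Real.exp (-(lensingExponent m x g s).re)
            ≤ Real.exp (-(kappaStar m ^ 2 / (32 * Real.pi) * ‖s‖ ^ 2 / 2)) := by
          rw [Real.exp_le_exp, neg_le_neg_iff]
          exact (div_le_self (by positivity) (by norm_num)).trans hre
        refine c1.trans (le_mul_of_one_le_left (Real.exp_pos _).le ?_)
        rw [← div_eq_inv_mul, one_le_div (by linarith [h.one_le_log])]
        exact hL
      refine (norm_sub_le _ _).trans ?_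
      rw [norm_pow]
      have : 0 ≤ K₁ * K * (Real.log g)⁻¹ * T := by positivity
      linarith
  refine (norm_sub_le_norm_sub_add_norm_sub _ _ _).trans ((add_le_add h1 h2).trans (le_of_eq ?_))
  ring


lemma measurable_lensingField (m : ℝ) : Measurable fun z : Plane => (m / ‖z‖ ^ 2) • z :=
  (measurable_const.div (measurable_norm.pow_const 2)).smul measurable_id

lemma inner_lensingField_polarPt (m : ℝ) (t : Plane) {r : ℝ} (hr : 0 < r) (θ : ℝ) :
    (⟪(m / ‖polarPt r θ‖ ^ 2) • polarPt r θ, t⟫ : ℝ) = m * dirComp t θ / r := by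
  rw [plane_inner, norm_polarPt hr.le, dirComp]
  simp only [PiLp.smul_apply, smul_eq_mul, polarPt_zero, polarPt_one]
  field_simp

lemma lensingMap_eq_sum (κc γ m : ℝ) {g : ℕ} (ξ : Fin g → Plane) (x : Plane) :
    lensingMap κc γ m ξ x
      = smoothPart κc γ x + ∑ j, (m / ‖ξ j - x‖ ^ 2) • (ξ j - x) := by
  rw [lensingMap, sub_eq_add_neg, ← Finset.sum_neg_distrib]
  congr 1
  refine Finset.sum_congr rfl fun j _ => ?_
  rw [norm_sub_rev, ← smul_neg, neg_sub]

lemma lensingMapApprox_eq_gaussApprox (κc γ m : ℝ) (x : Plane) (g : ℕ) (q : Plane) :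
    lensingMapApprox κc γ m x g q = gaussApprox (smoothPart κc γ x) (kappaStar m • x) (sigma m g)
      (kappaStar m ^ 2 / (4 * Real.pi) * Real.log (Real.log g)) q := by
  simp only [lensingMapApprox, gaussApprox, PiLp.smul_apply, smul_eq_mul]
  ring

lemma lensingMapStarApprox_eq_gaussApprox (κc γ m : ℝ) (x : Plane) (g : ℕ) (q : Plane) :
    lensingMapStarApprox κc γ m x g q = gaussApprox ((√(Real.log g))⁻¹ • smoothPart κc γ x)
      ((kappaStar m / √(Real.log g)) • x) (sigmaStar m g)
      (kappaStar m ^ 2 / (4 * Real.pi) * (Real.log (Real.log g) / Real.log g)) q := by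
  simp only [lensingMapStarApprox, gaussApprox, PiLp.smul_apply, smul_eq_mul]
  ring

lemma gaussCharFun_eq_mul (a β : Plane) (σ d : ℝ) (t : Plane) :
    gaussCharFun a β σ d t = cexp ((⟪a, t⟫ : ℝ) * I) * gaussCharFun 0 β σ d t := by
  simp [gaussCharFun]

lemma gaussCharFun_smul (a β : Plane) (σ d c : ℝ) (t : Plane) :
    gaussCharFun a β σ d (c • t) = gaussCharFun (c • a) (c • β) (σ * c) (d * c ^ 2) t := by
  simp only [gaussCharFun, inner_smul_left, inner_smul_right, norm_smul, mul_pow, Real.norm_eq_abs,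
    sq_abs, conj_trivial]
  rw [mul_assoc (σ ^ 2), mul_assoc d]

section

variable {Ω : ℕ → Type*} [∀ g, MeasurableSpace (Ω g)] (P : ∀ g, Measure (Ω g))
    [∀ g, IsProbabilityMeasure (P g)] (ξ : ∀ g, Fin g → Ω g → Plane)

lemma measurable_lensingMap (κc γ m : ℝ) (x : Plane) (hmeas : ∀ g j, Measurable (ξ g j)) (g : ℕ) :
    Measurable fun ω => lensingMap κc γ m (fun j => ξ g j ω) x := by
  simp only [lensingMap_eq_sum]
  exact (Finset.measurable_sum _ fun j _ =>
    (measurable_lensingField m).comp ((hmeas g j).sub_const x)).const_add _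

lemma charFun_lensingMap (κc γ m : ℝ) (hmeas : ∀ g j, Measurable (ξ g j))
    (hindep : ∀ g, iIndepFun (ξ g) (P g))
    (hunif : ∀ g j,
      pdf.IsUniform (ξ g j) (Metric.closedBall 0 (discRadius g)) (P g) volume)
    {x : Plane} {g : ℕ} (hR : ‖x‖ < discRadius g) (t : Plane) :
    charFun ((P g).map fun ω => lensingMap κc γ m (fun j => ξ g j ω) x) t
      = cexp ((⟪smoothPart κc γ x, t⟫ : ℝ) * I) * radialCharFun 1 2 m (discRadius g) x t ^ g := by
  simp only [lensingMap_eq_sum]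
  rw [charFun_map_sum_uniform hR (measurable_lensingField m) (hmeas g) (hindep g) (hunif g),
    starCharFun_eq_radialCharFun (k := 1) (p := 2) (m := m) (by norm_num) hR]
  intro r θ hr
  simpa using inner_lensingField_polarPt m t hr θ

theorem hasAsymptoticPDF_lensingMapStar (κc γ : ℝ) (hm : 0 < m) (x : Plane)
    (hmeas : ∀ g j, Measurable (ξ g j)) (hindep : ∀ g, iIndepFun (ξ g) (P g))
    (hunif : ∀ g j,
      pdf.IsUniform (ξ g j) (Metric.closedBall 0 (discRadius g)) (P g) volume) :
    HasAsymptoticPDF P (fun g ω => lensingMapStar κc γ m (fun j => ξ g j ω) x)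
      (lensingMapStarApprox κc γ m x) (fun g => 1 / Real.log g) := by
  have hX := measurable_lensingMap ξ κc γ m x hmeas
  obtain ⟨C, hC⟩ := exists_norm_radialCharFun_pow_sub_gaussCharFun_le hm x
  refine hasAsymptoticPDF_of_norm_charFun_sub_le P
    (fun g => Measurable.const_smul (hX g) (√(Real.log g))⁻¹)
    (Q := fun g => gaussCharFun ((√(Real.log g))⁻¹ • smoothPart κc γ x)
      ((kappaStar m / √(Real.log g)) • x) (sigmaStar m g)
      (kappaStar m ^ 2 / (4 * Real.pi) * (Real.log (Real.log g) / Real.log g)))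
    (r := fun _ => 1) (C := C) ?_
  filter_upwards [hC, tendsto_discRadius.eventually_gt_atTop ‖x‖, eventually_manyStars (m := m) x]
    with g hg hR h
  have hσ := h.sigmaStar_pos hm
  refine ⟨one_pos, integrable_gaussCharFun _ _ hσ _, fun q => ?_, fun t => ?_⟩
  · rw [lensingMapStarApprox_eq_gaussApprox, gaussApprox_eq_invCharFun _ _ hσ]
  · have e : charFun ((P g).map ((√(Real.log g))⁻¹ • fun ω =>
          lensingMap κc γ m (fun j => ξ g j ω) x)) t
        = charFun ((P g).map fun ω => lensingMap κc γ m (fun j => ξ g j ω) x)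
          ((√(Real.log g))⁻¹ • t) := charFun_map_smul_comp (hX g).aemeasurable _ _
    rw [e, charFun_lensingMap P ξ κc γ m hmeas hindep hunif hR,
      gaussCharFun_eq_mul, inner_smul_right, inner_smul_left, conj_trivial, ← mul_sub, norm_mul,
      norm_exp_ofReal_mul_I, one_mul]
    simpa using hg t

/-- The estimate for the normalized map at s = √L t, with r = √L: the planar change of scale
improves the error 1/L to 1/L². -/
theorem hasAsymptoticPDF_lensingMap (κc γ : ℝ) (hm : 0 < m) (x : Plane)
    (hmeas : ∀ g j, Measurable (ξ g j)) (hindep : ∀ g, iIndepFun (ξ g) (P g))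
    (hunif : ∀ g j,
      pdf.IsUniform (ξ g j) (Metric.closedBall 0 (discRadius g)) (P g) volume) :
    HasAsymptoticPDF P (fun g ω => lensingMap κc γ m (fun j => ξ g j ω) x)
      (lensingMapApprox κc γ m x) (fun g => 1 / Real.log g ^ 2) := by
  have hX := measurable_lensingMap ξ κc γ m x hmeas
  obtain ⟨C, hC⟩ := exists_norm_radialCharFun_pow_sub_gaussCharFun_le hm x
  refine hasAsymptoticPDF_of_norm_charFun_sub_le P hX
    (Q := fun g => gaussCharFun (smoothPart κc γ x) (kappaStar m • x) (sigma m g)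
      (kappaStar m ^ 2 / (4 * Real.pi) * Real.log (Real.log g)))
    (r := fun g => √(Real.log g)) (C := C) ?_
  filter_upwards [hC, tendsto_discRadius.eventually_gt_atTop ‖x‖, eventually_manyStars (m := m) x]
    with g hg hR h
  have hL0 : 0 < Real.log g := by linarith [h.one_le_log]
  have hs0 : 0 < √(Real.log g) := Real.sqrt_pos.2 hL0
  have hLs : √(Real.log g) ^ 2 = Real.log g := Real.sq_sqrt hL0.le
  have hσ : 0 < sigma m g := mul_pos (h.sigmaStar_pos hm) hs0
  refine ⟨hs0, integrable_gaussCharFun _ _ hσ _, fun q => ?_, fun t => ?_⟩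
  · rw [lensingMapApprox_eq_gaussApprox, gaussApprox_eq_invCharFun _ _ hσ]
  · have ht := hg (√(Real.log g) • t)
    rw [gaussCharFun_smul, smul_zero, smul_smul, smul_smul, inv_mul_cancel₀ hs0.ne', one_smul,
      mul_div_cancel₀ _ hs0.ne', hLs, mul_assoc (kappaStar m ^ 2 / (4 * Real.pi)),
      div_mul_cancel₀ _ hL0.ne', norm_smul, Real.norm_of_nonneg hs0.le] at ht
    rw [charFun_lensingMap P ξ κc γ m hmeas hindep hunif hR, gaussCharFun_eq_mul, ← mul_sub,
      norm_mul, norm_exp_ofReal_mul_I, one_mul, hLs]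
    refine ht.trans (le_of_eq ?_)
    field_simp

end

end LensingMap

end Microlensing

end

/-! ### Assembly of the density expansions. -/

theorem mainTheorem8
    (m κc γ : ℝ) (hm : 0 < m) (hκc : 0 ≤ κc) (hγ : 0 ≤ γ)
    (y x : Microlensing.Plane)
    {Ω : ℕ → Type*} [∀ g, MeasurableSpace (Ω g)] (P : ∀ g, Measure (Ω g))
    [∀ g, IsProbabilityMeasure (P g)]
    (ξ : ∀ g, Fin g → Ω g → Microlensing.Plane)
    (hmeas : ∀ g j, Measurable (ξ g j))
    (hindep : ∀ g, iIndepFun (ξ g) (P g))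
    (hunif : ∀ g j,
      pdf.IsUniform (ξ g j) (Metric.closedBall 0 (Microlensing.discRadius g)) (P g) volume) :
    -- the normalized time delay
    Microlensing.HasAsymptoticPDF P
      (fun g ω => Microlensing.timeDelayStar κc γ m (fun j => ξ g j ω) y x)
      (Microlensing.timeDelayApprox κc γ m y x)
      (fun g => (g : ℝ) ^ (-(3 / 2) : ℝ)) ∧
    -- the lensing map, before and after the normalization
    (Microlensing.HasAsymptoticPDF P
      (fun g ω => Microlensing.lensingMap κc γ m (fun j => ξ g j ω) x)
      (Microlensing.lensingMapApprox κc γ m x)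
      (fun g => 1 / Real.log g ^ 2) ∧
    Microlensing.HasAsymptoticPDF P
      (fun g ω => Microlensing.lensingMapStar κc γ m (fun j => ξ g j ω) x)
      (Microlensing.lensingMapStarApprox κc γ m x)
      (fun g => 1 / Real.log g)) ∧
    -- the shear
    Microlensing.HasAsymptoticPDF P
      (fun g ω => Microlensing.shear m (fun j => ξ g j ω) x)
      (Microlensing.shearApprox m x)
      (fun g => (g : ℝ) ^ (-3 : ℝ)) := by
  exact ⟨Microlensing.hasAsymptoticPDF_timeDelayStar hm y x P ξ hmeas hindep hunif,
    ⟨Microlensing.hasAsymptoticPDF_lensingMap P ξ κc γ hm x hmeas hindep hunif,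
      Microlensing.hasAsymptoticPDF_lensingMapStar P ξ κc γ hm x hmeas hindep hunif⟩,
    Microlensing.hasAsymptoticPDF_shear hm x P ξ hmeas hindep hunif⟩
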